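/- Let $M=[0,\infty)\times\mathbb{R}/2\pi\mathbb{Z}$ with the measure $dx\,dy$, and let $L=-\partial_x^2-(1+x)\partial_y^2$ be the (self-adjoint, Friedrichs) realization in $L^2(M)$ with Dirichlet condition at $x=0$: $u\in L^2(M)$ is in its domain, with $Lu=f\in L^2(M)$, if $u$ lies in the closure of $C_c^\infty((0,\infty)\times\mathbb{R}/2\pi\mathbb{Z})$ for the norm whose square is $\int_M |u|^2+|\partial_xu|^2+(1+x)|\partial_yu|^2\,dx\,dy$ and $Lu=f$ in the sense of distributions on the interior of $M$. Let $$\mathrm{Ai}(s)=\frac1{2\pi}\int_{-\infty}^{\infty}e^{i(sx+x^3/3)}\,dx=\lim_{R\to\infty}\frac1{2\pi}\int_{-R}^{R}e^{i(sx+x^3/3)}\,dx$$ be the Airy function; this limit exists for every real $s$. The real roots of $\mathrm{Ai}(-t)=0$ form an infinite sequence $0<t_1<t_2<\cdots$. For $m\ge 1$ and $n\in\mathbb{Z}\setminus\{0\}$ put, with $n^{2/3}=|n|^{2/3}$ and $n^{4/3}=|n|^{4/3}$, $$\varphi_{m,n}(x,y)=\mathrm{Ai}(n^{2/3}x-t_m)\,e^{iny},\qquad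 \lambda(m,n)=n^2+n^{4/3}t_m .$$ Then the Dirichlet eigenfunctions of $L$ on $$\mathcal H=\Big\{\varphi\in L^2(M):\ \int_{\mathbb{R}/2\pi\mathbb{Z}}\varphi(x,y)\,dy=0 \text{ for almost every } x\Big\}$$ are the functions $\varphi_{m,n}$, with eigenvalues $\lambda(m,n)$, in the following sense. Each $\varphi_{m,n}$ is smooth on $M$, vanishes at $x=0$, satisfies $L\varphi_{m,n}=\lambda(m,n)\varphi_{m,n}$ pointwise, and is a Dirichlet eigenfunction of $L$ in $\mathcal H$ with eigenvalue $\lambda(m,n)$. For every $\mu\in\mathbb{C}$, the Dirichlet eigenfunctions of $L$ in $\mathcal H$ with eigenvalue $\mu$ are exactly the non-zero finite linear combinations of the $\varphi_{m,n}$ with $\lambda(m,n)=\mu$. Finally, the $\varphi_{m,n}$ are pairwise orthogonal and their linear span is dense in $\mathcal H$. -/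

import Mathlib

open MeasureTheory Filter Topology Set
open scoped ContDiff

noncomputable section

namespace Friedlander

/-- The truncated Airy integral `(1 / 2π) ∫_{-R}^{R} exp (i (s x + x³ / 3)) dx`. -/
def airyPartial (s R : ℝ) : ℂ :=
  (1 / (2 * Real.pi) : ℂ) *
    ∫ x in (-R)..R, Complex.exp (Complex.I * ((s : ℂ) * (x : ℂ) + (x : ℂ) ^ 3 / 3))

/-- The Airy function `Ai s = (1 / 2π) ∫_{-∞}^{∞} exp (i (s x + x³ / 3)) dx`, the (conditionally
convergent) integral being the limit of its truncations. -/
def airyAi (s : ℝ) : ℂ :=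
  limUnder atTop (airyPartial s)

/-- The circle `ℝ / 2πℤ`. -/
abbrev Circ : Type := AddCircle (2 * Real.pi)

instance factTwoPiPos : Fact (0 < 2 * Real.pi) := ⟨Real.two_pi_pos⟩

/-- The measure `dx dy` of `M = [0, ∞) × ℝ / 2πℤ`, as a measure on `ℝ × ℝ / 2πℤ` that is
carried by `x ≥ 0`. -/
def vol : Measure (ℝ × Circ) :=
  ((volume : Measure ℝ).restrict (Ici 0)).prod (volume : Measure Circ)

/-- The complex Hilbert space `L²(M)`. -/
abbrev L2 : Type := Lp ℂ 2 vol

/-- Smoothness of a function on `ℝ × ℝ / 2πℤ`: its `2π`-periodic lift to `ℝ × ℝ` is smooth. -/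
def Smooth (ψ : ℝ × Circ → ℂ) : Prop :=
  ContDiff ℝ ∞ (fun p : ℝ × ℝ => ψ (p.1, (p.2 : Circ)))

/-- The partial derivative `∂ψ / ∂x`. -/
def dx (ψ : ℝ × Circ → ℂ) (p : ℝ × Circ) : ℂ :=
  deriv (fun s : ℝ => ψ (s, p.2)) p.1

/-- The partial derivative `∂ψ / ∂y`. -/
def dy (ψ : ℝ × Circ → ℂ) (p : ℝ × Circ) : ℂ :=
  deriv (fun s : ℝ => ψ (p.1, p.2 + (s : Circ))) 0

/-- The differential expression `L = -∂ₓ² - (1 + x) ∂_y²`. -/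
def opL (ψ : ℝ × Circ → ℂ) (p : ℝ × Circ) : ℂ :=
  -dx (dx ψ) p - (1 + (p.1 : ℂ)) * dy (dy ψ) p

/-- Test functions: smooth functions with compact support in the interior
`(0, ∞) × ℝ / 2πℤ` of `M`. -/
structure IsTest (ψ : ℝ × Circ → ℂ) : Prop where
  smooth : Smooth ψ
  compact : HasCompactSupport ψ
  interior : tsupport ψ ⊆ Ioi 0 ×ˢ univ

/-- The form domain of `L` with Dirichlet condition at `x = 0`: the closure of the test functions
for the norm whose square is `∫ |u|² + |∂ₓ u|² + (1 + x) |∂_y u|²`. Thus `u` is the limit in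
`L²(M)` of test functions `ψ k` such that `∂ₓ (ψ k)` and `√(1 + x) ∂_y (ψ k)` converge in
`L²(M)` too (to the limits `g` and `h`). -/
def InFormDomain (u : L2) : Prop :=
  ∃ (g h : L2) (ψ : ℕ → ℝ × Circ → ℂ), (∀ k, IsTest (ψ k)) ∧
    Tendsto (fun k => eLpNorm (fun p => ψ k p - u p) 2 vol) atTop (𝓝 0) ∧
    Tendsto (fun k => eLpNorm (fun p => dx (ψ k) p - g p) 2 vol) atTop (𝓝 0) ∧
    Tendsto (fun k => eLpNorm (fun p => ((Real.sqrt (1 + p.1) : ℝ) : ℂ) * dy (ψ k) p - h p) 2 vol)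
      atTop (𝓝 0)

/-- The graph of the self-adjoint Dirichlet (Friedrichs) realization of `L` in `L²(M)`: `u` lies in
the Dirichlet form domain and `L u = f` in the sense of distributions on the interior of `M`,
where `f ∈ L²(M)`. -/
def DirichletL (u f : L2) : Prop :=
  InFormDomain u ∧ ∀ ψ, IsTest ψ → ∫ p, u p * opL ψ p ∂vol = ∫ p, f p * ψ p ∂vol

/-- `∫ u (x, y) dy = 0` for almost every `x ≥ 0`. -/
def ZeroMean (u : L2) : Prop :=
  ∀ᵐ x ∂(volume : Measure ℝ).restrict (Ici 0), ∫ y : Circ, u (x, y) = 0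

/-- `u` is a Dirichlet eigenfunction of `L`, with eigenvalue `μ`, on the space of all
`u ∈ L²(M)` of zero mean in `y`. -/
structure IsDirichletEigenfunction (μ : ℂ) (u : L2) : Prop where
  ne_zero : u ≠ 0
  zeroMean : ZeroMean u
  eigen : DirichletL u (μ • u)

/-- The function `(x, y) ↦ Ai (n^{2/3} x - τ) e^{i n y}`, where `n^{2/3} = |n|^{2/3}`;
`fourier n` is the character `y ↦ e^{i n y}` of the circle `ℝ / 2πℤ`. -/
def eigenfun (τ : ℝ) (n : ℤ) (p : ℝ × Circ) : ℂ :=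
  airyAi (|(n : ℝ)| ^ (2 / 3 : ℝ) * p.1 - τ) * fourier n p.2

/-- The number `n² + n^{4/3} τ`, where `n^{4/3} = |n|^{4/3}`. -/
def eigenval (τ : ℝ) (n : ℤ) : ℝ :=
  (n : ℝ) ^ 2 + |(n : ℝ)| ^ (4 / 3 : ℝ) * τ

/-- The characters used in `eigenfun` are `y ↦ e^{i n y}`. -/
theorem fourier_eq_exp (n : ℤ) (y : ℝ) :
    fourier n (y : Circ) = Complex.exp (Complex.I * n * y) := by
  rw [fourier_coe_apply]
  congr 1
  have h : (Real.pi : ℂ) ≠ 0 := by exact_mod_cast Real.pi_ne_zero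
  push_cast
  field_simp

end Friedlander

end

open Friedlander

/-! On the Fourier mode `e^{iny}`, `n ≠ 0`, the operator `L` becomes `-∂ₓ² + n²(1 + x)` on the
half-line, and `s = |n|^{2/3} x - τ` turns its eigenvalue equation, with eigenvalue `n² + |n|^{4/3}
τ`, into Airy's equation. The decaying solution is `Ai`, and the Dirichlet condition selects the
roots of `Ai(-τ) = 0`. Eigenfunctions of `L` are not classified directly through an ODE: the
`φ_{m,n}` are shown to be eigenfunctions and to be complete, and completeness with symmetry leaves
room for no others.

Airy function: moving the contour to `Im z = 1` makes the integral absolutely convergent and yields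
smoothness, the bound `C e^{-s}` and Airy's equation (`airyMoment_two`). ODE uniqueness makes the
zeros simple, monotonicity of `Ai Ai'` excludes them from `s ≥ 0`, and oscillation produces
infinitely many (`exists_airy_zeros`).

Completeness in `x`: the Green operator of `-∂ₓ² + (x + 1)` with Dirichlet condition is symmetric,
Hilbert–Schmidt, hence compact, and injective. A Wronskian argument shows that its eigenvectors are
multiples of `Ai(x - t)` with `Ai(-t) = 0` (`eigenvector_greenOp`), so the spectral theorem gives
`ae_eq_zero_of_forall_integral_airyRe`. Dilation and Fourier series in `y` carry this over to `M`
(`inner_eq_zero_of_zeroMean`).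

Eigenspaces: the Dirichlet realization is symmetric (`DirichletL.integral_mul_comm`), so an
eigenfunction for `μ` is orthogonal to each `φ_{m,n}` with `λ(m,n) ≠ μ`. Subtracting its projection
on the finite-dimensional span of the others leaves a zero-mean function orthogonal to the whole
family, hence zero (`mem_eigenspace_iff`). -/

noncomputable section

namespace Friedlander

/-! ### The Airy integral on the contour `Im z = 1` -/

/-- The Airy phase factor `exp (i (s z + z³ / 3))` at a complex point `z`. -/
def airyKernel (s : ℝ) (z : ℂ) : ℂ :=
  Complex.exp (Complex.I * ((s : ℂ) * z + z ^ 3 / 3))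

/-- The `k`-th formal derivative of the Airy integral, on the contour `Im z = 1`. -/
def airyMoment (k : ℕ) (s : ℝ) : ℂ :=
  ∫ x : ℝ, (Complex.I * ((x : ℂ) + Complex.I)) ^ k * airyKernel s ((x : ℂ) + Complex.I)

/-- The cubic phase contributes `-x² y` to the real part of the exponent, so every height `y > 0`
brings Gaussian decay in `x`. -/
theorem norm_airyKernel (s x y : ℝ) :
    ‖airyKernel s ((x : ℂ) + (y : ℂ) * Complex.I)‖ =
      Real.exp (-(s * y) - x ^ 2 * y + y ^ 3 / 3) := by
  rw [airyKernel, Complex.norm_exp]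
  congr 1
  have : Complex.I * ((s : ℂ) * ((x : ℂ) + (y : ℂ) * Complex.I) +
      ((x : ℂ) + (y : ℂ) * Complex.I) ^ 3 / 3) =
      ((-(s * y) - x ^ 2 * y + y ^ 3 / 3 : ℝ) : ℂ) +
        ((s * x + x ^ 3 / 3 - x * y ^ 2 : ℝ) : ℂ) * Complex.I := by
    push_cast
    linear_combination ((s : ℂ) * y + x ^ 2 * y + (x : ℂ) * y ^ 2 * Complex.I
      + y ^ 3 / 3 * (Complex.I ^ 2 - 1)) * Complex.I_sq
  rw [this, Complex.add_re, Complex.ofReal_re, Complex.re_ofReal_mul, Complex.I_re, mul_zero,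
    add_zero]

theorem norm_airyKernel_add_I (s x : ℝ) :
    ‖airyKernel s ((x : ℂ) + Complex.I)‖ = Real.exp (1 / 3 - s) * Real.exp (-x ^ 2) := by
  have := norm_airyKernel s x 1
  rw [Complex.ofReal_one, one_mul] at this
  rw [this, ← Real.exp_add]
  congr 1; ring

theorem differentiable_airyKernel (s : ℝ) : Differentiable ℂ (airyKernel s) := by
  unfold airyKernel; fun_prop

/-- Half of the Gaussian absorbs the polynomial: `t ^ k ≤ k! e^t` at `t = |x| + 1`, and `|x| + 1 ≤ 2
+ x² / 2`. -/
theorem norm_pow_mul_exp_le (k : ℕ) (x : ℝ) :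
    ‖(Complex.I * ((x : ℂ) + Complex.I)) ^ k‖ * Real.exp (-x ^ 2) ≤
      (k.factorial * Real.exp 2) * Real.exp (-(1 / 2) * x ^ 2) := by
  have h1 : ‖(Complex.I * ((x : ℂ) + Complex.I)) ^ k‖ ≤ (|x| + 1) ^ k := by
    rw [norm_pow]
    gcongr
    rw [norm_mul, Complex.norm_I, one_mul]
    refine (norm_add_le _ _).trans ?_
    simp
  have h2 : (|x| + 1) ^ k ≤ k.factorial * Real.exp (|x| + 1) := by
    have := Real.pow_div_factorial_le_exp (|x| + 1) (by positivity) k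
    rwa [div_le_iff₀ (by positivity), mul_comm] at this
  calc _ ≤ (k.factorial * Real.exp (|x| + 1)) * Real.exp (-x ^ 2) := by gcongr; exact h1.trans h2
    _ = k.factorial * Real.exp (|x| + 1 - x ^ 2) := by rw [mul_assoc, ← Real.exp_add]; ring_nf
    _ ≤ k.factorial * Real.exp (2 + -(1 / 2) * x ^ 2) := by
        gcongr
        nlinarith [sq_nonneg (|x| - 1), sq_abs x]
    _ = _ := by rw [Real.exp_add]; ring

theorem integrable_gauss_half (C : ℝ) : Integrable (fun x : ℝ => C * Real.exp (-(1 / 2) * x ^ 2)) :=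
  (integrable_exp_neg_mul_sq (by norm_num)).const_mul C

theorem norm_airyMoment_integrand_le (k : ℕ) (s x : ℝ) :
    ‖(Complex.I * ((x : ℂ) + Complex.I)) ^ k * airyKernel s ((x : ℂ) + Complex.I)‖ ≤
      Real.exp (1 / 3 - s) * (k.factorial * Real.exp 2) * Real.exp (-(1 / 2) * x ^ 2) := by
  rw [norm_mul, norm_airyKernel_add_I]
  calc _ = Real.exp (1 / 3 - s) *
        (‖(Complex.I * ((x : ℂ) + Complex.I)) ^ k‖ * Real.exp (-x ^ 2)) := by ring
    _ ≤ _ := by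
      rw [mul_assoc]
      exact mul_le_mul_of_nonneg_left (norm_pow_mul_exp_le k x) (Real.exp_pos _).le

theorem continuous_airyMoment_integrand (k : ℕ) (s : ℝ) : Continuous (fun x : ℝ =>
    (Complex.I * ((x : ℂ) + Complex.I)) ^ k * airyKernel s ((x : ℂ) + Complex.I)) := by
  have := (differentiable_airyKernel s).continuous
  fun_prop

theorem integrable_airyMoment_integrand (k : ℕ) (s : ℝ) : Integrable (fun x : ℝ =>
    (Complex.I * ((x : ℂ) + Complex.I)) ^ k * airyKernel s ((x : ℂ) + Complex.I)) :=
  (integrable_gauss_half _).mono' (continuous_airyMoment_integrand k s).aestronglyMeasurable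
    (.of_forall (norm_airyMoment_integrand_le k s))

/-- The factor `e^{-s}` is the modulus of `e^{isz}` on `Im z = 1`. The true decay as `s → +∞` is
faster, but exponential decay is all that is needed. -/
theorem exists_norm_airyMoment_le (k : ℕ) :
    ∃ C, 0 ≤ C ∧ ∀ s, ‖airyMoment k s‖ ≤ C * Real.exp (-s) := by
  refine ⟨∫ x : ℝ, Real.exp (1 / 3) * (k.factorial * Real.exp 2) * Real.exp (-(1 / 2) * x ^ 2),
    integral_nonneg fun x => by positivity, fun s => ?_⟩
  rw [← integral_mul_const]
  refine norm_integral_le_of_norm_le ((integrable_gauss_half _).mul_const _)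
    (.of_forall fun x => (norm_airyMoment_integrand_le k s x).trans (le_of_eq ?_))
  rw [sub_eq_add_neg, Real.exp_add]; ring

theorem hasDerivAt_airyMoment (k : ℕ) (s : ℝ) :
    HasDerivAt (airyMoment k) (airyMoment (k + 1) s) s := by
  refine (hasDerivAt_integral_of_dominated_loc_of_deriv_le (𝕜 := ℝ) (s := Metric.ball s 1)
    (bound := fun x : ℝ => Real.exp (1 / 3 - (s - 1)) * ((k + 1).factorial * Real.exp 2) *
      Real.exp (-(1 / 2) * x ^ 2))
    (F := fun s x => (Complex.I * ((x : ℂ) + Complex.I)) ^ k *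
      airyKernel s ((x : ℂ) + Complex.I))
    (F' := fun s x => (Complex.I * ((x : ℂ) + Complex.I)) ^ (k + 1) *
      airyKernel s ((x : ℂ) + Complex.I)) (Metric.ball_mem_nhds s one_pos)
    (.of_forall fun s => (continuous_airyMoment_integrand k s).aestronglyMeasurable)
    (integrable_airyMoment_integrand k s)
    (continuous_airyMoment_integrand (k + 1) s).aestronglyMeasurable
    (.of_forall fun x r hr => ?_) (integrable_gauss_half _) (.of_forall fun x r _ => ?_)).2
  · refine (norm_airyMoment_integrand_le (k + 1) r x).trans ?_
    gcongr
    rw [Metric.mem_ball, Real.dist_eq, abs_lt] at hr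
    linarith
  · have h : HasDerivAt (fun r : ℝ => Complex.I * ((r : ℂ) * ((x : ℂ) + Complex.I) +
        ((x : ℂ) + Complex.I) ^ 3 / 3)) (Complex.I * (1 * ((x : ℂ) + Complex.I))) r :=
      (((hasDerivAt_id r).ofReal_comp.mul_const _).add_const _).const_mul _
    convert! (h.cexp.const_mul ((Complex.I * ((x : ℂ) + Complex.I)) ^ k)) using 1
    simp only [airyKernel]
    ring

/-- This is Airy's equation. The function `i (s + z²) e^{i(sz + z³/3)}` is the derivative of a
decaying function, so its integral is zero, and the second moment carries `(iz)² = -z²`. -/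
theorem airyMoment_two (s : ℝ) : airyMoment 2 s = s * airyMoment 0 s := by
  have hd : ∀ x : ℝ, HasDerivAt (fun x : ℝ => airyKernel s ((x : ℂ) + Complex.I))
      (Complex.I * (s + ((x : ℂ) + Complex.I) ^ 2) * airyKernel s ((x : ℂ) + Complex.I)) x := by
    intro x
    have h0 : HasDerivAt (fun x : ℝ => (x : ℂ) + Complex.I) 1 x :=
      (hasDerivAt_id x).ofReal_comp.add_const _
    have h : HasDerivAt (fun x : ℝ => Complex.I * ((s : ℂ) * ((x : ℂ) + Complex.I) +
        ((x : ℂ) + Complex.I) ^ 3 / 3)) (Complex.I * (s * 1 +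
          (3 : ℕ) * ((x : ℂ) + Complex.I) ^ 2 * 1 / 3)) x := by
      have := (((h0.const_mul (s : ℂ)).add ((h0.pow 3).div_const 3)).const_mul Complex.I)
      exact this
    convert! h.cexp using 1
    simp only [airyKernel]
    push_cast
    ring
  have hi : Integrable (fun x : ℝ => Complex.I * (s + ((x : ℂ) + Complex.I) ^ 2) *
      airyKernel s ((x : ℂ) + Complex.I)) := by
    convert! ((integrable_airyMoment_integrand 0 s).const_mul (Complex.I * s)).sub
      ((integrable_airyMoment_integrand 2 s).const_mul Complex.I) using 2 with x
    simp only [Pi.sub_apply]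
    linear_combination (Complex.I) * ((x : ℂ) + Complex.I) ^ 2 *
      airyKernel s ((x : ℂ) + Complex.I) * Complex.I_sq
  have h0 : Integrable (fun x : ℝ => airyKernel s ((x : ℂ) + Complex.I)) := by
    simpa using integrable_airyMoment_integrand 0 s
  have key := integral_eq_zero_of_hasDerivAt_of_integrable hd hi h0
  have : (Complex.I * s) * airyMoment 0 s - Complex.I * airyMoment 2 s = 0 := by
    rw [airyMoment, airyMoment, ← integral_const_mul, ← integral_const_mul, ← integral_sub
      ((integrable_airyMoment_integrand 0 s).const_mul (Complex.I * s))
      ((integrable_airyMoment_integrand 2 s).const_mul Complex.I), ← key]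
    congr 1; ext x
    linear_combination (-Complex.I) * ((x : ℂ) + Complex.I) ^ 2 *
      airyKernel s ((x : ℂ) + Complex.I) * Complex.I_sq
  have hI := Complex.I_ne_zero
  apply mul_left_cancel₀ hI
  linear_combination -this

/-- The modulus decays like `exp (-R² y)` for each `y > 0`, though not uniformly as `y → 0`, so
dominated convergence is used. The sign `σ` covers both vertical sides of the rectangle. -/
theorem tendsto_vertical (s : ℝ) (σ : ℝ) (hσ : σ ^ 2 = 1) :
    Tendsto (fun R : ℝ => ∫ y in (0 : ℝ)..1, airyKernel s (((σ * R : ℝ) : ℂ) + y * Complex.I))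
      atTop (𝓝 0) := by
  have := intervalIntegral.tendsto_integral_filter_of_dominated_convergence (μ := volume)
    (a := (0 : ℝ)) (b := 1) (l := (atTop : Filter ℝ))
    (F := fun (R : ℝ) (y : ℝ) => airyKernel s (((σ * R : ℝ) : ℂ) + y * Complex.I))
    (f := fun _ => 0) (fun _ => Real.exp (|s| + 1 / 3)) ?_ ?_ ?_ ?_
  · simpa using this
  · refine .of_forall fun R => Continuous.aestronglyMeasurable ?_
    have := (differentiable_airyKernel s).continuous
    fun_prop
  · refine .of_forall fun R => .of_forall fun y hy => ?_
    rw [uIoc_of_le zero_le_one] at hy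
    rw [norm_airyKernel]
    apply Real.exp_le_exp.mpr
    have h1 : -(s * y) ≤ |s| := by
      refine (neg_le_abs _).trans ?_
      rw [abs_mul, abs_of_pos hy.1]
      exact mul_le_of_le_one_right (abs_nonneg _) hy.2
    have h2 : y ^ 3 ≤ 1 := pow_le_one₀ hy.1.le hy.2
    have h3 : 0 ≤ (σ * R) ^ 2 * y := mul_nonneg (sq_nonneg _) hy.1.le
    linarith
  · exact intervalIntegrable_const
  · refine .of_forall fun y hy => ?_
    rw [uIoc_of_le zero_le_one] at hy
    rw [tendsto_zero_iff_norm_tendsto_zero]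
    simp_rw [norm_airyKernel]
    apply Real.tendsto_exp_atBot.comp
    have : Tendsto (fun R : ℝ => (-(s * y) + y ^ 3 / 3) + -(R ^ 2 * y)) atTop atBot := by
      apply tendsto_atBot_add_const_left
      apply tendsto_neg_atTop_atBot.comp
      exact (tendsto_pow_atTop (two_ne_zero)).atTop_mul_const hy.1
    refine this.congr fun R => ?_
    rw [mul_pow, hσ]; ring

/-- Cauchy's theorem on `[-R, R] × [0, 1]`: the real segment equals the raised one up to the two
vertical sides, which vanish in the limit. -/
theorem tendsto_airyPartial_moment (s : ℝ) :
    Tendsto (airyPartial s) atTop (𝓝 ((1 / (2 * Real.pi) : ℂ) * airyMoment 0 s)) := by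
  unfold airyPartial
  apply Tendsto.const_mul
  have h1 : Tendsto (fun R : ℝ => ∫ x in (-R)..R, airyKernel s ((x : ℂ) + Complex.I)) atTop
      (𝓝 (airyMoment 0 s)) := by
    have h0 : Integrable (fun x : ℝ => airyKernel s ((x : ℂ) + Complex.I)) := by
      simpa using integrable_airyMoment_integrand 0 s
    have := intervalIntegral_tendsto_integral h0 tendsto_neg_atTop_atBot tendsto_id
    simpa [airyMoment] using this
  have h2 := (tendsto_vertical s 1 (by norm_num)).const_mul Complex.I
  have h3 := (tendsto_vertical s (-1) (by norm_num)).const_mul Complex.I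
  have h4 := (h1.sub h2).add h3
  simp only [mul_zero, sub_zero, add_zero] at h4
  refine h4.congr fun R => ?_
  have := Complex.integral_boundary_rect_eq_zero_of_differentiableOn (airyKernel s)
    (((-R : ℝ) : ℂ)) ((R : ℂ) + Complex.I) (differentiable_airyKernel s).differentiableOn
  simp only [Complex.ofReal_re, Complex.ofReal_im, Complex.add_re, Complex.add_im, Complex.I_re,
    Complex.I_im, add_zero, zero_add, Complex.ofReal_zero, zero_mul, Complex.ofReal_one, one_mul,
    smul_eq_mul] at this
  have e : ∀ x : ℝ, airyKernel s x =
      Complex.exp (Complex.I * ((s : ℂ) * (x : ℂ) + (x : ℂ) ^ 3 / 3)) :=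
    fun x => rfl
  simp_rw [← e]
  simp only [one_mul, neg_mul]
  linear_combination -this

theorem airyAi_eq_moment (s : ℝ) : airyAi s = (1 / (2 * Real.pi) : ℂ) * airyMoment 0 s :=
  (tendsto_airyPartial_moment s).limUnder_eq

theorem tendsto_airyPartial (s : ℝ) : Tendsto (airyPartial s) atTop (𝓝 (airyAi s)) := by
  rw [airyAi_eq_moment]; exact tendsto_airyPartial_moment s

/-- The substitution `x ↦ -x` conjugates the integrand and preserves the symmetric truncation, so
`Ai` is real. -/
theorem conj_airyPartial (s R : ℝ) : (starRingEnd ℂ) (airyPartial s R) = airyPartial s R := by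
  have h := intervalIntegral.integral_comp_neg (a := -R) (b := R)
    (fun x : ℝ => Complex.exp (Complex.I * ((s : ℂ) * (x : ℂ) + (x : ℂ) ^ 3 / 3)))
  rw [neg_neg] at h
  unfold airyPartial
  have hc : ∀ f : ℝ → ℂ, (starRingEnd ℂ) (∫ x in (-R)..R, f x) =
      ∫ x in (-R)..R, (starRingEnd ℂ) (f x) := fun f => by
    simp only [intervalIntegral, map_sub, integral_conj]
  rw [map_mul, hc, ← h]
  congr 1
  · simp only [map_div₀, map_mul, map_one, Complex.conj_ofReal, Complex.conj_ofNat]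
  · congr 1; ext x
    rw [← Complex.exp_conj]
    congr 1
    simp only [map_mul, map_add, map_div₀, map_pow, Complex.conj_I, Complex.conj_ofReal,
      Complex.ofReal_neg, map_ofNat]
    ring

/-- The Airy function as a real-valued function. -/
def airyRe (s : ℝ) : ℝ := (airyAi s).re

/-- The derivative of the Airy function. -/
def airyDeriv (s : ℝ) : ℝ := ((1 / (2 * Real.pi) : ℂ) * airyMoment 1 s).re

theorem airyAi_eq_ofReal (s : ℝ) : airyAi s = (airyRe s : ℂ) := by
  have h1 := (Complex.continuous_conj.tendsto _).comp (tendsto_airyPartial s)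
  have h2 : (starRingEnd ℂ) (airyAi s) = airyAi s :=
    tendsto_nhds_unique h1 ((tendsto_airyPartial s).congr fun R => (conj_airyPartial s R).symm)
  exact (Complex.conj_eq_iff_re.mp h2).symm

theorem hasDerivAt_airyRe (s : ℝ) : HasDerivAt airyRe (airyDeriv s) s := by
  have h := ((hasDerivAt_airyMoment 0 s).const_mul (1 / (2 * Real.pi) : ℂ))
  have h2 : airyRe = fun s => ((1 / (2 * Real.pi) : ℂ) * airyMoment 0 s).re := by
    ext s; rw [airyRe, airyAi_eq_moment]
  rw [h2]
  exact Complex.reCLM.hasFDerivAt.comp_hasDerivAt s h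

theorem hasDerivAt_airyDeriv (s : ℝ) : HasDerivAt airyDeriv (s * airyRe s) s := by
  have h := ((hasDerivAt_airyMoment 1 s).const_mul (1 / (2 * Real.pi) : ℂ))
  have h3 := Complex.reCLM.hasFDerivAt.comp_hasDerivAt s h
  convert! h3 using 1
  rw [airyRe, airyAi_eq_moment, Complex.reCLM_apply, airyMoment_two, ← Complex.re_ofReal_mul]
  congr 1; ring

theorem exists_abs_airyRe_le : ∃ C, 0 ≤ C ∧ ∀ s, |airyRe s| ≤ C * Real.exp (-s) := by
  obtain ⟨C, hC, h⟩ := exists_norm_airyMoment_le 0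
  refine ⟨‖(1 / (2 * Real.pi) : ℂ)‖ * C, by positivity, fun s => ?_⟩
  rw [airyRe, airyAi_eq_moment, mul_assoc]
  refine (Complex.abs_re_le_norm _).trans ?_
  rw [norm_mul]
  gcongr
  exact h s

theorem exists_abs_airyDeriv_le : ∃ C, 0 ≤ C ∧ ∀ s, |airyDeriv s| ≤ C * Real.exp (-s) := by
  obtain ⟨C, hC, h⟩ := exists_norm_airyMoment_le 1
  refine ⟨‖(1 / (2 * Real.pi) : ℂ)‖ * C, by positivity, fun s => ?_⟩
  rw [airyDeriv, mul_assoc]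
  refine (Complex.abs_re_le_norm _).trans ?_
  rw [norm_mul]
  gcongr
  exact h s

-- Up to the factor `e^{-s}` and a rescaling, `Ai` is the Fourier transform of the continuous
-- integrable function `x ↦ airyKernel 0 (x + i)`. If `Ai` vanished identically, Fourier inversion
-- would make an exponential vanish.
open FourierTransform in
theorem exists_airyRe_ne_zero : ∃ s, airyRe s ≠ 0 := by
  by_contra! h
  have h0 : ∀ s, airyMoment 0 s = 0 := by
    intro s
    have h1 := airyAi_eq_moment s
    rw [airyAi_eq_ofReal, h, Complex.ofReal_zero] at h1
    have : (1 / (2 * Real.pi) : ℂ) ≠ 0 := by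
      have := Real.pi_ne_zero
      simp [this]
    exact (mul_eq_zero.mp h1.symm).resolve_left this
  have e : ∀ (s x : ℝ), airyKernel s ((x : ℂ) + Complex.I) =
      Complex.exp (-s) * (Complex.exp (Complex.I * s * x) * airyKernel 0 ((x : ℂ) + Complex.I)) := by
    intro s x
    simp only [airyKernel, ← Complex.exp_add]
    congr 1
    push_cast
    linear_combination (s : ℂ) * Complex.I_sq
  have hc : Continuous (fun x : ℝ => airyKernel 0 ((x : ℂ) + Complex.I)) := by
    simpa using continuous_airyMoment_integrand 0 0
  have hi : Integrable (fun x : ℝ => airyKernel 0 ((x : ℂ) + Complex.I)) := by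
    simpa using integrable_airyMoment_integrand 0 0
  have hF : 𝓕 (fun x : ℝ => airyKernel 0 ((x : ℂ) + Complex.I)) = 0 := by
    ext w
    rw [Real.fourier_real_eq_integral_exp_smul, Pi.zero_apply]
    have h1 := h0 (-2 * Real.pi * w)
    simp only [airyMoment, pow_zero, one_mul, e (-2 * Real.pi * w)] at h1
    rw [integral_const_mul] at h1
    have h2 := (mul_eq_zero.mp h1).resolve_left (Complex.exp_ne_zero _)
    rw [← h2]
    congr 1; ext x
    rw [smul_eq_mul]
    congr 2
    push_cast; ring
  have hinv := hc.fourierInv_fourier_eq hi (by rw [hF]; exact integrable_zero _ _ _)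
  have h1 := congrFun hinv 0
  rw [hF] at h1
  have h2 : 𝓕⁻ (0 : ℝ → ℂ) 0 = 0 := by
    rw [Real.fourierInv_eq]; simp
  rw [h2] at h1
  exact Complex.exp_ne_zero _ h1.symm

/-- Airy's equation expresses the derivatives of the pair through the pair itself, so the two
functions gain regularity together. -/
theorem contDiff_airyRe_airyDeriv (n : ℕ) : ContDiff ℝ n airyRe ∧ ContDiff ℝ n airyDeriv := by
  induction n with
  | zero =>
    simp only [Nat.cast_zero, contDiff_zero]
    exact ⟨continuous_iff_continuousAt.2 fun s => (hasDerivAt_airyRe s).continuousAt,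
      continuous_iff_continuousAt.2 fun s => (hasDerivAt_airyDeriv s).continuousAt⟩
  | succ n ih =>
    have h1 : deriv airyRe = airyDeriv := funext fun s => (hasDerivAt_airyRe s).deriv
    have h2 : deriv airyDeriv = fun s => s * airyRe s :=
      funext fun s => (hasDerivAt_airyDeriv s).deriv
    rw [Nat.cast_add, Nat.cast_one, contDiff_succ_iff_deriv, contDiff_succ_iff_deriv, h1, h2]
    exact ⟨⟨fun s => (hasDerivAt_airyRe s).differentiableAt, by simp, ih.2⟩,
      ⟨fun s => (hasDerivAt_airyDeriv s).differentiableAt, by simp, contDiff_id.mul ih.1⟩⟩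

theorem contDiff_airyRe : ContDiff ℝ ∞ airyRe :=
  contDiff_infty.2 fun n => (contDiff_airyRe_airyDeriv n).1

theorem continuous_airyRe : Continuous airyRe := contDiff_airyRe.continuous

theorem continuous_airyDeriv : Continuous airyDeriv :=
  ((contDiff_airyRe_airyDeriv 0).2).continuous

/-! ### ODE uniqueness and the zeros of the Airy function -/

theorem sub_le_mul_sub_of_hasDerivAt_le {f f' : ℝ → ℝ} {a C : ℝ}
    (hf : ∀ x, a ≤ x → HasDerivAt f (f' x) x) (hC : ∀ x, a ≤ x → f' x ≤ C) {x : ℝ} (hx : a ≤ x) :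
    f x - f a ≤ C * (x - a) := by
  have h : AntitoneOn (fun x => f x - C * x) (Ici a) := by
    refine antitoneOn_of_hasDerivWithinAt_nonpos (f' := fun x => f' x - C * 1) (convex_Ici a)
      (fun x hx => ?_) (fun x hx => ?_) (fun x hx => ?_)
    · exact ((hf x hx).continuousAt.sub (by fun_prop)).continuousWithinAt
    · rw [interior_Ici] at hx
      exact ((hf x (le_of_lt hx)).sub ((hasDerivAt_id x).const_mul C)).hasDerivWithinAt
    · rw [interior_Ici] at hx
      have := hC x (le_of_lt hx)
      linarith
  have := h (mem_Ici.2 le_rfl) (mem_Ici.2 hx) hx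
  simp only at this
  linarith

/-- Uniqueness for the initial value problem `y'' = p y`, `y 0 = y' 0 = 0` on `[0, ∞)`. -/
theorem eq_zero_of_second_order_ode {y y' p : ℝ → ℝ} (hp : ContinuousOn p (Ici 0))
    (hy : ContinuousOn y (Ici 0)) (hy' : ContinuousOn y' (Ici 0))
    (d : ∀ x, 0 < x → HasDerivAt y (y' x) x) (d' : ∀ x, 0 < x → HasDerivAt y' (p x * y x) x)
    (h0 : y 0 = 0) (h0' : y' 0 = 0) {b : ℝ} (hb : 0 ≤ b) : y b = 0 ∧ y' b = 0 := by
  obtain ⟨M, hM⟩ := isCompact_Icc.exists_bound_of_continuousOn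
    (hp.mono (Icc_subset_Ici_self : Icc 0 b ⊆ Ici 0))
  have hsub : Icc 0 b ⊆ Ici (0 : ℝ) := Icc_subset_Ici_self
  -- With `|p| ≤ M` on `[0, b]`, `(y² + y'²)' = 2 (1 + p) y y' ≤ (1 + M)(y² + y'²)`. The exponential
  -- weight therefore makes the energy decrease from its value `0`; no derivative at `0` is
  -- required.
  have h : AntitoneOn (fun x => (y x ^ 2 + y' x ^ 2) * Real.exp (-(1 + M) * x)) (Icc 0 b) := by
    refine antitoneOn_of_hasDerivWithinAt_nonpos (f' := fun x =>
      ((2 : ℕ) * y x ^ 1 * y' x + (2 : ℕ) * y' x ^ 1 * (p x * y x)) * Real.exp (-(1 + M) * x) +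
        (y x ^ 2 + y' x ^ 2) * (Real.exp (-(1 + M) * x) * (-(1 + M) * 1))) (convex_Icc 0 b)
      ?_ (fun x hx => ?_) (fun x hx => ?_)
    · exact (((hy.mono hsub).pow 2).add ((hy'.mono hsub).pow 2)).mul (by fun_prop)
    · rw [interior_Icc] at hx
      exact ((((d x hx.1).pow 2).add ((d' x hx.1).pow 2)).mul
        ((hasDerivAt_id x).const_mul (-(1 + M))).exp).hasDerivWithinAt
    · rw [interior_Icc] at hx
      have hpx := hM x ⟨hx.1.le, hx.2.le⟩
      rw [Real.norm_eq_abs, abs_le] at hpx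
      have : (2 : ℕ) * y x ^ 1 * y' x + (2 : ℕ) * y' x ^ 1 * (p x * y x) -
          (1 + M) * (y x ^ 2 + y' x ^ 2) ≤ 0 := by
        push_cast
        nlinarith [sq_nonneg (y x - y' x), sq_nonneg (y x + y' x),
          mul_nonneg (sub_nonneg.2 hpx.2) (sq_nonneg (y x + y' x)),
          mul_nonneg (sub_nonneg.2 hpx.1) (sq_nonneg (y x - y' x))]
      have h2 := mul_nonpos_of_nonpos_of_nonneg this (Real.exp_pos (-(1 + M) * x)).le
      linarith
  have h1 := h (left_mem_Icc.2 hb) (right_mem_Icc.2 hb) hb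
  simp only [h0, h0', ne_eq, OfNat.ofNat_ne_zero, not_false_eq_true, zero_pow, add_zero,
    zero_mul] at h1
  have h2 : y b ^ 2 + y' b ^ 2 ≤ 0 := by
    by_contra! hc
    have := mul_pos hc (Real.exp_pos (-(1 + M) * b))
    linarith
  constructor <;> nlinarith [sq_nonneg (y b), sq_nonneg (y' b)]

/-- Zeros of `Ai` are simple: a common zero of `Ai` and `Ai'` would force `Ai = 0` everywhere, by
uniqueness run to the right (`σ = 1`) and to the left (`σ = -1`). -/
theorem airyDeriv_ne_zero {s : ℝ} (hs : airyRe s = 0) : airyDeriv s ≠ 0 := by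
  intro hs'
  obtain ⟨r, hr⟩ := exists_airyRe_ne_zero
  apply hr
  have hc := continuous_airyRe
  have hc' := continuous_airyDeriv
  have inner : ∀ σ : ℝ, σ ^ 2 = 1 → ∀ b, 0 ≤ b → airyRe (s + σ * b) = 0 := by
    intro σ hσ b hb
    have hl : ∀ x : ℝ, HasDerivAt (fun x => s + σ * x) σ x := fun x => by
      simpa using ((hasDerivAt_id x).const_mul σ).const_add s
    refine (eq_zero_of_second_order_ode (y := fun x => airyRe (s + σ * x))
      (y' := fun x => airyDeriv (s + σ * x) * σ) (p := fun x => s + σ * x)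
      (by fun_prop) (by fun_prop) (by fun_prop)
      (fun x _ => (hasDerivAt_airyRe _).comp x (hl x)) (fun x _ => ?_) (by simpa using hs)
      (by simp [hs']) hb).1
    convert! ((hasDerivAt_airyDeriv _).comp x (hl x)).mul_const σ using 1
    linear_combination (-(s + σ * x) * airyRe (s + σ * x)) * hσ
  rcases le_total s r with h | h
  · simpa using inner 1 (by norm_num) (r - s) (by linarith)
  · simpa using inner (-1) (by norm_num) (s - r) (by linarith)

theorem tendsto_airyRe : Tendsto airyRe atTop (𝓝 0) := by
  obtain ⟨C, -, h⟩ := exists_abs_airyRe_le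
  refine squeeze_zero_norm h ?_
  simpa using Real.tendsto_exp_neg_atTop_nhds_zero.const_mul C

theorem tendsto_airyDeriv : Tendsto airyDeriv atTop (𝓝 0) := by
  obtain ⟨C, -, h⟩ := exists_abs_airyDeriv_le
  refine squeeze_zero_norm h ?_
  simpa using Real.tendsto_exp_neg_atTop_nhds_zero.const_mul C

theorem tendsto_mul_airyRe : Tendsto (fun s => s * airyRe s) atTop (𝓝 0) := by
  obtain ⟨C, -, h⟩ := exists_abs_airyRe_le
  refine squeeze_zero_norm' (a := fun s => C * (s ^ 1 * Real.exp (-s))) ?_ ?_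
  · filter_upwards [eventually_ge_atTop 0] with s hs
    rw [norm_mul, Real.norm_of_nonneg hs, Real.norm_eq_abs]
    nlinarith [mul_le_mul_of_nonneg_left (h s) hs]
  · simpa using (Real.tendsto_pow_mul_exp_neg_atTop_nhds_zero 1).const_mul C

/-- The function `Ai'² - s Ai²` has derivative `-Ai²` and limit `0` at `+∞`. The resulting `√s |Ai|
≤ |Ai'|` drives the Green kernel estimates. -/
theorem mul_airyRe_sq_le (s : ℝ) : s * airyRe s ^ 2 ≤ airyDeriv s ^ 2 := by
  have hd : ∀ x, HasDerivAt (fun s => airyDeriv s ^ 2 - s * airyRe s ^ 2) (-airyRe x ^ 2) x := by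
    intro x
    convert! ((hasDerivAt_airyDeriv x).pow 2).sub
      ((hasDerivAt_id x).mul ((hasDerivAt_airyRe x).pow 2)) using 1
    simp only [id, Pi.pow_apply]
    push_cast; ring
  have ha : Antitone (fun s => airyDeriv s ^ 2 - s * airyRe s ^ 2) :=
    antitone_of_hasDerivAt_nonpos hd fun x => neg_nonpos.2 (sq_nonneg _)
  have hl : Tendsto (fun s => airyDeriv s ^ 2 - s * airyRe s ^ 2) atTop (𝓝 0) := by
    have := (tendsto_airyDeriv.pow 2).sub (tendsto_mul_airyRe.mul tendsto_airyRe)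
    simp only [ne_eq, OfNat.ofNat_ne_zero, not_false_eq_true, zero_pow, mul_zero, sub_zero] at this
    exact this.congr fun s => by ring
  have := ha.le_of_tendsto hl s
  linarith

/-- On `[0, ∞)` the product `Ai Ai'` has derivative `Ai'² + s Ai²`, positive in the interior, and
limit `0` at infinity. Comparison with the point `s + 1` makes the inequality strict. -/
theorem airyRe_mul_airyDeriv_neg {s : ℝ} (hs : 0 ≤ s) : airyRe s * airyDeriv s < 0 := by
  have hd : ∀ x, HasDerivAt (fun s => airyRe s * airyDeriv s)
      (airyDeriv x * airyDeriv x + airyRe x * (x * airyRe x)) x := fun x =>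
    (hasDerivAt_airyRe x).mul (hasDerivAt_airyDeriv x)
  have hm : StrictMonoOn (fun s => airyRe s * airyDeriv s) (Ici 0) := by
    refine strictMonoOn_of_hasDerivWithinAt_pos (convex_Ici 0)
      (continuous_airyRe.mul continuous_airyDeriv).continuousOn
      (fun x _ => (hd x).hasDerivWithinAt) fun x hx => ?_
    rw [interior_Ici, mem_Ioi] at hx
    by_cases h : airyRe x = 0
    · have := airyDeriv_ne_zero h
      rw [h]
      simpa using mul_self_pos.2 this
    · have : 0 < airyRe x ^ 2 := by positivity
      nlinarith [mul_self_nonneg (airyDeriv x), mul_pos hx this]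
  have hl : Tendsto (fun s => airyRe s * airyDeriv s) atTop (𝓝 0) := by
    simpa using tendsto_airyRe.mul tendsto_airyDeriv
  have h1 : airyRe (s + 1) * airyDeriv (s + 1) ≤ 0 := by
    refine ge_of_tendsto hl ?_
    filter_upwards [eventually_ge_atTop (s + 1)] with r hr
    exact hm.monotoneOn (mem_Ici.2 (by linarith)) (mem_Ici.2 (by linarith)) hr
  exact (hm (mem_Ici.2 hs) (mem_Ici.2 (by linarith)) (by linarith : s < s + 1)).trans_le h1

theorem airyRe_ne_zero {s : ℝ} (hs : 0 ≤ s) : airyRe s ≠ 0 := fun h => by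
  have := airyRe_mul_airyDeriv_neg hs
  rw [h, zero_mul] at this
  exact lt_irrefl _ this

/-- A solution of `g'' = -t g` cannot stay positive. -/
theorem not_forall_pos_of_oscillating {g g' : ℝ → ℝ} {a : ℝ} (ha : 1 ≤ a)
    (d : ∀ t, HasDerivAt g (g' t) t) (d' : ∀ t, HasDerivAt g' (-(t * g t)) t)
    (hpos : ∀ t, a ≤ t → 0 < g t) : False := by
  have hanti : ∀ r t, a ≤ r → r ≤ t → g' t ≤ g' r := by
    intro r t hr hrt
    have := sub_le_mul_sub_of_hasDerivAt_le (a := r) (C := 0) (fun x _ => d' x)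
      (fun x hx => by have := hpos x (hr.trans hx); nlinarith) hrt
    linarith
  have hnn : ∀ t, a ≤ t → 0 ≤ g' t := by
    intro t ht
    by_contra! hneg
    -- This abscissa is where the tangent at `t` meets zero; `g` is concave, so it lies below that
    -- tangent.
    have hx : t ≤ t + g t / (-g' t) := by
      have := hpos t ht
      have : 0 < g t / (-g' t) := div_pos this (by linarith)
      linarith
    have h1 := sub_le_mul_sub_of_hasDerivAt_le (a := t) (C := g' t) (fun x _ => d x)
      (fun x hx => hanti t x ht hx) hx
    have h2 : g' t * (t + g t / (-g' t) - t) = -g t := by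
      have := hneg.ne
      rw [add_sub_cancel_left, div_neg, mul_neg, mul_div_cancel₀ _ this]
    rw [h2] at h1
    have := hpos _ (ht.trans hx)
    linarith
  have hmono : ∀ t, a ≤ t → g a ≤ g t := by
    intro t ht
    have := sub_le_mul_sub_of_hasDerivAt_le (f := fun x => -g x) (a := a) (C := 0)
      (fun x _ => (d x).neg) (fun x hx => by have := hnn x hx; linarith) ht
    linarith
  have hga := hpos a le_rfl
  -- Now `g ≥ g a` and `a ≥ 1` give `g'' ≤ -g a`, so by this abscissa `g'` has dropped to at most
  -- `-1`.
  have hx : a ≤ a + (g' a + 1) / g a := by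
    have := hnn a le_rfl
    have : 0 < (g' a + 1) / g a := by positivity
    linarith
  have h1 := sub_le_mul_sub_of_hasDerivAt_le (a := a) (C := -g a) (fun x _ => d' x)
    (fun x hx => by nlinarith [hmono x hx]) hx
  have h2 : -g a * (a + (g' a + 1) / g a - a) = -(g' a + 1) := by
    field_simp
    ring
  rw [h2] at h1
  have := hnn _ hx
  linarith

theorem hasDerivAt_airyRe_neg (t : ℝ) :
    HasDerivAt (fun t => airyRe (-t)) (-airyDeriv (-t)) t := by
  convert! (hasDerivAt_airyRe (-t)).comp t (hasDerivAt_neg t) using 1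
  ring

/-- Without zeros beyond `T`, the function `g t = Ai (-t)` would keep one sign there, although `g''
= -t g`; replacing `g` by `-g` reduces to the positive case. -/
theorem exists_airy_zero_gt (T : ℝ) : ∃ t, T < t ∧ airyRe (-t) = 0 := by
  by_contra! h
  set a := max T 1 + 1 with ha
  have hTa : T < a := by have := le_max_left T 1; linarith
  have ha1 : 1 ≤ a := by have := le_max_right T 1; linarith
  have d : ∀ t, HasDerivAt (fun t => airyRe (-t)) (-airyDeriv (-t)) t :=
    hasDerivAt_airyRe_neg
  have d' : ∀ t, HasDerivAt (fun t => -airyDeriv (-t)) (-(t * airyRe (-t))) t := fun t => by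
    convert! ((hasDerivAt_airyDeriv (-t)).comp t (hasDerivAt_neg t)).neg using 1
    ring
  have hc : ContinuousOn (fun t => airyRe (-t)) (Ici a) :=
    (continuous_airyRe.comp continuous_neg).continuousOn
  have hne : ∀ t ∈ Ici a, airyRe (-t) ≠ 0 := fun t ht => h t (hTa.trans_le ht)
  have hsign : (∀ t ∈ Ici a, 0 < airyRe (-t)) ∨ (∀ t ∈ Ici a, airyRe (-t) < 0) := by
    by_contra! hcon
    obtain ⟨⟨r, hr, hr'⟩, ⟨t, ht, ht'⟩⟩ := hcon
    obtain ⟨z, hz, hz'⟩ := isPreconnected_Ici.intermediate_value hr ht hc ⟨hr', ht'⟩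
    exact hne z hz hz'
  rcases hsign with hs | hs
  · exact not_forall_pos_of_oscillating ha1 d d' hs
  · refine not_forall_pos_of_oscillating ha1 (fun t => (d t).neg) (fun t => ?_)
      (fun t ht => neg_pos.2 (hs t ht))
    convert! (d' t).neg using 1
    simp

/-- Simple zeros are isolated, hence cannot accumulate in a compact interval. -/
theorem finite_airy_zeros (a b : ℝ) : ({t | airyRe (-t) = 0} ∩ Icc a b).Finite := by
  by_contra hinf
  obtain ⟨x, -, hx⟩ := Set.Infinite.exists_accPt_of_subset_isCompact hinf isCompact_Icc
    inter_subset_right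
  have hfr := accPt_iff_frequently_nhdsNE.1 hx
  have d : HasDerivAt (fun t => airyRe (-t)) (-airyDeriv (-x)) x :=
    hasDerivAt_airyRe_neg x
  have hev : ∀ᶠ t in 𝓝[≠] x, airyRe (-t) ≠ 0 := by
    by_cases h : airyRe (-x) = 0
    · exact d.eventually_ne (neg_ne_zero.2 (airyDeriv_ne_zero h))
    · exact (d.continuousAt.eventually_ne h).filter_mono nhdsWithin_le_nhds
  exact hfr (hev.mono fun t ht h => ht h.1)

/-- Such a set has a least element, no greatest one and finite order intervals, so it is order
isomorphic to `ℕ`. -/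
theorem exists_strictMono_range_eq {Z : Set ℝ} (hfin : ∀ a b, (Z ∩ Icc a b).Finite)
    (hunb : ∀ T, ∃ t, T < t ∧ t ∈ Z) (hbdd : BddBelow Z) :
    ∃ t : ℕ → ℝ, StrictMono t ∧ range t = Z := by
  obtain ⟨c, hc⟩ := hbdd
  obtain ⟨z₀, -, hz₀⟩ := hunb 0
  obtain ⟨m, hm, hmin⟩ := (hfin c z₀).exists_minimal ⟨z₀, hz₀, hc hz₀, le_rfl⟩
  have hmin' : ∀ z ∈ Z, m ≤ z := by
    intro z hz
    rcases le_total z z₀ with h | h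
    · rcases le_total m z with h' | h'
      · exact h'
      · exact hmin ⟨hz, hc hz, h⟩ h'
    · exact hm.2.2.trans h
  let : OrderBot Z := { bot := ⟨m, hm.1⟩, bot_le := fun z => hmin' z z.2 }
  have : NoMaxOrder Z := ⟨fun z => by
    obtain ⟨t, ht, htZ⟩ := hunb z
    exact ⟨⟨t, htZ⟩, ht⟩⟩
  let : LocallyFiniteOrder Z := LocallyFiniteOrder.ofFiniteIcc fun x y => by
    refine Set.Finite.of_finite_image (f := Subtype.val) ((hfin x y).subset ?_)
      Subtype.val_injective.injOn
    rintro _ ⟨z, hz, rfl⟩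
    exact ⟨z.2, hz.1, hz.2⟩
  let := LinearLocallyFiniteOrder.succOrder Z
  let := LinearLocallyFiniteOrder.predOrder Z
  let e : Z ≃o ℕ := orderIsoNatOfLinearSuccPredArch
  refine ⟨fun n => (e.symm n : ℝ), fun i j hij => e.symm.strictMono hij, ?_⟩
  ext z
  constructor
  · rintro ⟨n, rfl⟩
    exact (e.symm n).2
  · intro hz
    exact ⟨e ⟨z, hz⟩, by simp⟩

theorem pos_of_airy_zero {t : ℝ} (h : airyRe (-t) = 0) : 0 < t := by
  by_contra! ht
  exact airyRe_ne_zero (neg_nonneg.2 ht) h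

theorem exists_airy_zeros : ∃ t : ℕ → ℝ, StrictMono t ∧ (∀ m, 0 < t m) ∧
    range t = {s : ℝ | airyRe (-s) = 0} := by
  obtain ⟨t, ht, hr⟩ := exists_strictMono_range_eq finite_airy_zeros exists_airy_zero_gt
    ⟨0, fun s hs => (pos_of_airy_zero hs).le⟩
  refine ⟨t, ht, fun m => pos_of_airy_zero ?_, hr⟩
  have : t m ∈ {s : ℝ | airyRe (-s) = 0} := hr ▸ mem_range_self m
  exact this

/-! ### Hilbert–Schmidt operators are compact -/

section HilbertSchmidt

variable {α β : Type*} [MeasurableSpace α] [MeasurableSpace β] {μ : Measure α} {ν : Measure β}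

theorem ae_memLp_two_section [SFinite μ] [SFinite ν] {E : Type*} [NormedAddCommGroup E]
    {f : α × β → E} (hf : MemLp f 2 (μ.prod ν)) : ∀ᵐ x ∂μ, MemLp (fun y => f (x, y)) 2 ν := by
  have h := ((memLp_two_iff_integrable_sq_norm hf.1).1 hf).prod_right_ae
  filter_upwards [h, hf.1.prodMk_left] with x hx hx'
  exact (memLp_two_iff_integrable_sq_norm hx').2 hx

theorem sq_integral_mul_le {f g : α → ℝ} (hf : MemLp f 2 μ) (hg : MemLp g 2 μ) :
    (∫ x, f x * g x ∂μ) ^ 2 ≤ (∫ x, f x ^ 2 ∂μ) * ∫ x, g x ^ 2 ∂μ := by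
  have h : ∀ {f g : α → ℝ} (hf : MemLp f 2 μ) (hg : MemLp g 2 μ),
      inner ℝ (hf.toLp f) (hg.toLp g) = ∫ x, f x * g x ∂μ := by
    intro f g hf hg
    rw [L2.inner_def]
    refine integral_congr_ae ?_
    filter_upwards [hf.coeFn_toLp, hg.coeFn_toLp] with x h1 h2
    rw [h1, h2]; simp [mul_comm]
  have hs : ∀ {f : α → ℝ} (hf : MemLp f 2 μ), ∫ x, f x ^ 2 ∂μ = ‖hf.toLp f‖ ^ 2 := by
    intro f hf
    rw [← real_inner_self_eq_norm_sq, h hf hf]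
    simp only [sq]
  rw [← h hf hg, hs hf, hs hg, ← mul_pow]
  exact sq_le_sq' (by have := abs_real_inner_le_norm (hf.toLp f) (hg.toLp g); rw [abs_le] at this;
                      exact this.1) (real_inner_le_norm _ _)

theorem norm_sq_eq_integral_sq (f : Lp ℝ 2 μ) : ‖f‖ ^ 2 = ∫ x, f x ^ 2 ∂μ := by
  rw [← real_inner_self_eq_norm_sq, L2.inner_def]
  simp [sq]

variable [SFinite μ] {K : α × α → ℝ}

/-- The integral operator with kernel `K`, on functions. -/
def kernelIntegral (μ : Measure α) (K : α × α → ℝ) (f : α → ℝ) (x : α) : ℝ :=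
  ∫ y, K (x, y) * f y ∂μ

theorem memLp_kernelIntegral (hK : MemLp K 2 (μ.prod μ)) {f : α → ℝ} (hf : MemLp f 2 μ) :
    MemLp (kernelIntegral μ K f) 2 μ ∧ ∫ x, kernelIntegral μ K f x ^ 2 ∂μ ≤
      (∫ p, K p ^ 2 ∂(μ.prod μ)) * ∫ x, f x ^ 2 ∂μ := by
  have hm : AEStronglyMeasurable (kernelIntegral μ K f) μ :=
    (hK.1.mul hf.1.comp_snd).integral_prod_right'
  have hi : Integrable (fun x => ∫ y, K (x, y) ^ 2 ∂μ) μ := hK.integrable_sq.integral_prod_left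
  have hle : ∀ᵐ x ∂μ, kernelIntegral μ K f x ^ 2 ≤
      (∫ y, K (x, y) ^ 2 ∂μ) * ∫ x, f x ^ 2 ∂μ := by
    filter_upwards [ae_memLp_two_section hK] with x hx
    exact sq_integral_mul_le hx hf
  have h2 : Integrable (fun x => kernelIntegral μ K f x ^ 2) μ := by
    refine (hi.mul_const (∫ x, f x ^ 2 ∂μ)).mono' (hm.pow 2) ?_
    filter_upwards [hle] with x hx
    rwa [Real.norm_of_nonneg (sq_nonneg _)]
  refine ⟨(memLp_two_iff_integrable_sq hm).2 h2, ?_⟩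
  rw [integral_prod _ hK.integrable_sq, ← integral_mul_const]
  exact integral_mono_ae h2 (hi.mul_const _) hle

/-- The Hilbert–Schmidt operator on `L²` with a square integrable kernel. -/
def kernelOp (hK : MemLp K 2 (μ.prod μ)) : Lp ℝ 2 μ →L[ℝ] Lp ℝ 2 μ :=
  LinearMap.mkContinuous
    { toFun := fun f => (memLp_kernelIntegral hK (Lp.memLp f)).1.toLp _
      map_add' := fun f g => by
        rw [← MemLp.toLp_add, MemLp.toLp_eq_toLp_iff]
        filter_upwards [ae_memLp_two_section hK] with x hx
        refine Eq.trans ?_ (integral_add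
          (hx.integrable_mul (Lp.memLp f)) (hx.integrable_mul (Lp.memLp g)))
        refine integral_congr_ae ?_
        filter_upwards [Lp.coeFn_add f g] with y hy
        simp only [hy, Pi.add_apply, mul_add]
      map_smul' := fun c f => by
        rw [RingHom.id_apply, ← MemLp.toLp_const_smul, MemLp.toLp_eq_toLp_iff]
        refine .of_forall fun x => ?_
        rw [Pi.smul_apply, kernelIntegral, kernelIntegral, smul_eq_mul, ← integral_const_mul]
        refine integral_congr_ae ?_
        filter_upwards [Lp.coeFn_smul c f] with y hy
        rw [hy, Pi.smul_apply, smul_eq_mul]; ring }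
    (Real.sqrt (∫ p, K p ^ 2 ∂(μ.prod μ))) fun f => by
      apply le_of_sq_le_sq ?_ (by positivity)
      have := (memLp_kernelIntegral hK (Lp.memLp f)).2
      rw [mul_pow, Real.sq_sqrt (integral_nonneg fun _ => sq_nonneg _), norm_sq_eq_integral_sq f,
        norm_sq_eq_integral_sq]
      refine le_trans (le_of_eq (integral_congr_ae ?_)) this
      filter_upwards [(memLp_kernelIntegral hK (Lp.memLp f)).1.coeFn_toLp] with x hx
      rw [LinearMap.coe_mk, AddHom.coe_mk, hx]

theorem coeFn_kernelOp (hK : MemLp K 2 (μ.prod μ)) (f : Lp ℝ 2 μ) :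
    kernelOp hK f =ᵐ[μ] kernelIntegral μ K f :=
  (memLp_kernelIntegral hK (Lp.memLp f)).1.coeFn_toLp

theorem isSymmetric_kernelOp (hK : MemLp K 2 (μ.prod μ)) (hs : ∀ x y, K (x, y) = K (y, x)) :
    (kernelOp hK).IsSymmetric := by
  intro f g
  have hfg : Integrable (fun p : α × α => K p * (g p.1 * f p.2)) (μ.prod μ) := by
    refine hK.integrable_mul (q := 2) ?_
    have hm : AEStronglyMeasurable (fun p : α × α => g p.1 * f p.2) (μ.prod μ) :=
      (Lp.aestronglyMeasurable g).comp_fst.mul (Lp.aestronglyMeasurable f).comp_snd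
    rw [memLp_two_iff_integrable_sq hm]
    simpa only [mul_pow] using (Lp.memLp g).integrable_sq.mul_prod (Lp.memLp f).integrable_sq
  have h1 : inner ℝ (kernelOp hK f) g = ∫ x, ∫ y, K (x, y) * (g x * f y) ∂μ ∂μ := by
    rw [L2.inner_def]
    refine integral_congr_ae ?_
    filter_upwards [coeFn_kernelOp hK f] with x hx
    rw [hx, kernelIntegral]
    simp only [RCLike.inner_apply, conj_trivial]
    rw [← integral_const_mul]
    congr 1; ext y; ring
  have h2 : inner ℝ f (kernelOp hK g) = ∫ y, ∫ x, K (x, y) * (g x * f y) ∂μ ∂μ := by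
    rw [L2.inner_def]
    refine integral_congr_ae ?_
    filter_upwards [coeFn_kernelOp hK g] with x hx
    rw [hx, kernelIntegral]
    simp only [RCLike.inner_apply, conj_trivial]
    rw [← integral_mul_const]
    congr 1; ext y; rw [hs]; ring
  change inner ℝ (kernelOp hK f) g = inner ℝ f (kernelOp hK g)
  rw [h1, h2]
  exact integral_integral_swap hfg

/-- The value of the image of `e i` at `x` is the coefficient of the section `K (x, ·)` along `e i`.
Bessel's inequality holds for almost every section and is then integrated in `x`. -/
theorem sum_norm_kernelOp_sq_le (hK : MemLp K 2 (μ.prod μ)) {ι : Type*} {e : ι → Lp ℝ 2 μ}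
    (he : Orthonormal ℝ e) (s : Finset ι) :
    ∑ i ∈ s, ‖kernelOp hK (e i)‖ ^ 2 ≤ ∫ p, K p ^ 2 ∂(μ.prod μ) := by
  have h : ∀ i, ‖kernelOp hK (e i)‖ ^ 2 = ∫ x, kernelIntegral μ K (e i) x ^ 2 ∂μ := fun i => by
    rw [norm_sq_eq_integral_sq]
    refine integral_congr_ae ?_
    filter_upwards [coeFn_kernelOp hK (e i)] with x hx
    rw [hx]
  simp_rw [h]
  have hint : ∀ i ∈ s, Integrable (fun x => kernelIntegral μ K (e i) x ^ 2) μ := fun i _ =>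
    (memLp_kernelIntegral hK (Lp.memLp (e i))).1.integrable_sq
  rw [← integral_finsetSum _ hint, integral_prod _ hK.integrable_sq]
  refine integral_mono_ae (integrable_finsetSum _ hint) hK.integrable_sq.integral_prod_left ?_
  filter_upwards [ae_memLp_two_section hK] with x hx
  have hb := he.sum_inner_products_le (s := s) (hx.toLp _)
  rw [norm_sq_eq_integral_sq] at hb
  have e1 : ∫ y, (hx.toLp _ : Lp ℝ 2 μ) y ^ 2 ∂μ = ∫ y, K (x, y) ^ 2 ∂μ := by
    refine integral_congr_ae ?_
    filter_upwards [hx.coeFn_toLp] with y hy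
    rw [hy]
  rw [e1] at hb
  refine le_trans (le_of_eq (Finset.sum_congr rfl fun i _ => ?_)) hb
  rw [Real.norm_eq_abs, sq_abs, L2.inner_def, kernelIntegral]
  congr 1
  refine integral_congr_ae ?_
  filter_upwards [hx.coeFn_toLp] with y hy
  rw [hy]; simp

end HilbertSchmidt

section Compact

variable {E : Type*} [NormedAddCommGroup E] [InnerProductSpace ℝ E] [CompleteSpace E]

/-- The finite-rank truncations `F s = P_s T` converge to `T` in norm: by symmetry `‖(T - P_s T) f‖²
= ∑_{j ∉ s} ⟨T b_j, f⟩²`, at most `‖f‖²` times the tail of a convergent series. -/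
theorem isCompactOperator_of_sum_norm_sq_le {T : E →L[ℝ] E} (hT : T.IsSymmetric) {ι : Type*}
    (b : HilbertBasis ι ℝ E) {C : ℝ} (hC : ∀ s : Finset ι, ∑ i ∈ s, ‖T (b i)‖ ^ 2 ≤ C) :
    IsCompactOperator T := by
  classical
  have hsum : Summable fun i => ‖T (b i)‖ ^ 2 :=
    summable_of_sum_le (fun i => sq_nonneg _) hC
  set A := ∑' i, ‖T (b i)‖ ^ 2 with hA
  let F : Finset ι → E →L[ℝ] E := fun s =>
    ∑ i ∈ s, (ContinuousLinearMap.toSpanSingleton ℝ (b i)).comp ((innerSL ℝ (b i)).comp T)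
  have hF : ∀ s f, F s f = ∑ i ∈ s, inner ℝ (b i) (T f) • b i := by
    intro s f
    simp [F]
  have key : ∀ s, ‖F s - T‖ ≤ Real.sqrt (A - ∑ i ∈ s, ‖T (b i)‖ ^ 2) := by
    intro s
    have htail : HasSum (fun i => if i ∈ s then 0 else ‖T (b i)‖ ^ 2)
        (A - ∑ i ∈ s, ‖T (b i)‖ ^ 2) := by
      have h1 : HasSum (fun i => if i ∈ s then ‖T (b i)‖ ^ 2 else 0)
          (∑ i ∈ s, ‖T (b i)‖ ^ 2) := by
        have : HasSum (fun i => if i ∈ s then ‖T (b i)‖ ^ 2 else 0)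
            (∑ i ∈ s, if i ∈ s then ‖T (b i)‖ ^ 2 else 0) :=
          hasSum_sum_of_ne_finset_zero (fun i hi => by simp [hi])
        rwa [Finset.sum_congr rfl (fun i hi => if_pos hi)] at this
      convert! hsum.hasSum.sub h1 using 2 with i
      split_ifs <;> simp
    refine ContinuousLinearMap.opNorm_le_bound _ (Real.sqrt_nonneg _) fun f => ?_
    apply le_of_sq_le_sq ?_ (by positivity)
    have hnn : 0 ≤ A - ∑ i ∈ s, ‖T (b i)‖ ^ 2 :=
      htail.nonneg fun i => by split_ifs <;> positivity
    rw [mul_pow, Real.sq_sqrt hnn]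
    set r := (F s - T) f with hr
    have hin : ∀ j, inner ℝ (b j) r = if j ∈ s then 0 else -inner ℝ (b j) (T f) := by
      intro j
      rw [hr, sub_apply, hF, inner_sub_right, inner_sum]
      simp only [inner_smul_right, orthonormal_iff_ite.1 b.orthonormal]
      split_ifs with h <;> simp [h]
    have hr2 := b.hasSum_inner_mul_inner r r
    rw [real_inner_self_eq_norm_sq] at hr2
    refine hasSum_le (fun j => ?_) hr2 (htail.mul_right (‖f‖ ^ 2))
    rw [real_inner_comm, hin]
    split_ifs with h
    · simp
    · have h1 : inner ℝ (b j) (T f) = inner ℝ (T (b j)) f := (hT (b j) f).symm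
      rw [h1, ← mul_pow, ← sq, neg_sq]
      exact sq_le_sq.2 ((abs_real_inner_le_norm _ _).trans (le_abs_self _))
  have htend : Tendsto F atTop (𝓝 T) := by
    rw [tendsto_iff_norm_sub_tendsto_zero]
    refine squeeze_zero (fun _ => norm_nonneg _) key ?_
    have := (hsum.hasSum.const_sub A).sqrt
    rwa [← hA, sub_self, Real.sqrt_zero] at this
  refine isCompactOperator_of_tendsto htend (.of_forall fun s => ?_)
  have : F s ∈ compactOperator (RingHom.id ℝ) E E := Submodule.sum_mem _ fun i _ => by
    have h : IsCompactOperator (ContinuousLinearMap.toSpanSingleton ℝ (b i)) :=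
      isCompactOperator_id.clm_comp (ContinuousLinearMap.toSpanSingleton ℝ (b i))
    exact h.comp_clm ((innerSL ℝ (b i)).comp T)
  exact this

end Compact

theorem isCompactOperator_kernelOp {α : Type*} [MeasurableSpace α] {μ : Measure α} [SFinite μ]
    {K : α × α → ℝ} (hK : MemLp K 2 (μ.prod μ)) (hs : ∀ x y, K (x, y) = K (y, x)) :
    IsCompactOperator (kernelOp hK) := by
  obtain ⟨w, b, -⟩ := exists_hilbertBasis ℝ (Lp ℝ 2 μ)
  exact isCompactOperator_of_sum_norm_sq_le (isSymmetric_kernelOp hK hs) b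
    (sum_norm_kernelOp_sq_le hK b.orthonormal)

/-! ### The Green operator of `-∂ₓ² + (x + 1)` on the half-line -/

theorem continuousOn_primitive_Ici {h : ℝ → ℝ} (hh : ∀ b, IntegrableOn h (Icc 0 b)) :
    ContinuousOn (fun x => ∫ t in (0 : ℝ)..x, h t) (Ici 0) := by
  intro x hx
  have h1 := intervalIntegral.continuousOn_primitive_interval (μ := volume) (f := h) (a := 0)
    (b := x + 1) (by rw [uIcc_of_le (by linarith [mem_Ici.1 hx])]; exact hh _)
  rw [uIcc_of_le (by linarith [mem_Ici.1 hx])] at h1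
  refine (h1 x ⟨hx, by linarith⟩).mono_of_mem_nhdsWithin ?_
  have : Icc 0 (x + 1) = Ici 0 ∩ Iic (x + 1) := Ici_inter_Iic.symm
  rw [this]
  exact inter_mem self_mem_nhdsWithin (mem_nhdsWithin_of_mem_nhds (Iic_mem_nhds (by linarith)))

theorem hasDerivAt_primitive_Ici {h : ℝ → ℝ} (hh : ContinuousOn h (Ici 0)) {x : ℝ} (hx : 0 < x) :
    HasDerivAt (fun x => ∫ t in (0 : ℝ)..x, h t) (h x) x := by
  have hc : ContinuousOn h (Ioi 0) := hh.mono Ioi_subset_Ici_self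
  refine intervalIntegral.integral_hasDerivAt_right ?_
    (hc.stronglyMeasurableAtFilter isOpen_Ioi x hx) (hc.continuousAt (Ioi_mem_nhds hx))
  refine (hh.mono ?_).intervalIntegrable
  rw [uIcc_of_le hx.le]
  exact Icc_subset_Ici_self

/-- The decaying solution of `v'' = (x + 1) v`. -/
def decaySol (x : ℝ) : ℝ := airyRe (x + 1)

/-- The derivative of `decaySol`. -/
def decaySolDeriv (x : ℝ) : ℝ := airyDeriv (x + 1)

theorem hasDerivAt_decaySol (x : ℝ) : HasDerivAt decaySol (decaySolDeriv x) x :=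
  (hasDerivAt_airyRe (x + 1)).comp_add_const x 1

theorem hasDerivAt_decaySolDeriv (x : ℝ) :
    HasDerivAt decaySolDeriv ((x + 1) * decaySol x) x :=
  (hasDerivAt_airyDeriv (x + 1)).comp_add_const x 1

theorem continuous_decaySol : Continuous decaySol :=
  continuous_airyRe.comp (continuous_id.add continuous_const)

theorem continuous_decaySolDeriv : Continuous decaySolDeriv :=
  continuous_airyDeriv.comp (continuous_id.add continuous_const)

/-- The shift by `1` keeps the argument of `Ai` positive. For `v = decaySol` this permits reduction
of order: `v ∫₀ˣ v⁻²` is a second solution, zero at `x = 0`, whose Wronskian with `v` is `1`. -/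
theorem decaySol_ne_zero {x : ℝ} (hx : 0 ≤ x) : decaySol x ≠ 0 := airyRe_ne_zero (by linarith)

theorem decaySol_mul_deriv_neg {x : ℝ} (hx : 0 ≤ x) : decaySol x * decaySolDeriv x < 0 :=
  airyRe_mul_airyDeriv_neg (by linarith)

theorem mul_decaySol_sq_le (x : ℝ) : (x + 1) * decaySol x ^ 2 ≤ decaySolDeriv x ^ 2 :=
  mul_airyRe_sq_le (x + 1)

theorem sqrt_mul_abs_decaySol_le (x : ℝ) :
    √(x + 1) * |decaySol x| ≤ |decaySolDeriv x| := by
  rcases le_total 0 (x + 1) with h | h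
  · apply le_of_sq_le_sq ?_ (abs_nonneg _)
    rw [mul_pow, Real.sq_sqrt h, sq_abs, sq_abs]
    exact mul_decaySol_sq_le x
  · rw [Real.sqrt_eq_zero_of_nonpos h, zero_mul]; exact abs_nonneg _

theorem abs_decaySol_antitoneOn : AntitoneOn (fun x => |decaySol x|) (Ici 0) := by
  have h : AntitoneOn (fun x => decaySol x ^ 2) (Ici 0) := by
    refine antitoneOn_of_hasDerivWithinAt_nonpos (convex_Ici 0)
      (continuous_decaySol.pow 2).continuousOn
      (fun x _ => ((hasDerivAt_decaySol x).pow 2).hasDerivWithinAt) fun x hx => ?_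
    rw [interior_Ici] at hx
    have := decaySol_mul_deriv_neg (le_of_lt hx)
    push_cast
    linarith
  exact fun x hx y hy hxy => sq_le_sq.1 (h hx hy hxy)

theorem abs_decaySolDeriv_antitoneOn : AntitoneOn (fun x => |decaySolDeriv x|) (Ici 0) := by
  have h : AntitoneOn (fun x => decaySolDeriv x ^ 2) (Ici 0) := by
    refine antitoneOn_of_hasDerivWithinAt_nonpos (convex_Ici 0)
      (continuous_decaySolDeriv.pow 2).continuousOn
      (fun x _ => ((hasDerivAt_decaySolDeriv x).pow 2).hasDerivWithinAt) fun x hx => ?_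
    rw [interior_Ici] at hx
    have := decaySol_mul_deriv_neg (le_of_lt hx)
    have h2 : 0 < x + 1 := by have := mem_Ioi.1 hx; linarith
    push_cast
    nlinarith [mul_neg_of_pos_of_neg h2 this]
  exact fun x hx y hy hxy => sq_le_sq.1 (h hx hy hxy)

/-- The primitive `∫₀ˣ v⁻²` of the reduction of order. -/
def redOrder (x : ℝ) : ℝ := ∫ s in (0 : ℝ)..x, (decaySol s ^ 2)⁻¹

theorem continuousOn_inv_decaySol_sq : ContinuousOn (fun s => (decaySol s ^ 2)⁻¹) (Ici 0) :=
  (continuous_decaySol.pow 2).continuousOn.inv₀ fun _ hx => pow_ne_zero 2 (decaySol_ne_zero hx)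

theorem hasDerivAt_redOrder {x : ℝ} (hx : 0 < x) :
    HasDerivAt redOrder (decaySol x ^ 2)⁻¹ x :=
  hasDerivAt_primitive_Ici continuousOn_inv_decaySol_sq hx

theorem integrableOn_Icc_of_continuousOn_Ici {h : ℝ → ℝ} (hh : ContinuousOn h (Ici 0)) (b : ℝ) :
    IntegrableOn h (Icc 0 b) :=
  (hh.mono Icc_subset_Ici_self).integrableOn_compact isCompact_Icc

theorem continuousOn_redOrder : ContinuousOn redOrder (Ici 0) :=
  continuousOn_primitive_Ici (integrableOn_Icc_of_continuousOn_Ici continuousOn_inv_decaySol_sq)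

theorem redOrder_zero : redOrder 0 = 0 := intervalIntegral.integral_same

theorem redOrder_nonneg {x : ℝ} (hx : 0 ≤ x) : 0 ≤ redOrder x :=
  intervalIntegral.integral_nonneg hx fun _ _ => inv_nonneg.2 (sq_nonneg _)

/-- The derivative of `-1 / (v v')` is `v⁻² + (x + 1) / v'²`, which exceeds `redOrder' = v⁻²`. As
`-1 / (v v')` is positive at `0`, it dominates `redOrder` on the half-line. -/
theorem abs_mul_redOrder_le {x : ℝ} (hx : 0 ≤ x) :
    |decaySol x * decaySolDeriv x| * redOrder x ≤ 1 := by
  have hP : ∀ x, HasDerivAt (fun x => decaySol x * decaySolDeriv x)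
      (decaySolDeriv x * decaySolDeriv x + decaySol x * ((x + 1) * decaySol x)) x := fun x =>
    (hasDerivAt_decaySol x).mul (hasDerivAt_decaySolDeriv x)
  have hm : MonotoneOn (fun x => -(decaySol x * decaySolDeriv x)⁻¹ - redOrder x) (Ici 0) := by
    refine monotoneOn_of_hasDerivWithinAt_nonneg (convex_Ici 0) (f' := fun x =>
      -(-(decaySolDeriv x * decaySolDeriv x + decaySol x * ((x + 1) * decaySol x)) /
        (decaySol x * decaySolDeriv x) ^ 2) - (decaySol x ^ 2)⁻¹) ?_ (fun x hx => ?_)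
      fun x hx => ?_
    · exact ((((continuous_decaySol.mul continuous_decaySolDeriv).continuousOn).inv₀
        fun x hx => (decaySol_mul_deriv_neg hx).ne).neg).sub continuousOn_redOrder
    · rw [interior_Ici] at hx
      exact (((hP x).fun_inv (decaySol_mul_deriv_neg (le_of_lt hx)).ne).neg.sub
        (hasDerivAt_redOrder hx)).hasDerivWithinAt
    · rw [interior_Ici] at hx
      have h0 := (decaySol_mul_deriv_neg (le_of_lt hx)).ne
      have h1 : decaySol x ≠ 0 := left_ne_zero_of_mul h0
      have h2 : decaySolDeriv x ≠ 0 := right_ne_zero_of_mul h0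
      have h3 : 0 < x + 1 := by have := mem_Ioi.1 hx; linarith
      have : -(-(decaySolDeriv x * decaySolDeriv x + decaySol x * ((x + 1) * decaySol x)) /
        (decaySol x * decaySolDeriv x) ^ 2) - (decaySol x ^ 2)⁻¹ =
        (x + 1) / decaySolDeriv x ^ 2 := by
        field_simp
        ring
      rw [this]
      positivity
  have h1 := hm (mem_Ici.2 le_rfl) (mem_Ici.2 hx) hx
  have hx0 := decaySol_mul_deriv_neg hx
  have h00 := inv_lt_zero.2 (decaySol_mul_deriv_neg le_rfl)
  simp only [redOrder_zero] at h1
  rw [abs_of_neg hx0]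
  have h2 : redOrder x ≤ -(decaySol x * decaySolDeriv x)⁻¹ := by linarith
  calc _ ≤ -(decaySol x * decaySolDeriv x) * -(decaySol x * decaySolDeriv x)⁻¹ :=
        mul_le_mul_of_nonneg_left h2 (by linarith)
    _ = 1 := by rw [neg_mul_neg, mul_inv_cancel₀ hx0.ne]

theorem sqrt_mul_decaySol_sq_mul_redOrder_le {x : ℝ} (hx : 0 ≤ x) :
    √(x + 1) * (decaySol x ^ 2 * redOrder x) ≤ 1 := by
  refine le_trans ?_ (abs_mul_redOrder_le hx)
  have h := mul_le_mul_of_nonneg_right (sqrt_mul_abs_decaySol_le x)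
    (mul_nonneg (abs_nonneg (decaySol x)) (redOrder_nonneg hx))
  rw [abs_mul]
  calc _ = √(x + 1) * |decaySol x| * (|decaySol x| * redOrder x) := by rw [← sq_abs]; ring
    _ ≤ _ := h
    _ = _ := by ring

theorem one_le_sqrt_add_one {x : ℝ} (hx : 0 ≤ x) : 1 ≤ √(x + 1) := by
  rw [Real.one_le_sqrt]; linarith

theorem decaySol_sq_mul_redOrder_le {x : ℝ} (hx : 0 ≤ x) : decaySol x ^ 2 * redOrder x ≤ 1 := by
  refine le_trans ?_ (sqrt_mul_decaySol_sq_mul_redOrder_le hx)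
  exact le_mul_of_one_le_left (mul_nonneg (sq_nonneg _) (redOrder_nonneg hx))
    (one_le_sqrt_add_one hx)

theorem tendsto_decaySol : Tendsto decaySol atTop (𝓝 0) :=
  tendsto_airyRe.comp (tendsto_atTop_add_const_right _ _ tendsto_id)

theorem integrableOn_deriv_decaySol_sq {x : ℝ} (hx : 0 ≤ x) :
    IntegrableOn (fun s => 2 * decaySol s * decaySolDeriv s) (Ioi x) ∧
      ∫ s in Ioi x, 2 * decaySol s * decaySolDeriv s = -decaySol x ^ 2 := by
  have hd : ∀ s, HasDerivAt (fun s => decaySol s ^ 2) (2 * decaySol s * decaySolDeriv s) s := by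
    intro s
    convert! (hasDerivAt_decaySol s).pow 2 using 1
    push_cast; ring
  have hneg : ∀ s ∈ Ioi x, 2 * decaySol s * decaySolDeriv s ≤ 0 := fun s hs => by
    have := decaySol_mul_deriv_neg (hx.trans (le_of_lt hs))
    linarith
  have hl : Tendsto (fun s => decaySol s ^ 2) atTop (𝓝 0) := by
    simpa using tendsto_decaySol.pow 2
  refine ⟨integrableOn_Ioi_deriv_of_nonpos' (fun s _ => hd s) hneg hl, ?_⟩
  rw [integral_Ioi_of_hasDerivAt_of_nonpos' (fun s _ => hd s) hneg hl, zero_sub]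

/-- For `s > x`, `√(x + 1) v² ≤ -v v'`, and the right-hand side integrates over `(x, ∞)` to `v(x)² /
2`. -/
theorem decaySol_sq_tail {x : ℝ} (hx : 0 ≤ x) : IntegrableOn (fun s => decaySol s ^ 2) (Ioi x) ∧
    √(x + 1) * ∫ s in Ioi x, decaySol s ^ 2 ≤ decaySol x ^ 2 / 2 := by
  obtain ⟨hi, he⟩ := integrableOn_deriv_decaySol_sq hx
  have hle : ∀ s ∈ Ioi x, √(x + 1) * decaySol s ^ 2 ≤
      (-1 / 2) * (2 * decaySol s * decaySolDeriv s) := by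
    intro s hs
    have hs' := hx.trans (le_of_lt hs)
    have h1 : √(x + 1) * |decaySol s| ≤ |decaySolDeriv s| :=
      (mul_le_mul_of_nonneg_right (Real.sqrt_le_sqrt (by linarith [mem_Ioi.1 hs]))
        (abs_nonneg _)).trans (sqrt_mul_abs_decaySol_le s)
    have h2 := abs_of_neg (decaySol_mul_deriv_neg hs')
    rw [abs_mul] at h2
    have h3 := mul_le_mul_of_nonneg_right h1 (abs_nonneg (decaySol s))
    calc _ = √(x + 1) * |decaySol s| * |decaySol s| := by rw [← sq_abs]; ring
      _ ≤ _ := h3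
      _ = _ := by linarith
  have hint : IntegrableOn (fun s => √(x + 1) * decaySol s ^ 2) (Ioi x) := by
    refine (hi.const_mul (-1 / 2)).mono'
      ((continuous_decaySol.pow 2).const_smul (√(x + 1))).aestronglyMeasurable ?_
    filter_upwards [ae_restrict_mem measurableSet_Ioi] with s hs
    rw [Real.norm_of_nonneg (by positivity)]
    exact hle s hs
  have h0 : √(x + 1) ≠ 0 := by have := one_le_sqrt_add_one hx; linarith
  constructor
  · have := hint.const_mul (√(x + 1))⁻¹
    refine this.congr (.of_forall fun s => ?_)
    simp only
    rw [inv_mul_cancel_left₀ h0]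
  · rw [← integral_const_mul]
    refine (setIntegral_mono_on hint (hi.const_mul (-1 / 2)) measurableSet_Ioi hle).trans ?_
    rw [integral_const_mul, he]
    linarith

/-- Lebesgue measure on the half-line `[0, ∞)`. -/
def halfVol : Measure ℝ := volume.restrict (Ici 0)

instance : SigmaFinite halfVol := by unfold halfVol; infer_instance

/-- The Green kernel of `-∂ₓ² + (x + 1)` on `[0, ∞)` with Dirichlet condition. -/
def greenKernel (p : ℝ × ℝ) : ℝ := decaySol p.1 * redOrder (min p.1 p.2) * decaySol p.2

theorem greenKernel_symm (x y : ℝ) : greenKernel (x, y) = greenKernel (y, x) := by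
  simp only [greenKernel, min_comm x y]; ring

theorem halfVol_prod :
    halfVol.prod halfVol = (volume : Measure (ℝ × ℝ)).restrict (Ici 0 ×ˢ Ici 0) := by
  rw [halfVol, Measure.prod_restrict, Measure.volume_eq_prod]

theorem aestronglyMeasurable_greenKernel :
    AEStronglyMeasurable greenKernel (halfVol.prod halfVol) := by
  rw [halfVol_prod]
  refine ContinuousOn.aestronglyMeasurable ?_ (measurableSet_Ici.prod measurableSet_Ici)
  refine ContinuousOn.mul (ContinuousOn.mul ?_ ?_) ?_
  · exact (continuous_decaySol.comp continuous_fst).continuousOn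
  · exact continuousOn_redOrder.comp (continuous_fst.min continuous_snd).continuousOn
      fun p hp => mem_Ici.2 (le_min hp.1 hp.2)
  · exact (continuous_decaySol.comp continuous_snd).continuousOn

/-- By symmetry it is enough to bound the part `x ≤ y`. Integrating its square in `y` gives `v²
redOrder² ∫ₓ^∞ v²`, and the bounds on `v² redOrder` and on the tail reduce this to at most `(x +
1)^{-3/2} / 2`, which is integrable. -/
theorem memLp_greenKernel : MemLp greenKernel 2 (halfVol.prod halfVol) := by
  set K₁ : ℝ × ℝ → ℝ := {p : ℝ × ℝ | p.1 ≤ p.2}.indicator greenKernel with hK₁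
  have hm : AEStronglyMeasurable K₁ (halfVol.prod halfVol) :=
    aestronglyMeasurable_greenKernel.indicator (measurableSet_le measurable_fst measurable_snd)
  have hsec : ∀ x y : ℝ, 0 ≤ x → 0 ≤ y → ‖K₁ (x, y) ^ 2‖ = (Ici x).indicator
      (fun y => (decaySol x * redOrder x) ^ 2 * decaySol y ^ 2) y := by
    intro x y hx hy
    rw [Real.norm_of_nonneg (sq_nonneg _)]
    simp only [hK₁, indicator, mem_ofPred_eq, mem_Ici]
    split_ifs with h
    · rw [greenKernel, min_eq_left h]; ring
    · ring
  have hae : ∀ᵐ x ∂halfVol, (0 : ℝ) ≤ x := by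
    unfold halfVol; exact ae_restrict_mem measurableSet_Ici
  have hsi : ∀ x, 0 ≤ x → IntegrableOn
      (fun y => (decaySol x * redOrder x) ^ 2 * decaySol y ^ 2) (Ici x) := fun x hx =>
    ((integrableOn_Ici_iff_integrableOn_Ioi).2 (decaySol_sq_tail hx).1).const_mul _
  have h1 : MemLp K₁ 2 (halfVol.prod halfVol) := by
    have hm2 : AEStronglyMeasurable (fun p => K₁ p ^ 2) (halfVol.prod halfVol) := hm.pow 2
    rw [memLp_two_iff_integrable_sq hm, integrable_prod_iff hm2]
    constructor
    · filter_upwards [hae, hm2.prodMk_left] with x hx hx'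
      rw [← integrable_norm_iff hx']
      refine Integrable.congr (f := (Ici x).indicator
        (fun y => (decaySol x * redOrder x) ^ 2 * decaySol y ^ 2)) ?_ ?_
      · exact ((integrable_indicator_iff measurableSet_Ici).2 (hsi x hx)).mono_measure
          Measure.restrict_le_self
      · filter_upwards [hae] with y hy
        exact (hsec x y hx hy).symm
    · have hdom : Integrable (fun x : ℝ => (x + 1) ^ (-(3 / 2) : ℝ) / 2) halfVol := by
        unfold halfVol
        exact ((integrableOn_Ici_iff_integrableOn_Ioi).2
          (integrableOn_add_rpow_Ioi_of_lt (by norm_num) (by norm_num))).div_const 2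
      refine hdom.mono' hm2.norm.integral_prod_right' ?_
      filter_upwards [hae] with x hx
      have e1 : ∫ y, ‖K₁ (x, y) ^ 2‖ ∂halfVol =
          (decaySol x * redOrder x) ^ 2 * ∫ y in Ioi x, decaySol y ^ 2 := by
        calc _ = ∫ y, (Ici x).indicator
              (fun y => (decaySol x * redOrder x) ^ 2 * decaySol y ^ 2) y ∂halfVol := by
              refine integral_congr_ae ?_
              filter_upwards [hae] with y hy
              exact hsec x y hx hy
          _ = ∫ y in Ici x, (decaySol x * redOrder x) ^ 2 * decaySol y ^ 2 := by
              rw [halfVol, setIntegral_indicator measurableSet_Ici,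
                inter_eq_right.2 (Ici_subset_Ici.2 hx)]
          _ = _ := by rw [integral_Ici_eq_integral_Ioi, integral_const_mul]
      rw [Real.norm_of_nonneg (integral_nonneg fun _ => norm_nonneg _), e1]
      set S := √(x + 1) with hS
      have hS1 : 1 ≤ S := one_le_sqrt_add_one hx
      have hS0 : 0 < S := by linarith
      have hpow : (x + 1) ^ (-(3 / 2) : ℝ) = (S ^ 3)⁻¹ := by
        rw [Real.rpow_neg (by linarith), hS, Real.sqrt_eq_rpow, ← Real.rpow_natCast,
          ← Real.rpow_mul (by linarith)]
        norm_num
      rw [hpow, inv_eq_one_div, div_div, le_div_iff₀ (by positivity)]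
      have hN := (decaySol_sq_tail hx).2
      rw [← hS] at hN
      have hI := sqrt_mul_decaySol_sq_mul_redOrder_le hx
      rw [← hS] at hI
      set N := ∫ y in Ioi x, decaySol y ^ 2
      have hI0 := redOrder_nonneg hx
      calc (decaySol x * redOrder x) ^ 2 * N * (S ^ 3 * 2)
          = (S ^ 2 * decaySol x ^ 2 * redOrder x ^ 2) * (2 * (S * N)) := by ring
        _ ≤ (S ^ 2 * decaySol x ^ 2 * redOrder x ^ 2) * decaySol x ^ 2 := by
            refine mul_le_mul_of_nonneg_left (by linarith) (by positivity)
        _ = (S * (decaySol x ^ 2 * redOrder x)) ^ 2 := by ring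
        _ ≤ 1 := pow_le_one₀ (by positivity) hI
  have h2 : MemLp (fun p => K₁ p.swap) 2 (halfVol.prod halfVol) :=
    h1.comp_measurePreserving Measure.measurePreserving_swap
  refine (h1.norm.add h2.norm).mono aestronglyMeasurable_greenKernel (.of_forall fun p => ?_)
  rw [Pi.add_apply, Real.norm_of_nonneg (add_nonneg (norm_nonneg _) (norm_nonneg _))]
  rcases le_total p.1 p.2 with h | h
  · have : K₁ p = greenKernel p := indicator_of_mem (show p ∈ {p : ℝ × ℝ | p.1 ≤ p.2} from h) _
    rw [this]
    linarith [norm_nonneg (K₁ p.swap)]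
  · have : K₁ p.swap = greenKernel p.swap :=
      indicator_of_mem (show p.swap ∈ {p : ℝ × ℝ | p.1 ≤ p.2} from h) _
    have h3 : greenKernel p.swap = greenKernel p := greenKernel_symm p.2 p.1
    rw [this, h3]
    linarith [norm_nonneg (K₁ p)]

theorem ae_halfVol_nonneg : ∀ᵐ x ∂halfVol, (0 : ℝ) ≤ x := ae_restrict_mem measurableSet_Ici

/-- The lower part of the Green integral. -/
def greenLower (f : ℝ → ℝ) (x : ℝ) : ℝ := ∫ s in (0 : ℝ)..x, redOrder s * decaySol s * f s

/-- The upper part of the Green integral. -/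
def greenUpper (f : ℝ → ℝ) (x : ℝ) : ℝ := ∫ s in Ioi x, decaySol s * f s

section Green

variable {f : ℝ → ℝ}

theorem memLp_decaySol : MemLp decaySol 2 halfVol :=
  (memLp_two_iff_integrable_sq continuous_decaySol.aestronglyMeasurable).2
    ((integrableOn_Ici_iff_integrableOn_Ioi).2 (decaySol_sq_tail le_rfl).1)

theorem integrableOn_decaySol_mul (hf : MemLp f 2 halfVol) :
    IntegrableOn (fun s => decaySol s * f s) (Ici 0) :=
  memLp_decaySol.integrable_mul hf

theorem MemLp.integrableOn_Icc (hf : MemLp f 2 halfVol) (b : ℝ) : IntegrableOn f (Icc 0 b) := by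
  have h : MemLp f 2 (volume.restrict (Icc 0 b)) :=
    hf.mono_measure (Measure.restrict_mono Icc_subset_Ici_self le_rfl)
  exact h.integrable one_le_two

theorem integrableOn_redOrder_mul (hf : MemLp f 2 halfVol) (b : ℝ) :
    IntegrableOn (fun s => redOrder s * decaySol s * f s) (Icc 0 b) :=
  (MemLp.integrableOn_Icc hf b).continuousOn_mul
    ((continuousOn_redOrder.mul continuous_decaySol.continuousOn).mono Icc_subset_Ici_self)
    isCompact_Icc

theorem greenUpper_eq_sub (hf : MemLp f 2 halfVol) {x : ℝ} (hx : 0 ≤ x) :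
    greenUpper f x = greenUpper f 0 - ∫ s in (0 : ℝ)..x, decaySol s * f s := by
  have hi := integrableOn_decaySol_mul hf
  rw [greenUpper, greenUpper, intervalIntegral.integral_of_le hx, ← Ioc_union_Ioi_eq_Ioi hx,
    setIntegral_union (Ioc_disjoint_Ioi le_rfl) measurableSet_Ioi
      (hi.mono_set (Ioc_subset_Icc_self.trans Icc_subset_Ici_self))
      (hi.mono_set ((Ioi_subset_Ioi hx).trans Ioi_subset_Ici_self))]
  ring

theorem kernelIntegral_green (hf : MemLp f 2 halfVol) {x : ℝ} (hx : 0 ≤ x) :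
    kernelIntegral halfVol greenKernel f x =
      decaySol x * (greenLower f x + redOrder x * greenUpper f x) := by
  have hi := integrableOn_decaySol_mul hf
  have h1 : EqOn (fun y => greenKernel (x, y) * f y)
      (fun y => decaySol x * (redOrder y * decaySol y * f y)) (Ioc 0 x) := fun y hy => by
    simp only [greenKernel, min_eq_right hy.2]; ring
  have h2 : EqOn (fun y => greenKernel (x, y) * f y)
      (fun y => decaySol x * redOrder x * (decaySol y * f y)) (Ioi x) := fun y hy => by
    simp only [greenKernel, min_eq_left (le_of_lt (mem_Ioi.1 hy))]; ring
  rw [kernelIntegral, halfVol, integral_Ici_eq_integral_Ioi, ← Ioc_union_Ioi_eq_Ioi hx,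
    setIntegral_union (Ioc_disjoint_Ioi le_rfl) measurableSet_Ioi,
    setIntegral_congr_fun measurableSet_Ioc h1, setIntegral_congr_fun measurableSet_Ioi h2,
    integral_const_mul, integral_const_mul, greenLower, greenUpper,
    intervalIntegral.integral_of_le hx]
  · ring
  · refine (integrableOn_congr_fun h1 measurableSet_Ioc).2 ?_
    exact ((integrableOn_redOrder_mul hf x).mono_set Ioc_subset_Icc_self).const_mul (decaySol x)
  · refine (integrableOn_congr_fun h2 measurableSet_Ioi).2 ?_
    exact (hi.mono_set ((Ioi_subset_Ioi hx).trans Ioi_subset_Ici_self)).const_mul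
      (decaySol x * redOrder x)

theorem continuousOn_greenLower (hf : MemLp f 2 halfVol) : ContinuousOn (greenLower f) (Ici 0) :=
  continuousOn_primitive_Ici (integrableOn_redOrder_mul hf)

theorem continuousOn_greenUpper (hf : MemLp f 2 halfVol) : ContinuousOn (greenUpper f) (Ici 0) :=
  (continuousOn_const.sub (continuousOn_primitive_Ici fun _ =>
    (integrableOn_decaySol_mul hf).mono_set Icc_subset_Ici_self)).congr
    fun _ hx => greenUpper_eq_sub hf hx

theorem eq_zero_of_ae_eq_zero_Ici {g : ℝ → ℝ} (hg : ContinuousOn g (Ici 0))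
    (h : g =ᵐ[halfVol] 0) {x : ℝ} (hx : 0 ≤ x) : g x = 0 := by
  have h1 : EqOn g 0 (Ioi 0) := by
    refine Measure.eqOn_open_of_ae_eq (μ := volume) ?_ isOpen_Ioi (hg.mono Ioi_subset_Ici_self)
      continuousOn_const
    exact ae_restrict_of_ae_restrict_of_subset Ioi_subset_Ici_self h
  have h2 : EqOn g 0 (Ici 0) := by
    refine h1.of_subset_closure hg continuousOn_const Ioi_subset_Ici_self ?_
    rw [closure_Ioi]
  exact h2 hx

theorem ae_hasDerivAt_primitive {h : ℝ → ℝ} (hh : ∀ b, IntegrableOn h (Icc 0 b)) :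
    ∀ᵐ x, 0 < x → HasDerivAt (fun x => ∫ t in (0 : ℝ)..x, h t) (h x) x := by
  have h1 : ∀ n : ℕ, ∀ᵐ x : ℝ, x ∈ uIcc (0 : ℝ) n → ∀ c ∈ uIcc (0 : ℝ) n,
      HasDerivAt (fun x => ∫ t in c..x, h t) (h x) x := fun n =>
    IntervalIntegrable.ae_hasDerivAt_integral
      ((intervalIntegrable_iff_integrableOn_Icc_of_le (Nat.cast_nonneg n)).2 (hh n))
  filter_upwards [ae_all_iff.2 h1] with x hx hx0
  obtain ⟨n, hn⟩ := exists_nat_ge x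
  exact hx n (by rw [uIcc_of_le (Nat.cast_nonneg n)]; exact ⟨hx0.le, hn⟩) 0 left_mem_uIcc

theorem ae_halfVol_of_ae_pos {p : ℝ → Prop} (h : ∀ᵐ x, 0 < x → p x) : ∀ᵐ x ∂halfVol, p x := by
  rw [halfVol, ← restrict_Ioi_eq_restrict_Ici, ae_restrict_iff' measurableSet_Ioi]
  exact h

theorem eventually_nonneg_nhds {x : ℝ} (hx : 0 < x) : ∀ᶠ y in 𝓝 x, 0 ≤ y :=
  (lt_mem_nhds hx).mono fun _ hy => le_of_lt hy

/-- Injectivity of the Green operator, which excludes eigenvectors for the eigenvalue `0`. -/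
theorem ae_eq_zero_of_green_eq_zero (hf : MemLp f 2 halfVol)
    (h : kernelIntegral halfVol greenKernel f =ᵐ[halfVol] 0) : f =ᵐ[halfVol] 0 := by
  have hsum : ∀ x, 0 ≤ x → greenLower f x + redOrder x * greenUpper f x = 0 := by
    intro x hx
    refine eq_zero_of_ae_eq_zero_Ici (g := fun x => greenLower f x + redOrder x * greenUpper f x)
      ((continuousOn_greenLower hf).add
        (continuousOn_redOrder.mul (continuousOn_greenUpper hf))) ?_ hx
    filter_upwards [h, ae_halfVol_nonneg] with y hy hy0
    rw [kernelIntegral_green hf hy0] at hy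
    exact (mul_eq_zero.1 hy).resolve_left (decaySol_ne_zero hy0)
  have hdU := ae_hasDerivAt_primitive fun b =>
    (integrableOn_decaySol_mul hf).mono_set (Icc_subset_Ici_self : Icc 0 b ⊆ Ici 0)
  have hdU' : ∀ᵐ x, 0 < x → HasDerivAt (greenUpper f) (-(decaySol x * f x)) x := by
    filter_upwards [hdU] with x hx hx0
    refine ((hx hx0).const_sub (greenUpper f 0)).congr_of_eventuallyEq ?_
    filter_upwards [eventually_nonneg_nhds hx0] with y hy
    exact greenUpper_eq_sub hf hy
  have hU : ∀ x, 0 ≤ x → greenUpper f x = 0 := by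
    intro x hx
    refine eq_zero_of_ae_eq_zero_Ici (continuousOn_greenUpper hf) (ae_halfVol_of_ae_pos ?_) hx
    filter_upwards [ae_hasDerivAt_primitive (integrableOn_redOrder_mul hf), hdU'] with x h1 h2 hx0
    -- In the derivative of the vanishing sum the terms with `f` cancel, leaving `v⁻² greenUpper f =
    -- 0`. As `f` is only in `L²`, this differentiation is available only almost everywhere.
    have h3 : HasDerivAt (fun x => greenLower f x + redOrder x * greenUpper f x)
        (redOrder x * decaySol x * f x + ((decaySol x ^ 2)⁻¹ * greenUpper f x +
          redOrder x * -(decaySol x * f x))) x :=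
      (h1 hx0).add ((hasDerivAt_redOrder hx0).mul (h2 hx0))
    have h4 : HasDerivAt (fun x => greenLower f x + redOrder x * greenUpper f x) 0 x :=
      (hasDerivAt_const x (0 : ℝ)).congr_of_eventuallyEq
        ((eventually_nonneg_nhds hx0).mono fun y hy => hsum y hy)
    have h5 := h3.unique h4
    have h6 : (decaySol x ^ 2)⁻¹ * greenUpper f x = 0 := by linarith
    exact (mul_eq_zero.1 h6).resolve_left
      (inv_ne_zero (pow_ne_zero 2 (decaySol_ne_zero hx0.le)))
  refine ae_halfVol_of_ae_pos ?_
  filter_upwards [hdU'] with x hx hx0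
  have h4 : HasDerivAt (greenUpper f) 0 x :=
    (hasDerivAt_const x (0 : ℝ)).congr_of_eventuallyEq
      ((eventually_nonneg_nhds hx0).mono fun y hy => hU y hy)
  have h5 := neg_eq_zero.1 ((hx hx0).unique h4)
  exact (mul_eq_zero.1 h5).resolve_left (decaySol_ne_zero hx0.le)

theorem abs_greenUpper_le (hf : MemLp f 2 halfVol) {x : ℝ} (hx : 0 ≤ x) :
    |greenUpper f x| ≤ |decaySol x| * √(∫ s, f s ^ 2 ∂halfVol) := by
  have hr : volume.restrict (Ioi x) ≤ halfVol :=
    Measure.restrict_mono ((Ioi_subset_Ioi hx).trans Ioi_subset_Ici_self) le_rfl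
  have hR : 0 ≤ ∫ s, f s ^ 2 ∂halfVol := integral_nonneg fun _ => sq_nonneg _
  have h1 := sq_integral_mul_le (memLp_decaySol.mono_measure hr) (hf.mono_measure hr)
  have h2 : ∫ s in Ioi x, f s ^ 2 ≤ ∫ s, f s ^ 2 ∂halfVol :=
    integral_mono_measure hr (.of_forall fun _ => sq_nonneg _) hf.integrable_sq
  have h3 := (decaySol_sq_tail hx).2
  have hN0 : 0 ≤ ∫ s in Ioi x, decaySol s ^ 2 := integral_nonneg fun _ => sq_nonneg _
  have h4 : ∫ s in Ioi x, decaySol s ^ 2 ≤ decaySol x ^ 2 := by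
    have := le_mul_of_one_le_left hN0 (one_le_sqrt_add_one hx)
    nlinarith [sq_nonneg (decaySol x)]
  apply abs_le_of_sq_le_sq' _ (by positivity) |> abs_le.2
  rw [mul_pow, sq_abs, Real.sq_sqrt hR]
  exact h1.trans (mul_le_mul h4 h2 (integral_nonneg fun _ => sq_nonneg _) (sq_nonneg _))

/-- Used with `c = |v x|` and `c = |v' x|`. The crude bound `|f| ≤ 1 + f²` gives linear growth,
which is enough because the Wronskian partner decays exponentially. -/
theorem mul_abs_greenLower_le (hf : MemLp f 2 halfVol) {x c : ℝ} (hx : 0 ≤ x) (hc : 0 ≤ c)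
    (h : ∀ s ∈ Icc 0 x, c * (redOrder s * |decaySol s|) ≤ 1) :
    c * |greenLower f x| ≤ x + ∫ s, f s ^ 2 ∂halfVol := by
  have hsub : volume.restrict (Ioc 0 x) ≤ halfVol :=
    Measure.restrict_mono (Ioc_subset_Icc_self.trans Icc_subset_Ici_self) le_rfl
  have hfs : IntegrableOn (fun s => f s ^ 2) (Ioc 0 x) := hf.integrable_sq.mono_measure hsub
  have h1 : c * |greenLower f x| = ‖∫ s in Ioc 0 x, c * (redOrder s * decaySol s * f s)‖ := by
    rw [integral_const_mul, norm_mul, Real.norm_of_nonneg hc, greenLower,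
      intervalIntegral.integral_of_le hx, Real.norm_eq_abs]
  have hone : IntegrableOn (fun _ => (1 : ℝ)) (Ioc 0 x) := integrableOn_const (by simp)
  have h2 : ∫ s in Ioc 0 x, (1 + f s ^ 2) ≤ x + ∫ s, f s ^ 2 ∂halfVol := by
    rw [integral_add hone hfs]
    have h3 : ∫ s in Ioc 0 x, f s ^ 2 ≤ ∫ s, f s ^ 2 ∂halfVol :=
      integral_mono_measure hsub (.of_forall fun _ => sq_nonneg _) hf.integrable_sq
    have h4 : ∫ s in Ioc 0 x, (1 : ℝ) = x := by simp [hx]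
    linarith
  rw [h1]
  refine (norm_integral_le_of_norm_le (hone.add hfs) ?_).trans h2
  filter_upwards [ae_restrict_mem measurableSet_Ioc] with s hs
  have h5 := h s ⟨hs.1.le, hs.2⟩
  have h6 : |f s| ≤ 1 + f s ^ 2 := by nlinarith [sq_nonneg (|f s| - 1), sq_abs (f s)]
  rw [norm_mul, norm_mul, norm_mul, Real.norm_of_nonneg hc,
    Real.norm_of_nonneg (redOrder_nonneg hs.1.le), Real.norm_eq_abs, Real.norm_eq_abs]
  calc c * (redOrder s * |decaySol s| * |f s|) = c * (redOrder s * |decaySol s|) * |f s| := by ring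
    _ ≤ 1 * |f s| := mul_le_mul_of_nonneg_right h5 (abs_nonneg _)
    _ ≤ 1 + f s ^ 2 := by linarith

/-- The derivative of `x ↦ kernelIntegral halfVol greenKernel f x`. -/
def greenDeriv (f : ℝ → ℝ) (x : ℝ) : ℝ :=
  decaySolDeriv x * (greenLower f x + redOrder x * greenUpper f x) + greenUpper f x / decaySol x

theorem abs_green_le (hf : MemLp f 2 halfVol) {x : ℝ} (hx : 0 ≤ x) :
    |decaySol x * (greenLower f x + redOrder x * greenUpper f x)| ≤
      x + ((∫ s, f s ^ 2 ∂halfVol) + 2 * √(∫ s, f s ^ 2 ∂halfVol)) := by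
  have h1 := mul_abs_greenLower_le hf hx (abs_nonneg (decaySol x)) fun s hs => by
    have h2 := abs_decaySol_antitoneOn (mem_Ici.2 hs.1) (mem_Ici.2 hx) hs.2
    have h3 := decaySol_sq_mul_redOrder_le hs.1
    refine le_trans (mul_le_mul_of_nonneg_right h2
      (mul_nonneg (redOrder_nonneg hs.1) (abs_nonneg _))) (le_trans (le_of_eq ?_) h3)
    simp only
    rw [← sq_abs (decaySol s)]; ring
  have h2 := abs_greenUpper_le hf hx
  set Q := √(∫ s, f s ^ 2 ∂halfVol)
  have hQ : 0 ≤ Q := Real.sqrt_nonneg _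
  have h3 : |decaySol x| * (redOrder x * |greenUpper f x|) ≤ Q := by
    calc _ ≤ |decaySol x| * (redOrder x * (|decaySol x| * Q)) := by
          have := redOrder_nonneg hx
          gcongr
      _ = decaySol x ^ 2 * redOrder x * Q := by rw [← sq_abs]; ring
      _ ≤ 1 * Q := mul_le_mul_of_nonneg_right (decaySol_sq_mul_redOrder_le hx) hQ
      _ = Q := one_mul Q
  have h4 := abs_add_le (decaySol x * greenLower f x) (decaySol x * (redOrder x * greenUpper f x))
  rw [abs_mul, abs_mul, abs_mul (redOrder x), abs_of_nonneg (redOrder_nonneg hx), ← mul_add] at h4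
  linarith

theorem abs_greenDeriv_le (hf : MemLp f 2 halfVol) {x : ℝ} (hx : 0 ≤ x) :
    |greenDeriv f x| ≤ x + ((∫ s, f s ^ 2 ∂halfVol) + 2 * √(∫ s, f s ^ 2 ∂halfVol)) := by
  have h1 := mul_abs_greenLower_le hf hx (abs_nonneg (decaySolDeriv x)) fun s hs => by
    have h2 := abs_decaySolDeriv_antitoneOn (mem_Ici.2 hs.1) (mem_Ici.2 hx) hs.2
    have h3 := abs_mul_redOrder_le hs.1
    refine le_trans (mul_le_mul_of_nonneg_right h2
      (mul_nonneg (redOrder_nonneg hs.1) (abs_nonneg _))) (le_trans (le_of_eq ?_) h3)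
    simp only
    rw [abs_mul]; ring
  have h2 := abs_greenUpper_le hf hx
  set Q := √(∫ s, f s ^ 2 ∂halfVol)
  have hQ : 0 ≤ Q := Real.sqrt_nonneg _
  have h3 : |decaySolDeriv x| * (redOrder x * |greenUpper f x|) ≤ Q := by
    calc _ ≤ |decaySolDeriv x| * (redOrder x * (|decaySol x| * Q)) := by
          have := redOrder_nonneg hx
          gcongr
      _ = |decaySol x * decaySolDeriv x| * redOrder x * Q := by rw [abs_mul]; ring
      _ ≤ 1 * Q := mul_le_mul_of_nonneg_right (abs_mul_redOrder_le hx) hQ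
      _ = Q := one_mul Q
  have h5 : |greenUpper f x / decaySol x| ≤ Q := by
    rw [abs_div, div_le_iff₀ (abs_pos.2 (decaySol_ne_zero hx)), mul_comm]
    exact h2
  have h4 := abs_add_le (decaySolDeriv x * greenLower f x)
    (decaySolDeriv x * (redOrder x * greenUpper f x))
  rw [abs_mul, abs_mul, abs_mul (redOrder x), abs_of_nonneg (redOrder_nonneg hx), ← mul_add] at h4
  have h6 := abs_add_le (decaySolDeriv x * (greenLower f x + redOrder x * greenUpper f x))
    (greenUpper f x / decaySol x)
  rw [greenDeriv]
  linarith

theorem hasDerivAt_greenLower (hc : ContinuousOn f (Ici 0)) {x : ℝ} (hx : 0 < x) :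
    HasDerivAt (greenLower f) (redOrder x * decaySol x * f x) x :=
  hasDerivAt_primitive_Ici ((continuousOn_redOrder.mul continuous_decaySol.continuousOn).mul hc) hx

theorem hasDerivAt_greenUpper (hf : MemLp f 2 halfVol) (hc : ContinuousOn f (Ici 0))
    {x : ℝ} (hx : 0 < x) :
    HasDerivAt (greenUpper f) (-(decaySol x * f x)) x := by
  refine ((hasDerivAt_primitive_Ici (continuous_decaySol.continuousOn.mul hc) hx).const_sub
    (greenUpper f 0)).congr_of_eventuallyEq ?_
  filter_upwards [eventually_nonneg_nhds hx] with y hy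
  exact greenUpper_eq_sub hf hy

/-- Variation of parameters: the terms with `f` cancel, and `v · redOrder' · greenUpper f =
greenUpper f / v`. -/
theorem hasDerivAt_green (hf : MemLp f 2 halfVol) (hc : ContinuousOn f (Ici 0))
    {x : ℝ} (hx : 0 < x) :
    HasDerivAt (fun x => decaySol x * (greenLower f x + redOrder x * greenUpper f x))
      (greenDeriv f x) x := by
  have h := (hasDerivAt_decaySol x).mul ((hasDerivAt_greenLower hc hx).add
    ((hasDerivAt_redOrder hx).mul (hasDerivAt_greenUpper hf hc hx)))
  convert! h using 1
  have := decaySol_ne_zero hx.le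
  simp only [greenDeriv, Pi.add_apply, Pi.mul_apply]
  field_simp
  ring

theorem hasDerivAt_greenDeriv (hf : MemLp f 2 halfVol) (hc : ContinuousOn f (Ici 0))
    {x : ℝ} (hx : 0 < x) :
    HasDerivAt (greenDeriv f) ((x + 1) *
      (decaySol x * (greenLower f x + redOrder x * greenUpper f x)) - f x) x := by
  have h0 := decaySol_ne_zero hx.le
  have h := ((hasDerivAt_decaySolDeriv x).mul ((hasDerivAt_greenLower hc hx).add
    ((hasDerivAt_redOrder hx).mul (hasDerivAt_greenUpper hf hc hx)))).add
    ((hasDerivAt_greenUpper hf hc hx).div (hasDerivAt_decaySol x) h0)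
  convert! h using 1
  simp only [Pi.add_apply, Pi.mul_apply]
  field_simp
  ring

theorem continuousOn_green (hf : MemLp f 2 halfVol) : ContinuousOn
    (fun x => decaySol x * (greenLower f x + redOrder x * greenUpper f x)) (Ici 0) :=
  continuous_decaySol.continuousOn.mul ((continuousOn_greenLower hf).add
    (continuousOn_redOrder.mul (continuousOn_greenUpper hf)))

theorem continuousOn_greenDeriv (hf : MemLp f 2 halfVol) :
    ContinuousOn (greenDeriv f) (Ici 0) :=
  (continuous_decaySolDeriv.continuousOn.mul ((continuousOn_greenLower hf).add
    (continuousOn_redOrder.mul (continuousOn_greenUpper hf)))).add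
    ((continuousOn_greenUpper hf).div continuous_decaySol.continuousOn
      fun _ hx => decaySol_ne_zero hx)

end Green

/-! ### Eigenvectors of the Green operator and completeness of the Airy functions -/

theorem eqOn_const_of_hasDerivAt_zero {W : ℝ → ℝ} (hW : ContinuousOn W (Ici 0))
    (d : ∀ x, 0 < x → HasDerivAt W 0 x) {x : ℝ} (hx : 0 ≤ x) : W x = W 0 := by
  have hd : ∀ x ∈ interior (Ici (0 : ℝ)), HasDerivWithinAt W 0 (interior (Ici 0)) x := by
    intro x hx
    rw [interior_Ici] at hx
    exact (d x hx).hasDerivWithinAt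
  exact le_antisymm
    (antitoneOn_of_hasDerivWithinAt_nonpos (convex_Ici 0) hW hd (fun _ _ => le_rfl)
      (mem_Ici.2 le_rfl) (mem_Ici.2 hx) hx)
    (monotoneOn_of_hasDerivWithinAt_nonneg (convex_Ici 0) hW hd (fun _ _ => le_rfl)
      (mem_Ici.2 le_rfl) (mem_Ici.2 hx) hx)

/-- A solution of `y'' = (x - t) y` on `[0, ∞)` with Dirichlet condition and at most linear growth
is trivial or a multiple of a shifted Airy function. -/
theorem eq_const_mul_airy {y y' : ℝ → ℝ} {t B : ℝ} (hy : ContinuousOn y (Ici 0))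
    (hy' : ContinuousOn y' (Ici 0)) (d : ∀ x, 0 < x → HasDerivAt y (y' x) x)
    (d' : ∀ x, 0 < x → HasDerivAt y' ((x - t) * y x) x) (h0 : y 0 = 0)
    (hb : ∀ x, 0 ≤ x → |y x| ≤ B * (x + 1)) (hb' : ∀ x, 0 ≤ x → |y' x| ≤ B * (x + 1)) :
    (∀ x, 0 ≤ x → y x = 0) ∨
      ∃ c, airyRe (-t) = 0 ∧ ∀ x, 0 ≤ x → y x = c * airyRe (x - t) := by
  set a : ℝ → ℝ := fun x => airyRe (x - t) with ha
  set a' : ℝ → ℝ := fun x => airyDeriv (x - t) with ha'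
  have hac : Continuous a := continuous_airyRe.comp (continuous_id.sub continuous_const)
  have hac' : Continuous a' := continuous_airyDeriv.comp (continuous_id.sub continuous_const)
  have da : ∀ x, HasDerivAt a (a' x) x := fun x => (hasDerivAt_airyRe (x - t)).comp_sub_const x t
  have da' : ∀ x, HasDerivAt a' ((x - t) * a x) x := fun x =>
    (hasDerivAt_airyDeriv (x - t)).comp_sub_const x t
  -- The Wronskian of two solutions of the same equation is constant.
  have hW : ∀ x, 0 ≤ x → y x * a' x - y' x * a x = y 0 * a' 0 - y' 0 * a 0 := fun x hx => by
    refine eqOn_const_of_hasDerivAt_zero (W := fun x => y x * a' x - y' x * a x)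
      ((hy.mul hac'.continuousOn).sub (hy'.mul hac.continuousOn)) (fun x hx => ?_) hx
    convert! ((d x hx).mul (da' x)).sub ((d' x hx).mul (da x)) using 1
    ring
  -- Linear growth of `y`, `y'` against exponential decay of `a`, `a'` forces the constant to be
  -- `0`; at `x = 0`, where `y = 0`, only `y' 0 * a 0` remains.
  have hW0 : y' 0 * a 0 = 0 := by
    obtain ⟨C, hC, h1⟩ := exists_abs_airyRe_le
    obtain ⟨C', hC', h2⟩ := exists_abs_airyDeriv_le
    have hlim : Tendsto (fun x : ℝ => B * (C + C') * Real.exp t * (x ^ 1 * Real.exp (-x) +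
        Real.exp (-x))) atTop (𝓝 0) := by
      simpa using ((Real.tendsto_pow_mul_exp_neg_atTop_nhds_zero 1).add
        Real.tendsto_exp_neg_atTop_nhds_zero).const_mul (B * (C + C') * Real.exp t)
    have hlim2 : Tendsto (fun _ : ℝ => y 0 * a' 0 - y' 0 * a 0) atTop (𝓝 0) := by
      refine squeeze_zero_norm' ?_ hlim
      filter_upwards [eventually_ge_atTop 0] with x hx
      rw [← hW x hx]
      have e1 := h1 (x - t)
      have e2 := h2 (x - t)
      have e3 : Real.exp (-(x - t)) = Real.exp t * Real.exp (-x) := by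
        rw [← Real.exp_add]; ring_nf
      rw [e3] at e1 e2
      have hB : 0 ≤ B * (x + 1) := (abs_nonneg _).trans (hb x hx)
      calc ‖y x * a' x - y' x * a x‖ ≤ ‖y x * a' x‖ + ‖y' x * a x‖ := norm_sub_le _ _
        _ = |y x| * |a' x| + |y' x| * |a x| := by rw [norm_mul, norm_mul]; rfl
        _ ≤ (B * (x + 1)) * (C' * (Real.exp t * Real.exp (-x))) +
            (B * (x + 1)) * (C * (Real.exp t * Real.exp (-x))) :=
          add_le_add (mul_le_mul (hb x hx) e2 (abs_nonneg _) hB)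
            (mul_le_mul (hb' x hx) e1 (abs_nonneg _) hB)
        _ = _ := by ring
    have := tendsto_nhds_unique tendsto_const_nhds hlim2
    rw [h0] at this
    linarith
  rcases mul_eq_zero.1 hW0 with h | h
  · left
    intro x hx
    exact (eq_zero_of_second_order_ode (p := fun x => x - t) (by fun_prop) hy hy' d d' h0 h hx).1
  · right
    have hz : airyRe (-t) = 0 := by simpa [ha] using h
    have hz' : a' 0 ≠ 0 := by
      have := airyDeriv_ne_zero hz
      simpa [ha'] using this
    -- Both `y` and `a` vanish at `0`; this multiple matches their slopes, so uniqueness applies to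
    -- the difference.
    refine ⟨y' 0 / a' 0, hz, fun x hx => ?_⟩
    have key := (eq_zero_of_second_order_ode (p := fun x => x - t)
      (y := fun x => y x - y' 0 / a' 0 * a x) (y' := fun x => y' x - y' 0 / a' 0 * a' x)
      (by fun_prop) (hy.sub (continuous_const.mul hac).continuousOn)
      (hy'.sub (continuous_const.mul hac').continuousOn)
      (fun x hx => (d x hx).sub ((da x).const_mul _))
      (fun x hx => by
        convert! (d' x hx).sub ((da' x).const_mul (y' 0 / a' 0)) using 1
        ring)
      (by rw [h0, h]; simp) (by rw [div_mul_cancel₀ _ hz', sub_self]) hx).1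
    linarith

/-- For `κ ≠ 0`, applying `-∂ₓ² + (x + 1)` to `κ g = G g` gives `g'' = (x + 1 - κ⁻¹) g`, which is
Airy's equation shifted by `t = κ⁻¹ - 1`. The case `κ = 0` is injectivity. -/
theorem eigenvector_greenOp {h : Lp ℝ 2 halfVol} {κ : ℝ}
    (hh : kernelOp memLp_greenKernel h = κ • h) :
    h = 0 ∨ ∃ c t, airyRe (-t) = 0 ∧ h =ᵐ[halfVol] fun x => c * airyRe (x - t) := by
  have h1 : kernelIntegral halfVol greenKernel h =ᵐ[halfVol] fun x => κ * h x := by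
    filter_upwards [coeFn_kernelOp memLp_greenKernel h, Lp.coeFn_smul κ h] with x h1 h2
    rw [← h1, hh, h2, Pi.smul_apply, smul_eq_mul]
  have hmem := Lp.memLp h
  by_cases hκ : κ = 0
  · left
    rw [Lp.eq_zero_iff_ae_eq_zero]
    refine ae_eq_zero_of_green_eq_zero hmem ?_
    filter_upwards [h1] with x hx
    rw [hx, hκ, zero_mul, Pi.zero_apply]
  -- The continuous representative of `h`: only for continuous data is the Green integral
  -- differentiable at every `x > 0`.
  · set g : ℝ → ℝ := fun x =>
      κ⁻¹ * (decaySol x * (greenLower h x + redOrder x * greenUpper h x)) with hg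
    have hgc : ContinuousOn g (Ici 0) := continuousOn_const.mul (continuousOn_green hmem)
    have hge : h =ᵐ[halfVol] g := by
      filter_upwards [h1, ae_halfVol_nonneg] with x hx hx0
      rw [kernelIntegral_green hmem hx0] at hx
      rw [hg]
      simp only
      rw [hx, inv_mul_cancel_left₀ hκ]
    have hgm : MemLp g 2 halfVol := hmem.ae_eq hge
    have hself : ∀ x, 0 ≤ x →
        decaySol x * (greenLower g x + redOrder x * greenUpper g x) = κ * g x := by
      intro x hx
      have e1 : kernelIntegral halfVol greenKernel g x =
          kernelIntegral halfVol greenKernel h x := by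
        refine integral_congr_ae ?_
        filter_upwards [hge] with y hy
        rw [hy]
      rw [← kernelIntegral_green hgm hx, e1, kernelIntegral_green hmem hx, hg]
      simp only
      rw [mul_inv_cancel_left₀ hκ]
    set R := (∫ s, g s ^ 2 ∂halfVol) + 2 * √(∫ s, g s ^ 2 ∂halfVol) with hR
    have hR0 : 0 ≤ R := by
      have : 0 ≤ ∫ s, g s ^ 2 ∂halfVol := integral_nonneg fun _ => sq_nonneg _
      positivity
    have hbound : ∀ z x : ℝ, 0 ≤ x → |z| ≤ x + R → |κ⁻¹ * z| ≤ |κ⁻¹| * (1 + R) * (x + 1) := by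
      intro z x hx hz
      rw [abs_mul, mul_assoc]
      refine mul_le_mul_of_nonneg_left (hz.trans ?_) (abs_nonneg _)
      nlinarith [mul_nonneg hR0 hx]
    have hgself : ∀ x, 0 ≤ x →
        g x = κ⁻¹ * (decaySol x * (greenLower g x + redOrder x * greenUpper g x)) := fun x hx => by
      rw [hself x hx, inv_mul_cancel_left₀ hκ]
    rcases eq_const_mul_airy (y := g) (y' := fun x => κ⁻¹ * greenDeriv g x) (t := κ⁻¹ - 1)
      (B := |κ⁻¹| * (1 + R)) hgc (continuousOn_const.mul (continuousOn_greenDeriv hgm))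
      (fun x hx => ((hasDerivAt_green hgm hgc hx).const_mul κ⁻¹).congr_of_eventuallyEq
        ((eventually_nonneg_nhds hx).mono hgself))
      (fun x hx => by
        convert! (hasDerivAt_greenDeriv hgm hgc hx).const_mul κ⁻¹ using 1
        rw [hself x hx.le]
        field_simp
        ring)
      (by rw [hgself 0 le_rfl, greenLower, intervalIntegral.integral_same, redOrder_zero]; simp)
      (fun x hx => by rw [hgself x hx]; exact hbound _ x hx (abs_green_le hgm hx))
      (fun x hx => hbound _ x hx (abs_greenDeriv_le hgm hx)) with hz | ⟨c, hz, hc⟩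
    · left
      rw [Lp.eq_zero_iff_ae_eq_zero]
      filter_upwards [hge, ae_halfVol_nonneg] with x hx hx0
      rw [hx, hz x hx0, Pi.zero_apply]
    · right
      refine ⟨c, κ⁻¹ - 1, hz, ?_⟩
      filter_upwards [hge, ae_halfVol_nonneg] with x hx hx0
      rw [hx, hc x hx0]

/-- Completeness of the shifted Airy functions in `L²(0, ∞)`, real version. -/
theorem ae_eq_zero_of_forall_integral_airyRe {f : ℝ → ℝ} (hf : MemLp f 2 halfVol)
    (h : ∀ t, airyRe (-t) = 0 → ∫ x, f x * airyRe (x - t) ∂halfVol = 0) : f =ᵐ[halfVol] 0 := by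
  -- Spectral theorem for compact symmetric operators: the eigenspaces have no common orthogonal
  -- vector but `0`, and `f` is orthogonal to each of them.
  have hbot := ContinuousLinearMap.orthogonalComplement_iSup_eigenspaces_eq_bot
    (isCompactOperator_kernelOp memLp_greenKernel greenKernel_symm)
    (isSymmetric_kernelOp memLp_greenKernel greenKernel_symm)
  have hmem : hf.toLp f ∈
      (⨆ μ, Module.End.eigenspace (kernelOp memLp_greenKernel : Module.End ℝ _) μ)ᗮ := by
    rw [Submodule.mem_orthogonal]
    intro u hu
    induction hu using Submodule.iSup_induction' with
    | mem κ u hu =>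
      rw [Module.End.mem_eigenspace_iff] at hu
      rcases eigenvector_greenOp hu with h0 | ⟨c, t, ht, hc⟩
      · rw [h0, inner_zero_left]
      · rw [L2.inner_def]
        calc _ = ∫ x, c * (f x * airyRe (x - t)) ∂halfVol := by
              refine integral_congr_ae ?_
              filter_upwards [hc, hf.coeFn_toLp] with x h1 h2
              rw [h1, h2]
              simp only [RCLike.inner_apply, conj_trivial]
              ring
          _ = 0 := by rw [integral_const_mul, h t ht, mul_zero]
    | zero => exact inner_zero_left _
    | add u v _ _ hu hv => rw [inner_add_left, hu, hv, add_zero]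
  rw [hbot, Submodule.mem_bot] at hmem
  have := hf.coeFn_toLp
  rw [hmem] at this
  exact this.symm.trans (Lp.coeFn_zero ℝ 2 halfVol)

/-! ### Dilated Airy functions on the half-line -/

theorem halfVol_map_mul {a : ℝ} (ha : 0 < a) :
    halfVol.map (a * ·) = ENNReal.ofReal a⁻¹ • halfVol := by
  have hpre : (a * ·) ⁻¹' Ici (0 : ℝ) = Ici 0 := by
    ext x; simp [ha]
  have h := Measure.restrict_map (μ := (volume : Measure ℝ)) (f := (a * ·)) (s := Ici 0)
    (measurable_const_mul a) measurableSet_Ici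
  rw [hpre, Real.map_volume_mul_left ha.ne', Measure.restrict_smul,
    abs_of_pos (inv_pos.2 ha)] at h
  exact h.symm

theorem measurableEmbedding_mul {a : ℝ} (ha : 0 < a) : MeasurableEmbedding (a * · : ℝ → ℝ) :=
  (Homeomorph.mulLeft₀ a ha.ne').measurableEmbedding

theorem memLp_exp_neg {a : ℝ} (ha : 0 < a) (C : ℝ) :
    MemLp (fun x => C * Real.exp (-(a * x))) 2 halfVol := by
  refine MemLp.const_mul ?_ C
  rw [memLp_two_iff_integrable_sq (by fun_prop)]
  have h := (integrableOn_Ici_iff_integrableOn_Ioi).2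
    (exp_neg_integrableOn_Ioi (0 : ℝ) (b := 2 * a) (by positivity))
  refine Integrable.congr (μ := halfVol) h (.of_forall fun x => ?_)
  simp only
  rw [← Real.exp_nat_mul]
  congr 1
  push_cast; ring

theorem exists_abs_scaled_airyRe_le (a t : ℝ) :
    ∃ C, 0 ≤ C ∧ ∀ x, |airyRe (a * x - t)| ≤ C * Real.exp (-(a * x)) := by
  obtain ⟨C, hC, h⟩ := exists_abs_airyRe_le
  refine ⟨C * Real.exp t, by positivity, fun x => (h _).trans (le_of_eq ?_)⟩
  rw [mul_assoc, ← Real.exp_add]; ring_nf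

theorem exists_abs_scaled_airyDeriv_le (a t : ℝ) :
    ∃ C, 0 ≤ C ∧ ∀ x, |airyDeriv (a * x - t)| ≤ C * Real.exp (-(a * x)) := by
  obtain ⟨C, hC, h⟩ := exists_abs_airyDeriv_le
  refine ⟨C * Real.exp t, by positivity, fun x => (h _).trans (le_of_eq ?_)⟩
  rw [mul_assoc, ← Real.exp_add]; ring_nf

theorem memLp_scaled_airyAi {a : ℝ} (ha : 0 < a) (t : ℝ) :
    MemLp (fun x => airyAi (a * x - t)) 2 halfVol := by
  obtain ⟨C, hC, h⟩ := exists_abs_scaled_airyRe_le a t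
  have hc : Continuous (fun x : ℝ => ((airyRe (a * x - t) : ℝ) : ℂ)) :=
    Complex.continuous_ofReal.comp (continuous_airyRe.comp (by fun_prop))
  simp only [airyAi_eq_ofReal]
  refine (memLp_exp_neg ha C).mono hc.aestronglyMeasurable (.of_forall fun x => ?_)
  rw [Complex.norm_real, Real.norm_eq_abs]
  exact (h x).trans (le_abs_self _)

/-- Completeness of the rescaled and shifted Airy functions in `L²(0, ∞)`. -/
theorem ae_eq_zero_of_forall_integral_airyAi {f : ℝ → ℂ} (hf : MemLp f 2 halfVol) {a : ℝ}
    (ha : 0 < a)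
    (h : ∀ t, airyRe (-t) = 0 → ∫ x, f x * airyAi (a * x - t) ∂halfVol = 0) :
    f =ᵐ[halfVol] 0 := by
  have hsmul : halfVol.map (a * ·) = ENNReal.ofReal a⁻¹ • halfVol := halfVol_map_mul ha
  have hemb := measurableEmbedding_mul ha
  have real : ∀ g : ℝ → ℝ, MemLp g 2 halfVol →
      (∀ t, airyRe (-t) = 0 → ∫ x, g x * airyRe (a * x - t) ∂halfVol = 0) →
      g =ᵐ[halfVol] 0 := by
    intro g hg hgt
    have hcomp : (fun x => g (a⁻¹ * (a * x))) = g := by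
      ext x; rw [inv_mul_cancel_left₀ ha.ne']
    -- The function `x ↦ g (x / a)` is orthogonal to the undilated Airy functions; the dilation
    -- changes the measure only by a constant factor.
    have hm : MemLp (fun x => g (a⁻¹ * x)) 2 halfVol := by
      have h1 : MemLp (fun x => g (a⁻¹ * x)) 2 (halfVol.map (a * ·)) := by
        rw [hemb.memLp_map_measure_iff]
        simpa only [Function.comp_def, hcomp] using hg
      rw [hsmul] at h1
      have h2 := h1.smul_measure (c := ENNReal.ofReal a) ENNReal.ofReal_ne_top
      rwa [smul_smul, ← ENNReal.ofReal_mul ha.le, mul_inv_cancel₀ ha.ne', ENNReal.ofReal_one,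
        one_smul] at h2
    have hz : (fun x => g (a⁻¹ * x)) =ᵐ[halfVol] 0 := by
      refine ae_eq_zero_of_forall_integral_airyRe hm fun t ht => ?_
      have h2 := hgt t ht
      have h3 : ∫ x, g (a⁻¹ * x) * airyRe (x - t) ∂(halfVol.map (a * ·)) = 0 := by
        rw [hemb.integral_map, ← h2]
        simp only [inv_mul_cancel_left₀ ha.ne']
      rw [hsmul, integral_smul_measure] at h3
      refine (smul_eq_zero.1 h3).resolve_left ?_
      rw [ENNReal.toReal_ofReal (inv_nonneg.2 ha.le)]
      exact inv_ne_zero ha.ne'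
    have hz' : ∀ᵐ x ∂(halfVol.map (a * ·)), g (a⁻¹ * x) = 0 := by
      rw [hsmul]
      exact (Measure.smul_absolutelyContinuous).ae_le hz
    rw [hemb.ae_map_iff] at hz'
    filter_upwards [hz'] with x hx
    rwa [inv_mul_cancel_left₀ ha.ne'] at hx
  have hint : ∀ t, Integrable (fun x => f x * airyAi (a * x - t)) halfVol := fun t =>
    hf.integrable_mul (memLp_scaled_airyAi ha t)
  have hre := real (fun x => (f x).re) hf.re fun t ht => by
    have h1 := congrArg Complex.re (h t ht)
    have h2 := integral_re (hint t)
    rw [← RCLike.re_eq_complex_re, ← h2, map_zero] at h1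
    rw [← h1]
    congr 1; ext x
    rw [airyAi_eq_ofReal, RCLike.re_eq_complex_re, Complex.re_mul_ofReal]
  have him := real (fun x => (f x).im) hf.im fun t ht => by
    have h1 := congrArg Complex.im (h t ht)
    have h2 := integral_im (hint t)
    rw [← RCLike.im_eq_complex_im, ← h2, map_zero] at h1
    rw [← h1]
    congr 1; ext x
    rw [airyAi_eq_ofReal, RCLike.im_eq_complex_im, Complex.im_mul_ofReal]
  filter_upwards [hre, him] with x h1 h2
  exact Complex.ext h1 h2

/-! ### Test functions, integration by parts and symmetry of the Dirichlet realization -/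

section Calculus

/-- The `2π`-periodic lift. -/
def lift (ψ : ℝ × Circ → ℂ) (p : ℝ × ℝ) : ℂ := ψ (p.1, (p.2 : Circ))

theorem isOpenQuotientMap_lift :
    IsOpenQuotientMap (Prod.map id ((↑) : ℝ → Circ) : ℝ × ℝ → ℝ × Circ) :=
  IsOpenQuotientMap.id.prodMap QuotientAddGroup.isOpenQuotientMap_mk

variable {φ ψ : ℝ × Circ → ℂ}

theorem Smooth.continuous (h : Smooth ψ) : Continuous ψ :=
  isOpenQuotientMap_lift.isQuotientMap.continuous_iff.2 (ContDiff.continuous h)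

theorem Smooth.mul (hφ : Smooth φ) (hψ : Smooth ψ) : Smooth (fun p => φ p * ψ p) :=
  ContDiff.mul hφ hψ

theorem Smooth.hasDerivAt_fst (h : Smooth ψ) (x : ℝ) (z : Circ) :
    HasDerivAt (fun s : ℝ => ψ (s, z)) (dx ψ (x, z)) x := by
  obtain ⟨y, rfl⟩ := QuotientAddGroup.mk_surjective z
  have hd : DifferentiableAt ℝ (fun s : ℝ => lift ψ (s, y)) x :=
    ((ContDiff.differentiable h (by simp)).comp
      (differentiable_id.prodMk (differentiable_const y))) x
  exact hd.hasDerivAt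

theorem Smooth.dx_lift (h : Smooth ψ) (x y : ℝ) :
    dx ψ (x, (y : Circ)) = fderiv ℝ (lift ψ) (x, y) (1, 0) := by
  have h1 := (ContDiff.differentiable h (by simp) (x, y)).hasFDerivAt
  have h2 : HasDerivAt (fun s : ℝ => ((s, y) : ℝ × ℝ)) (1, 0) x :=
    (hasDerivAt_id x).prodMk (hasDerivAt_const x y)
  have h3 : HasDerivAt (fun s : ℝ => ψ (s, (y : Circ))) (fderiv ℝ (lift ψ) (x, y) (1, 0)) x :=
    HasFDerivAt.comp_hasDerivAt (l := lift ψ) (f := fun s : ℝ => (s, y)) x h1 h2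
  exact (h.hasDerivAt_fst x y).unique h3

theorem Smooth.hasDerivAt_lift_snd (h : Smooth ψ) (x y : ℝ) :
    HasDerivAt (fun s : ℝ => ψ (x, (s : Circ))) (fderiv ℝ (lift ψ) (x, y) (0, 1)) y := by
  have h1 := (ContDiff.differentiable h (by simp) (x, y)).hasFDerivAt
  have h2 : HasDerivAt (fun s : ℝ => ((x, s) : ℝ × ℝ)) (0, 1) y :=
    (hasDerivAt_const y x).prodMk (hasDerivAt_id y)
  exact h1.comp_hasDerivAt y h2

theorem Smooth.dy_lift (h : Smooth ψ) (x y : ℝ) :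
    dy ψ (x, (y : Circ)) = fderiv ℝ (lift ψ) (x, y) (0, 1) := by
  have h1 : HasDerivAt (fun s : ℝ => ψ (x, ((y + s : ℝ) : Circ)))
      (fderiv ℝ (lift ψ) (x, y) (0, 1)) 0 := by
    have := h.hasDerivAt_lift_snd x (y + 0)
    rw [add_zero y] at this
    exact HasDerivAt.comp_const_add (a := y) (x := 0) (by rw [add_zero]; exact this)
  exact h1.deriv

theorem Smooth.hasDerivAt_snd (h : Smooth ψ) (x y : ℝ) :
    HasDerivAt (fun s : ℝ => ψ (x, (s : Circ))) (dy ψ (x, (y : Circ))) y := by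
  rw [h.dy_lift]; exact h.hasDerivAt_lift_snd x y

theorem Smooth.dx (h : Smooth ψ) : Smooth (dx ψ) := by
  have : (fun p : ℝ × ℝ => Friedlander.dx ψ (p.1, (p.2 : Circ))) =
      fun p => fderiv ℝ (lift ψ) p (1, 0) := funext fun p => h.dx_lift p.1 p.2
  unfold Smooth
  rw [this]
  exact (ContDiff.fderiv_right h (m := ∞) (by simp)).clm_apply contDiff_const

theorem Smooth.dy (h : Smooth ψ) : Smooth (dy ψ) := by
  have : (fun p : ℝ × ℝ => Friedlander.dy ψ (p.1, (p.2 : Circ))) =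
      fun p => fderiv ℝ (lift ψ) p (0, 1) := funext fun p => h.dy_lift p.1 p.2
  unfold Smooth
  rw [this]
  exact (ContDiff.fderiv_right h (m := ∞) (by simp)).clm_apply contDiff_const

theorem Smooth.dx_mul (hφ : Smooth φ) (hψ : Smooth ψ) (p : ℝ × Circ) :
    Friedlander.dx (fun p => φ p * ψ p) p =
      Friedlander.dx φ p * ψ p + φ p * Friedlander.dx ψ p :=
  ((hφ.hasDerivAt_fst p.1 p.2).mul (hψ.hasDerivAt_fst p.1 p.2)).deriv

theorem Smooth.dy_mul (hφ : Smooth φ) (hψ : Smooth ψ) (p : ℝ × Circ) :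
    Friedlander.dy (fun p => φ p * ψ p) p =
      Friedlander.dy φ p * ψ p + φ p * Friedlander.dy ψ p := by
  obtain ⟨x, z⟩ := p
  obtain ⟨y, rfl⟩ := QuotientAddGroup.mk_surjective z
  exact ((hφ.mul hψ).hasDerivAt_snd x y).unique
    ((hφ.hasDerivAt_snd x y).mul (hψ.hasDerivAt_snd x y))

/-- The coefficient `1 + x`. -/
def weight (p : ℝ × Circ) : ℂ := 1 + (p.1 : ℂ)

theorem smooth_weight : Smooth weight :=
  contDiff_const.add (Complex.ofRealCLM.contDiff.comp contDiff_fst)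

theorem dy_weight (p : ℝ × Circ) : dy weight p = 0 := by
  unfold dy weight; simp

theorem dx_eq_zero_of_eventually {p : ℝ × Circ} (h : ψ =ᶠ[𝓝 p] 0) : dx ψ p = 0 := by
  have hc : Tendsto (fun s : ℝ => (s, p.2)) (𝓝 p.1) (𝓝 p) :=
    (continuous_id.prodMk continuous_const).tendsto p.1
  have h1 : (fun s : ℝ => ψ (s, p.2)) =ᶠ[𝓝 p.1] fun _ => 0 := hc.eventually h
  rw [dx, h1.deriv_eq, deriv_const]

theorem dy_eq_zero_of_eventually {p : ℝ × Circ} (h : ψ =ᶠ[𝓝 p] 0) : dy ψ p = 0 := by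
  have hc : Tendsto (fun s : ℝ => (p.1, p.2 + (s : Circ))) (𝓝 0) (𝓝 p) := by
    have : Continuous (fun s : ℝ => (p.1, p.2 + (s : Circ))) :=
      continuous_const.prodMk (continuous_const.add (AddCircle.continuous_mk' _))
    simpa using this.tendsto 0
  have h1 : (fun s : ℝ => ψ (p.1, p.2 + (s : Circ))) =ᶠ[𝓝 0] fun _ => 0 := hc.eventually h
  rw [dy, h1.deriv_eq, deriv_const]

theorem support_dx_subset : Function.support (dx ψ) ⊆ tsupport ψ := fun p hp => by
  by_contra hc
  exact hp (dx_eq_zero_of_eventually (notMem_tsupport_iff_eventuallyEq.1 hc))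

theorem support_dy_subset : Function.support (dy ψ) ⊆ tsupport ψ := fun p hp => by
  by_contra hc
  exact hp (dy_eq_zero_of_eventually (notMem_tsupport_iff_eventuallyEq.1 hc))

theorem IsTest.of_support_subset (h : IsTest ψ) (hφ : Smooth φ)
    (hs : Function.support φ ⊆ tsupport ψ) : IsTest φ where
  smooth := hφ
  compact := h.compact.mono' hs
  interior := (closure_minimal hs (isClosed_tsupport ψ)).trans h.interior

theorem IsTest.dx (h : IsTest ψ) : IsTest (dx ψ) :=
  h.of_support_subset h.smooth.dx support_dx_subset

theorem IsTest.dy (h : IsTest ψ) : IsTest (dy ψ) :=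
  h.of_support_subset h.smooth.dy support_dy_subset

theorem IsTest.mul_left (h : IsTest ψ) (hφ : Smooth φ) : IsTest (fun p => φ p * ψ p) :=
  h.of_support_subset (hφ.mul h.smooth)
    ((Function.support_mul_subset_right _ _).trans (subset_tsupport ψ))

theorem IsTest.opL (h : IsTest ψ) : IsTest (opL ψ) := by
  refine h.of_support_subset ?_ fun p hp => ?_
  · exact (ContDiff.neg h.dx.dx.smooth).sub (smooth_weight.mul h.dy.dy.smooth)
  · by_contra hc
    have h1 : Friedlander.dx (Friedlander.dx ψ) p = 0 := by
      by_contra h2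
      exact hc (closure_minimal support_dx_subset (isClosed_tsupport ψ) (support_dx_subset h2))
    have h1' : Friedlander.dy (Friedlander.dy ψ) p = 0 := by
      by_contra h2
      exact hc (closure_minimal support_dy_subset (isClosed_tsupport ψ) (support_dy_subset h2))
    exact hp (by rw [Friedlander.opL, h1, h1']; simp)

instance : IsFiniteMeasureOnCompacts vol := by unfold vol; infer_instance

theorem IsTest.memLp (h : IsTest ψ) : MemLp ψ 2 vol :=
  h.smooth.continuous.memLp_of_hasCompactSupport h.compact

theorem IsTest.integrable (h : IsTest ψ) : Integrable ψ vol :=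
  h.smooth.continuous.integrable_of_hasCompactSupport h.compact

theorem ae_vol_nonneg : ∀ᵐ p ∂vol, 0 ≤ p.1 :=
  Measure.quasiMeasurePreserving_fst.ae ae_halfVol_nonneg

theorem IsTest.exists_bound (h : IsTest ψ) :
    ∃ B, ∀ x z, x ∉ Icc 0 B → ψ (x, z) = 0 := by
  obtain ⟨B, hB⟩ := (h.compact.image continuous_fst).bddAbove
  refine ⟨B, fun x z hx => ?_⟩
  by_contra hne
  have hm := subset_tsupport ψ hne
  exact hx ⟨le_of_lt (h.interior hm).1, hB ⟨_, hm, rfl⟩⟩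

/-- A test function is supported away from `x = 0`, so the half-line integral is one over all of `ℝ`
and there is no boundary term. -/
theorem IsTest.integral_dx (h : IsTest ψ) : ∫ p, Friedlander.dx ψ p ∂vol = 0 := by
  have hi := h.dx.integrable
  unfold vol at hi ⊢
  rw [integral_prod_symm _ hi]
  refine integral_eq_zero_of_ae (.of_forall fun z => ?_)
  obtain ⟨B, hB⟩ := h.exists_bound
  obtain ⟨B', hB'⟩ := h.dx.exists_bound
  have e1 : ∫ x in Ici (0 : ℝ), Friedlander.dx ψ (x, z) = ∫ x, Friedlander.dx ψ (x, z) :=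
    setIntegral_eq_integral_of_forall_compl_eq_zero fun x hx =>
      hB' x z fun hc => hx hc.1
  simp only [Pi.zero_apply]
  rw [e1]
  have hz : Continuous fun x : ℝ => (x, z) := continuous_id.prodMk continuous_const
  exact integral_eq_zero_of_hasDerivAt_of_integrable (fun x => h.smooth.hasDerivAt_fst x z)
    ((h.dx.smooth.continuous.comp hz).integrable_of_hasCompactSupport
      (HasCompactSupport.intro isCompact_Icc fun x hx => hB' x z hx))
    ((h.smooth.continuous.comp hz).integrable_of_hasCompactSupport
      (HasCompactSupport.intro isCompact_Icc fun x hx => hB x z hx))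

theorem IsTest.integral_dy (h : IsTest ψ) : ∫ p, Friedlander.dy ψ p ∂vol = 0 := by
  have hi := h.dy.integrable
  unfold vol at hi ⊢
  rw [integral_prod _ hi]
  refine integral_eq_zero_of_ae (.of_forall fun x => ?_)
  simp only [Pi.zero_apply]
  rw [← AddCircle.intervalIntegral_preimage (2 * Real.pi) 0,
    intervalIntegral.integral_eq_sub_of_hasDerivAt
      (f := fun s : ℝ => ψ (x, (s : Circ))) (fun y _ => h.smooth.hasDerivAt_snd x y)]
  · rw [zero_add, AddCircle.coe_period, AddCircle.coe_zero, sub_self]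
  · refine Continuous.intervalIntegrable ?_ _ _
    exact h.dy.smooth.continuous.comp
      (continuous_const.prodMk (AddCircle.continuous_mk' _))

/-- The energy form on smooth functions. -/
def energy (φ ψ : ℝ × Circ → ℂ) : ℂ :=
  ∫ p, (dx φ p * dx ψ p + weight p * (dy φ p * dy ψ p)) ∂vol

theorem integrable_energy (hφ : Smooth φ) (hψ : IsTest ψ) :
    Integrable (fun p => dx φ p * dx ψ p + weight p * (dy φ p * dy ψ p)) vol :=
  (hψ.dx.mul_left hφ.dx).integrable.add
    ((hψ.dy.mul_left hφ.dy).mul_left smooth_weight).integrable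

/-- The integrand differs from the energy density by an `x`- and a `y`-derivative of test functions,
which integrate to zero. Only `ψ` needs compact support. Together with `integral_opL_mul` this is
Green's formula. -/
theorem integral_mul_opL (hφ : Smooth φ) (hψ : IsTest ψ) :
    ∫ p, φ p * opL ψ p ∂vol = energy φ ψ := by
  have t1 : IsTest (fun p => φ p * dx ψ p) := hψ.dx.mul_left hφ
  have t2 : IsTest (fun p => weight p * (φ p * dy ψ p)) :=
    (hψ.dy.mul_left hφ).mul_left smooth_weight
  have hE := integrable_energy hφ hψ
  have hsub : Integrable (fun p => dx φ p * dx ψ p + weight p * (dy φ p * dy ψ p) -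
      dx (fun p => φ p * dx ψ p) p) vol := hE.sub t1.dx.integrable
  have key : ∀ p, φ p * opL ψ p = (dx φ p * dx ψ p + weight p * (dy φ p * dy ψ p)) -
      dx (fun p => φ p * dx ψ p) p - dy (fun p => weight p * (φ p * dy ψ p)) p := by
    intro p
    rw [hφ.dx_mul hψ.dx.smooth, smooth_weight.dy_mul (hφ.mul hψ.dy.smooth), dy_weight,
      hφ.dy_mul hψ.dy.smooth, opL]
    change _ * (_ - weight p * _) = _
    ring
  simp_rw [key]
  rw [integral_sub hsub t2.dy.integrable, integral_sub hE t1.dx.integrable, t1.integral_dx,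
    t2.integral_dy,
    sub_zero, sub_zero, energy]

theorem integral_opL_mul (hφ : Smooth φ) (hψ : IsTest ψ) :
    ∫ p, opL φ p * ψ p ∂vol = energy φ ψ := by
  have t1 : IsTest (fun p => dx φ p * ψ p) := hψ.mul_left hφ.dx
  have t2 : IsTest (fun p => weight p * (dy φ p * ψ p)) :=
    (hψ.mul_left hφ.dy).mul_left smooth_weight
  have hE := integrable_energy hφ hψ
  have hsub : Integrable (fun p => dx φ p * dx ψ p + weight p * (dy φ p * dy ψ p) -
      dx (fun p => dx φ p * ψ p) p) vol := hE.sub t1.dx.integrable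
  have key : ∀ p, opL φ p * ψ p = (dx φ p * dx ψ p + weight p * (dy φ p * dy ψ p)) -
      dx (fun p => dx φ p * ψ p) p - dy (fun p => weight p * (dy φ p * ψ p)) p := by
    intro p
    rw [hφ.dx.dx_mul hψ.smooth, smooth_weight.dy_mul (hφ.dy.mul hψ.smooth), dy_weight,
      hφ.dy.dy_mul hψ.smooth, opL]
    change (_ - weight p * _) * _ = _
    ring
  simp_rw [key]
  rw [integral_sub hsub t2.dy.integrable, integral_sub hE t1.dx.integrable, t1.integral_dx,
    t2.integral_dy,
    sub_zero, sub_zero, energy]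

/-- The weighted derivative `√(1 + x) ∂_y ψ`. -/
def wdy (ψ : ℝ × Circ → ℂ) (p : ℝ × Circ) : ℂ := ((Real.sqrt (1 + p.1) : ℝ) : ℂ) * dy ψ p

theorem IsTest.memLp_wdy (h : IsTest ψ) : MemLp (wdy ψ) 2 vol := by
  have hc : Continuous (wdy ψ) := by
    have := h.dy.smooth.continuous
    unfold wdy
    exact (Complex.continuous_ofReal.comp (by fun_prop)).mul this
  refine hc.memLp_of_hasCompactSupport (h.dy.compact.mono ?_)
  exact Function.support_mul_subset_right _ _

theorem energy_eq (hφ : IsTest φ) (hψ : IsTest ψ) :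
    energy φ ψ = ∫ p, dx φ p * dx ψ p ∂vol + ∫ p, wdy φ p * wdy ψ p ∂vol := by
  refine Eq.trans ?_ (integral_add (hφ.dx.memLp.integrable_mul hψ.dx.memLp)
    (hφ.memLp_wdy.integrable_mul hψ.memLp_wdy))
  refine integral_congr_ae ?_
  filter_upwards [ae_vol_nonneg] with p hp
  have : ((Real.sqrt (1 + p.1) : ℝ) : ℂ) * ((Real.sqrt (1 + p.1) : ℝ) : ℂ) = weight p := by
    rw [← Complex.ofReal_mul, Real.mul_self_sqrt (by linarith)]
    simp [weight]
  simp only [wdy, ← this]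
  ring

section Limits

variable {α : Type*} [MeasurableSpace α] {μ : Measure α}

theorem enorm_integral_mul_le {f g : α → ℂ} (hf : AEStronglyMeasurable f μ)
    (hg : AEStronglyMeasurable g μ) :
    ‖∫ x, f x * g x ∂μ‖ₑ ≤ eLpNorm f 2 μ * eLpNorm g 2 μ := by
  refine (enorm_integral_le_lintegral_enorm _).trans ?_
  rw [← eLpNorm_one_eq_lintegral_enorm]
  have h : eLpNorm (f • g) 1 μ ≤ eLpNorm f 2 μ * eLpNorm g 2 μ := eLpNorm_smul_le_mul_eLpNorm hg hf
  exact h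

theorem tendsto_integral_mul {F : ℕ → α → ℂ} {f g : α → ℂ} (hF : ∀ k, MemLp (F k) 2 μ)
    (hf : MemLp f 2 μ) (hg : MemLp g 2 μ)
    (h : Tendsto (fun k => eLpNorm (fun x => F k x - f x) 2 μ) atTop (𝓝 0)) :
    Tendsto (fun k => ∫ x, F k x * g x ∂μ) atTop (𝓝 (∫ x, f x * g x ∂μ)) := by
  have h1 : Tendsto (fun k => eLpNorm (fun x => F k x - f x) 2 μ * eLpNorm g 2 μ) atTop (𝓝 0) := by
    simpa using ENNReal.Tendsto.mul_const h (Or.inr hg.2.ne)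
  rw [tendsto_iff_edist_tendsto_0]
  refine tendsto_of_tendsto_of_tendsto_of_le_of_le tendsto_const_nhds h1 (fun _ => zero_le)
    fun k => ?_
  simp only
  have h2 := integral_sub ((hF k).integrable_mul hg) (hf.integrable_mul hg)
  simp only [Pi.mul_apply] at h2
  rw [edist_eq_enorm_sub, ← h2]
  refine le_trans (le_of_eq ?_) (enorm_integral_mul_le ((hF k).1.sub hf.1) hg.1)
  congr 2; ext x
  ring

end Limits

/-- Weak form of `DirichletL`: the pairing with the right-hand side is the energy pairing. -/
theorem DirichletL.exists_energy {u f : L2} (h : DirichletL u f) :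
    ∃ (g w : L2) (φ : ℕ → ℝ × Circ → ℂ), (∀ k, IsTest (φ k)) ∧
      Tendsto (fun k => eLpNorm (fun p => φ k p - u p) 2 vol) atTop (𝓝 0) ∧
      Tendsto (fun k => eLpNorm (fun p => dx (φ k) p - g p) 2 vol) atTop (𝓝 0) ∧
      Tendsto (fun k => eLpNorm (fun p => wdy (φ k) p - w p) 2 vol) atTop (𝓝 0) ∧
      ∀ ψ, IsTest ψ → ∫ p, f p * ψ p ∂vol =
        ∫ p, dx ψ p * g p ∂vol + ∫ p, wdy ψ p * w p ∂vol := by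
  obtain ⟨⟨g, w, φ, hφ, h1, h2, h3⟩, hw⟩ := h
  refine ⟨g, w, φ, hφ, h1, h2, h3, fun ψ hψ => ?_⟩
  rw [← hw ψ hψ]
  -- The integration by parts is done on the test approximants `φ k`, and only then is the limit
  -- taken; `u` itself is never differentiated.
  have l1 := tendsto_integral_mul (fun k => (hφ k).memLp) (Lp.memLp u) hψ.opL.memLp h1
  have l2 := tendsto_integral_mul (fun k => (hφ k).dx.memLp) (Lp.memLp g) hψ.dx.memLp h2
  have l3 := tendsto_integral_mul (fun k => (hφ k).memLp_wdy) (Lp.memLp w) hψ.memLp_wdy h3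
  have e : ∀ k, ∫ p, φ k p * opL ψ p ∂vol =
      ∫ p, dx (φ k) p * dx ψ p ∂vol + ∫ p, wdy (φ k) p * wdy ψ p ∂vol := fun k => by
    rw [integral_mul_opL (hφ k).smooth hψ, energy_eq (hφ k) hψ]
  simp_rw [e] at l1
  rw [tendsto_nhds_unique l1 (l2.add l3)]
  simp only [mul_comm]

/-- The Dirichlet realization is symmetric for the bilinear pairing. -/
theorem DirichletL.integral_mul_comm {u f v w : L2} (hu : DirichletL u f) (hv : DirichletL v w) :
    ∫ p, f p * v p ∂vol = ∫ p, w p * u p ∂vol := by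
  obtain ⟨g₁, w₁, φ, hφ, a1, a2, a3, ha⟩ := hu.exists_energy
  obtain ⟨g₂, w₂, ψ, hψ, b1, b2, b3, hb⟩ := hv.exists_energy
  -- Approximating `v` by test functions in the weak identity for `u` yields an expression symmetric
  -- in the two sets of limit derivatives. The pairing is bilinear, without conjugation.
  have key : ∀ {f v g₁ w₁ g₂ w₂ : L2} {ψ : ℕ → ℝ × Circ → ℂ}, (∀ k, IsTest (ψ k)) →
      Tendsto (fun k => eLpNorm (fun p => ψ k p - v p) 2 vol) atTop (𝓝 0) →
      Tendsto (fun k => eLpNorm (fun p => dx (ψ k) p - g₂ p) 2 vol) atTop (𝓝 0) →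
      Tendsto (fun k => eLpNorm (fun p => wdy (ψ k) p - w₂ p) 2 vol) atTop (𝓝 0) →
      (∀ ψ, IsTest ψ → ∫ p, f p * ψ p ∂vol =
        ∫ p, dx ψ p * g₁ p ∂vol + ∫ p, wdy ψ p * w₁ p ∂vol) →
      ∫ p, f p * v p ∂vol = ∫ p, g₂ p * g₁ p ∂vol + ∫ p, w₂ p * w₁ p ∂vol := by
    intro f v g₁ w₁ g₂ w₂ ψ hψ b1 b2 b3 ha
    have l1 := tendsto_integral_mul (fun k => (hψ k).memLp) (Lp.memLp v) (Lp.memLp f) b1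
    have l2 := tendsto_integral_mul (fun k => (hψ k).dx.memLp) (Lp.memLp g₂) (Lp.memLp g₁) b2
    have l3 := tendsto_integral_mul (fun k => (hψ k).memLp_wdy) (Lp.memLp w₂) (Lp.memLp w₁) b3
    have e : ∀ k, ∫ p, ψ k p * f p ∂vol =
        ∫ p, dx (ψ k) p * g₁ p ∂vol + ∫ p, wdy (ψ k) p * w₁ p ∂vol := fun k => by
      rw [← ha _ (hψ k)]; simp only [mul_comm]
    simp_rw [e] at l1
    rw [← tendsto_nhds_unique l1 (l2.add l3)]
    simp only [mul_comm]
  rw [key hψ b1 b2 b3 ha, key hφ a1 a2 a3 hb]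
  simp only [mul_comm]

end Calculus

/-! ### Separated functions, cutoffs and the form domain -/

/-- The function `w(x) e^{i n y}`. -/
def sep (w : ℝ → ℂ) (n : ℤ) (p : ℝ × Circ) : ℂ := w p.1 * fourier n p.2

theorem norm_fourier_apply (n : ℤ) (z : Circ) : ‖fourier n z‖ = 1 := by
  rw [fourier_apply]; exact Circle.norm_coe _

theorem norm_sep (w : ℝ → ℂ) (n : ℤ) (p : ℝ × Circ) : ‖sep w n p‖ = ‖w p.1‖ := by
  rw [sep, norm_mul, norm_fourier_apply, mul_one]

theorem smooth_sep {w : ℝ → ℂ} (hw : ContDiff ℝ ∞ w) (n : ℤ) : Smooth (sep w n) := by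
  unfold Smooth sep
  simp only [fourier_eq_exp]
  have h : ContDiff ℝ ∞ (fun p : ℝ × ℝ => Complex.I * n * (p.2 : ℂ)) :=
    contDiff_const.mul (Complex.ofRealCLM.contDiff.comp contDiff_snd)
  have h1 : ContDiff ℝ ∞ (fun p : ℝ × ℝ => w p.1) := hw.comp contDiff_fst
  have h2 : ContDiff ℝ ∞ (fun p : ℝ × ℝ => Complex.exp (Complex.I * n * (p.2 : ℂ))) :=
    (Complex.contDiff_exp (𝕜 := ℝ)).comp h
  exact h1.mul h2

theorem dx_sep (w : ℝ → ℂ) (n : ℤ) : dx (sep w n) = sep (deriv w) n := by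
  ext p
  unfold dx sep
  exact deriv_mul_const_field (u := w) (fourier n p.2)

theorem dy_sep (w : ℝ → ℂ) (n : ℤ) (p : ℝ × Circ) :
    dy (sep w n) p = Complex.I * n * sep w n p := by
  have h1 : HasDerivAt (fun s : ℝ => Complex.exp (Complex.I * n * (s : ℂ)))
      (Complex.exp (Complex.I * n * ((0 : ℝ) : ℂ)) * (Complex.I * n * ((1 : ℝ) : ℂ))) 0 :=
    (((hasDerivAt_id (0 : ℝ)).ofReal_comp).const_mul (Complex.I * n)).cexp
  have h2 : HasDerivAt (fun s : ℝ => sep w n (p.1, p.2 + (s : Circ)))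
      (sep w n p * (Complex.exp (Complex.I * n * ((0 : ℝ) : ℂ)) *
        (Complex.I * n * ((1 : ℝ) : ℂ)))) 0 := by
    convert! h1.const_mul (sep w n p) using 1
    ext s
    have h3 : fourier n (p.2 + (s : Circ)) = fourier n p.2 * fourier n (s : Circ) := by
      simp only [fourier_apply, smul_add, AddCircle.toCircle_add, Circle.coe_mul]
    rw [sep, sep, h3, fourier_eq_exp]
    ring
  rw [dy, h2.deriv]
  simp
  ring

theorem dy_sep' (w : ℝ → ℂ) (n : ℤ) : dy (sep w n) = sep (fun x => Complex.I * n * w x) n := by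
  ext p
  rw [dy_sep, sep, sep]; ring

theorem opL_sep (w : ℝ → ℂ) (n : ℤ) (p : ℝ × Circ) :
    opL (sep w n) p =
      (-deriv (deriv w) p.1 + (1 + (p.1 : ℂ)) * (n : ℂ) ^ 2 * w p.1) * fourier n p.2 := by
  rw [opL, dx_sep, dx_sep, dy_sep', dy_sep, sep, sep]
  linear_combination (-(1 + (p.1 : ℂ)) * (n : ℂ) ^ 2 * w p.1 * fourier n p.2) * Complex.I_sq

theorem memLp_sep {w : ℝ → ℂ} (hw : MemLp w 2 halfVol) (n : ℤ) : MemLp (sep w n) 2 vol := by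
  have h : MemLp (fun p : ℝ × Circ => w p.1) 2 vol := hw.comp_fst (volume : Measure Circ)
  refine h.mono (h.1.mul ?_) (.of_forall fun p => ?_)
  · exact ((fourier n).continuous.comp continuous_snd).aestronglyMeasurable
  · rw [norm_sep]

theorem tendsto_eLpNorm_zero_of_dominated {α : Type*} [MeasurableSpace α] {μ : Measure α}
    {F : ℕ → α → ℂ} {G : α → ℝ} (hF : ∀ k, AEStronglyMeasurable (F k) μ) (hG : MemLp G 2 μ)
    (hb : ∀ k, ∀ᵐ x ∂μ, ‖F k x‖ ≤ G x)
    (hl : ∀ᵐ x ∂μ, Tendsto (fun k => F k x) atTop (𝓝 0)) :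
    Tendsto (fun k => eLpNorm (F k) 2 μ) atTop (𝓝 0) := by
  have h2 : (2 : ENNReal).toReal = 2 := by simp
  have key : Tendsto (fun k => ∫⁻ x, ‖F k x‖ₑ ^ (2 : ℝ) ∂μ) atTop (𝓝 (∫⁻ _, 0 ∂μ)) := by
    refine tendsto_lintegral_of_dominated_convergence' (fun x => ‖G x‖ₑ ^ (2 : ℝ))
      (fun k => (hF k).enorm.pow_const _) (fun k => ?_) ?_ ?_
    · filter_upwards [hb k] with x hx
      gcongr
      rw [enorm_le_iff_norm_le]
      exact hx.trans (le_abs_self _)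
    · have := hG.eLpNorm_lt_top
      rw [eLpNorm_lt_top_iff_lintegral_rpow_enorm_lt_top (by simp) (by simp), h2] at this
      exact this.ne
    · filter_upwards [hl] with x hx
      have h1 : Tendsto (fun k => ‖F k x‖ₑ) atTop (𝓝 0) := by
        have := (continuous_enorm.tendsto (0 : ℂ)).comp hx
        rwa [enorm_zero] at this
      have := (ENNReal.continuous_rpow_const (y := 2)).tendsto 0 |>.comp h1
      rwa [ENNReal.zero_rpow_of_pos two_pos] at this
  rw [lintegral_zero] at key
  have h3 := (ENNReal.continuous_rpow_const (y := 1 / 2)).tendsto 0 |>.comp key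
  simp only [one_div, ENNReal.zero_rpow_of_pos (by norm_num : (0 : ℝ) < 2⁻¹)] at h3
  refine h3.congr fun k => ?_
  rw [eLpNorm_eq_lintegral_rpow_enorm_toReal (by simp) (by simp), h2]
  simp

section Cutoff

theorem deriv_smoothTransition_eq_zero_of_one_lt {s : ℝ} (hs : 1 < s) :
    deriv Real.smoothTransition s = 0 := by
  have h : Real.smoothTransition =ᶠ[𝓝 s] fun _ => 1 :=
    (lt_mem_nhds hs).mono fun r hr => Real.smoothTransition.one_of_one_le (le_of_lt hr)
  rw [h.deriv_eq, deriv_const]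

theorem deriv_smoothTransition_eq_zero_of_neg {s : ℝ} (hs : s < 0) :
    deriv Real.smoothTransition s = 0 := by
  have h : Real.smoothTransition =ᶠ[𝓝 s] fun _ => 0 :=
    (gt_mem_nhds hs).mono fun r hr => Real.smoothTransition.zero_of_nonpos (le_of_lt hr)
  rw [h.deriv_eq, deriv_const]

theorem contDiff_smoothTransition : ContDiff ℝ ∞ Real.smoothTransition :=
  Real.smoothTransition.contDiff

theorem exists_abs_deriv_smoothTransition_le :
    ∃ B, 0 ≤ B ∧ ∀ s, |deriv Real.smoothTransition s| ≤ B := by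
  obtain ⟨B, hB⟩ := isCompact_Icc.exists_bound_of_continuousOn (s := Icc (0 : ℝ) 1)
    (contDiff_smoothTransition.continuous_deriv (by simp)).continuousOn
  have hB0 : 0 ≤ B := (norm_nonneg _).trans (hB 0 (by simp))
  refine ⟨B, hB0, fun s => ?_⟩
  rcases lt_or_ge s 0 with h | h
  · rw [deriv_smoothTransition_eq_zero_of_neg h, abs_zero]; exact hB0
  · rcases lt_or_ge 1 s with h' | h'
    · rw [deriv_smoothTransition_eq_zero_of_one_lt h', abs_zero]; exact hB0
    · exact hB s ⟨h, h'⟩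

/-- A smooth cutoff equal to `1` on `[2 / (k + 1), k + 1]` and to `0` off
`[1 / (k + 1), 2 (k + 1)]`. -/
def cutoff (k : ℕ) (x : ℝ) : ℝ :=
  Real.smoothTransition ((k + 1) * x - 1) * Real.smoothTransition (2 - x / (k + 1))

/-- The derivative of `cutoff`. -/
def cutoffDeriv (k : ℕ) (x : ℝ) : ℝ :=
  deriv Real.smoothTransition ((k + 1) * x - 1) * (k + 1) * Real.smoothTransition (2 - x / (k + 1))
    + Real.smoothTransition ((k + 1) * x - 1) *
      (deriv Real.smoothTransition (2 - x / (k + 1)) * -(1 / (k + 1)))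

theorem hasDerivAt_cutoff (k : ℕ) (x : ℝ) : HasDerivAt (cutoff k) (cutoffDeriv k x) x := by
  have hd : ∀ s, HasDerivAt Real.smoothTransition (deriv Real.smoothTransition s) s := fun s =>
    ((contDiff_smoothTransition.differentiable (by simp)) s).hasDerivAt
  have h1 : HasDerivAt (fun x : ℝ => ((k : ℝ) + 1) * x - 1) (k + 1) x := by
    simpa using ((hasDerivAt_id x).const_mul ((k : ℝ) + 1)).sub_const 1
  have h2 : HasDerivAt (fun x : ℝ => 2 - x / ((k : ℝ) + 1)) (-(1 / (k + 1))) x :=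
    ((hasDerivAt_id x).div_const ((k : ℝ) + 1)).const_sub 2
  exact ((hd _).comp x h1).mul ((hd _).comp x h2)

theorem contDiff_cutoff (k : ℕ) : ContDiff ℝ ∞ (cutoff k) :=
  (contDiff_smoothTransition.comp (by fun_prop)).mul (contDiff_smoothTransition.comp (by fun_prop))

theorem cutoff_mem (k : ℕ) (x : ℝ) : 0 ≤ cutoff k x ∧ cutoff k x ≤ 1 :=
  ⟨mul_nonneg (Real.smoothTransition.nonneg _) (Real.smoothTransition.nonneg _),
    mul_le_one₀ (Real.smoothTransition.le_one _) (Real.smoothTransition.nonneg _)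
      (Real.smoothTransition.le_one _)⟩

theorem cutoff_eq_zero {k : ℕ} {x : ℝ} (hx : x ∉ Icc (1 / ((k : ℝ) + 1)) (2 * (k + 1))) :
    cutoff k x = 0 := by
  have hk : (0 : ℝ) < k + 1 := by positivity
  rw [cutoff]
  by_cases h : x < 1 / ((k : ℝ) + 1)
  · rw [lt_div_iff₀ hk] at h
    rw [Real.smoothTransition.zero_of_nonpos (by linarith), zero_mul]
  · have h2 : 2 * ((k : ℝ) + 1) < x := by
      by_contra h3
      exact hx ⟨not_lt.1 h, not_lt.1 h3⟩
    have h3 : 2 < x / ((k : ℝ) + 1) := by rwa [lt_div_iff₀ hk]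
    rw [Real.smoothTransition.zero_of_nonpos (x := 2 - x / ((k : ℝ) + 1)) (by linarith), mul_zero]

theorem eventually_cutoff {x : ℝ} (hx : 0 < x) :
    ∀ᶠ k : ℕ in atTop, cutoff k x = 1 ∧ cutoffDeriv k x = 0 := by
  obtain ⟨N, hN⟩ := exists_nat_gt (max x (2 / x))
  filter_upwards [eventually_ge_atTop N] with k hk
  have hkN : (N : ℝ) ≤ k := Nat.cast_le.2 hk
  have h0 : (0 : ℝ) < k + 1 := by positivity
  have h1 : x < k + 1 := by have := (le_max_left x (2 / x)).trans_lt hN; linarith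
  have h2 : 2 < (k + 1) * x := by
    have := (le_max_right x (2 / x)).trans_lt hN
    rw [div_lt_iff₀ hx] at this
    nlinarith
  have h3 : x / (k + 1) < 1 := by rwa [div_lt_one h0]
  rw [cutoff, cutoffDeriv, Real.smoothTransition.one_of_one_le (by linarith),
    Real.smoothTransition.one_of_one_le (by linarith),
    deriv_smoothTransition_eq_zero_of_one_lt (by linarith),
    deriv_smoothTransition_eq_zero_of_one_lt (by linarith)]
  simp

/-- The Dirichlet condition enters here. Near `0` the cutoff has slope of order `k + 1`, but it
varies only where `(k + 1) x ≤ 2`, and `w 0 = 0` gives `‖w x‖ ≤ C x`. At the far end its slope is at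
most `B / (k + 1)`. -/
theorem exists_norm_cutoffDeriv_mul_le {w : ℝ → ℂ} (hw : Differentiable ℝ w) (h0 : w 0 = 0)
    {a C : ℝ} (ha : 0 < a) (hC : 0 ≤ C) (hb : ∀ x, 0 ≤ x → ‖w x‖ ≤ C * Real.exp (-(a * x)))
    (hb' : ∀ x, 0 ≤ x → ‖deriv w x‖ ≤ C * Real.exp (-(a * x))) :
    ∃ D, 0 ≤ D ∧ ∀ k x, 0 ≤ x → ‖(cutoffDeriv k x : ℂ) * w x‖ ≤ D * Real.exp (-(a * x)) := by
  obtain ⟨B, hB, hBd⟩ := exists_abs_deriv_smoothTransition_le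
  have hlin : ∀ x, 0 ≤ x → ‖w x‖ ≤ C * x := by
    intro x hx
    have := (convex_Ici (0 : ℝ)).norm_image_sub_le_of_norm_deriv_le (f := w) (C := C)
      (fun y _ => hw y) (fun y hy => (hb' y hy).trans (mul_le_of_le_one_right hC
        (Real.exp_le_one_iff.2 (by have := mul_nonneg ha.le (mem_Ici.1 hy); linarith))))
      (mem_Ici.2 le_rfl) (mem_Ici.2 hx)
    simpa [h0, abs_of_nonneg hx] using this
  refine ⟨2 * B * C * Real.exp (2 * a) + B * C, by positivity, fun k x hx => ?_⟩
  have hk : (1 : ℝ) ≤ k + 1 := by have : (0 : ℝ) ≤ k := Nat.cast_nonneg k; linarith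
  rw [norm_mul, Complex.norm_real, Real.norm_eq_abs, cutoffDeriv]
  have hs0 := Real.smoothTransition.nonneg (2 - x / ((k : ℝ) + 1))
  have hs1 := Real.smoothTransition.le_one (2 - x / ((k : ℝ) + 1))
  have hr0 := Real.smoothTransition.nonneg ((k + 1) * x - 1)
  have hr1 := Real.smoothTransition.le_one ((k + 1) * x - 1)
  have e1 : |deriv Real.smoothTransition ((k + 1) * x - 1) * (k + 1) *
      Real.smoothTransition (2 - x / (k + 1))| * ‖w x‖ ≤
      2 * B * C * Real.exp (2 * a) * Real.exp (-(a * x)) := by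
    by_cases h : 1 < (k + 1) * x - 1
    · rw [deriv_smoothTransition_eq_zero_of_one_lt h]
      simp only [zero_mul, abs_zero]
      positivity
    · have h2 : (k + 1) * x ≤ 2 := by linarith [not_lt.1 h]
      have hx2 : x ≤ 2 := by nlinarith
      -- On `x ≤ 2` a constant is turned into an exponential bound at the cost of `e^{2a}`.
      have hexp : 1 ≤ Real.exp (2 * a) * Real.exp (-(a * x)) := by
        rw [← Real.exp_add]
        exact Real.one_le_exp (by nlinarith)
      rw [abs_mul, abs_mul, abs_of_nonneg hs0, abs_of_nonneg (by linarith : (0 : ℝ) ≤ k + 1)]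
      calc _ ≤ B * (k + 1) * 1 * (C * x) := by
            have := hBd ((k + 1) * x - 1)
            have := hlin x hx
            gcongr
        _ = B * C * ((k + 1) * x) := by ring
        _ ≤ B * C * 2 := by gcongr
        _ ≤ B * C * 2 * (Real.exp (2 * a) * Real.exp (-(a * x))) :=
            le_mul_of_one_le_right (by positivity) hexp
        _ = _ := by ring
  have e2 : |Real.smoothTransition ((k + 1) * x - 1) *
      (deriv Real.smoothTransition (2 - x / (k + 1)) * -(1 / (k + 1)))| * ‖w x‖ ≤
      B * C * Real.exp (-(a * x)) := by
    have h3 : 1 / ((k : ℝ) + 1) ≤ 1 := by rw [div_le_one (by linarith)]; exact hk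
    have h4 : 0 ≤ 1 / ((k : ℝ) + 1) := by positivity
    rw [abs_mul, abs_mul, abs_neg, abs_of_nonneg hr0, abs_of_nonneg h4]
    calc _ ≤ 1 * (B * 1) * (C * Real.exp (-(a * x))) := by
          have := hBd (2 - x / (k + 1))
          have := hb x hx
          gcongr
      _ = _ := by ring
  calc _ ≤ (_ + _) * ‖w x‖ := mul_le_mul_of_nonneg_right (abs_add_le _ _) (norm_nonneg _)
    _ ≤ _ := (add_mul _ _ _).trans_le ((add_le_add e1 e2).trans_eq (add_mul _ _ _).symm)

end Cutoff

theorem continuous_sep {w : ℝ → ℂ} (hw : Continuous w) (n : ℤ) : Continuous (sep w n) :=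
  (hw.comp continuous_fst).mul ((fourier n).continuous.comp continuous_snd)

theorem ae_vol_pos : ∀ᵐ p ∂vol, 0 < p.1 := by
  refine Measure.quasiMeasurePreserving_fst.ae (p := fun x : ℝ => 0 < x) (μa := vol)
    (μb := halfVol) ?_
  exact ae_halfVol_of_ae_pos (.of_forall fun _ h => h)

theorem isTest_sep_cutoff {w : ℝ → ℂ} (hw : ContDiff ℝ ∞ w) (n : ℤ) (k : ℕ) :
    IsTest (sep (fun x => (cutoff k x : ℂ) * w x) n) := by
  have hs : Function.support (sep (fun x => (cutoff k x : ℂ) * w x) n) ⊆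
      Icc (1 / ((k : ℝ) + 1)) (2 * (k + 1)) ×ˢ univ := by
    intro p hp
    refine ⟨?_, mem_univ _⟩
    by_contra h
    exact hp (by rw [sep, cutoff_eq_zero h]; simp)
  have hcl : IsClosed (Icc (1 / ((k : ℝ) + 1)) (2 * (k + 1)) ×ˢ (univ : Set Circ)) :=
    isClosed_Icc.prod isClosed_univ
  refine ⟨smooth_sep ((Complex.ofRealCLM.contDiff.comp (contDiff_cutoff k)).mul hw) n, ?_, ?_⟩
  · exact HasCompactSupport.of_support_subset_isCompact (isCompact_Icc.prod isCompact_univ) hs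
  · refine (closure_minimal hs hcl).trans (prod_mono_left fun x hx => ?_)
    exact lt_of_lt_of_le (by positivity) hx.1

/-- Half of the exponential rate is spent on the weight `√(1 + x)`. -/
theorem sqrt_mul_exp_le {a : ℝ} (ha : 0 < a) {x : ℝ} (hx : 0 ≤ x) :
    √(1 + x) * Real.exp (-(a * x)) ≤ (1 + 2 / a) * Real.exp (-(a / 2 * x)) := by
  have h1 : √(1 + x) ≤ 1 + x := Real.sqrt_le_iff.2 ⟨by linarith, by nlinarith⟩
  have h2 : a / 2 * x ≤ Real.exp (a / 2 * x) := by linarith [Real.add_one_le_exp (a / 2 * x)]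
  have h3 : x ≤ 2 / a * Real.exp (a / 2 * x) := by
    calc x = 2 / a * (a / 2 * x) := by field_simp
      _ ≤ _ := by gcongr
  have h4 : 1 ≤ Real.exp (a / 2 * x) := Real.one_le_exp (by positivity)
  calc _ ≤ ((1 + 2 / a) * Real.exp (a / 2 * x)) * Real.exp (-(a * x)) := by
        gcongr
        linarith
    _ = _ := by rw [mul_assoc, ← Real.exp_add]; ring_nf

/-- Smooth exponentially decaying separated functions that vanish at `x = 0` lie in the Dirichlet
form domain. -/
theorem inFormDomain_sep {w : ℝ → ℂ} (hw : ContDiff ℝ ∞ w) (h0 : w 0 = 0) {a C : ℝ} (ha : 0 < a)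
    (hC : 0 ≤ C) (hb : ∀ x, 0 ≤ x → ‖w x‖ ≤ C * Real.exp (-(a * x)))
    (hb' : ∀ x, 0 ≤ x → ‖deriv w x‖ ≤ C * Real.exp (-(a * x))) (n : ℤ) {u : L2}
    (hu : u =ᵐ[vol] sep w n) : InFormDomain u := by
  obtain ⟨D, hD, hDb⟩ := exists_norm_cutoffDeriv_mul_le (hw.differentiable (by simp)) h0 ha hC hb
    hb'
  have hwc := hw.continuous
  have hwc' : Continuous (deriv w) := hw.continuous_deriv (by simp)
  have hcc : ∀ k, Continuous fun x : ℝ => (cutoff k x : ℂ) := fun k =>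
    Complex.continuous_ofReal.comp (contDiff_cutoff k).continuous
  have hcd : ∀ k, Continuous fun x : ℝ => (cutoffDeriv k x : ℂ) := fun k => by
    refine Complex.continuous_ofReal.comp ?_
    rw [show cutoffDeriv k = deriv (cutoff k) from
      funext fun x => (hasDerivAt_cutoff k x).deriv.symm]
    exact (contDiff_cutoff k).continuous_deriv (by simp)
  have hdc : ∀ k, deriv (fun x => (cutoff k x : ℂ) * w x) =
      fun x => (cutoffDeriv k x : ℂ) * w x + (cutoff k x : ℂ) * deriv w x := fun k => by
    ext x
    exact ((hasDerivAt_cutoff k x).ofReal_comp.mul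
      ((hw.differentiable (by simp)) x).hasDerivAt).deriv
  have hc1 : ∀ (k : ℕ) (x : ℝ), ‖(cutoff k x : ℂ) - 1‖ ≤ 1 := fun k x => by
    have h := cutoff_mem k x
    rw [← Complex.ofReal_one, ← Complex.ofReal_sub, Complex.norm_real, Real.norm_eq_abs, abs_le]
    constructor <;> linarith
  have hae : ∀ {f : ℝ → ℂ} {G : ℝ → ℝ}, Continuous f → MemLp G 2 halfVol →
      (∀ x, 0 ≤ x → ‖f x‖ ≤ G x) → MemLp f 2 halfVol := fun hf hG h =>
    hG.mono hf.aestronglyMeasurable (by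
      filter_upwards [ae_halfVol_nonneg] with x hx
      exact (h x hx).trans (le_abs_self _))
  have hg : MemLp (sep (deriv w) n) 2 vol := memLp_sep (hae hwc' (memLp_exp_neg ha C) hb') n
  have hsq : ∀ x, 0 ≤ x → ‖((√(1 + x) : ℝ) : ℂ) * (Complex.I * n * w x)‖ ≤
      ‖(n : ℂ)‖ * C * (1 + 2 / a) * Real.exp (-(a / 2 * x)) := fun x hx => by
    have h1 := sqrt_mul_exp_le ha hx
    have h2 := hb x hx
    rw [norm_mul, norm_mul, norm_mul, Complex.norm_I, one_mul, Complex.norm_real,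
      Real.norm_of_nonneg (Real.sqrt_nonneg _)]
    calc _ ≤ √(1 + x) * (‖(n : ℂ)‖ * (C * Real.exp (-(a * x)))) := by gcongr
      _ = ‖(n : ℂ)‖ * C * (√(1 + x) * Real.exp (-(a * x))) := by ring
      _ ≤ ‖(n : ℂ)‖ * C * ((1 + 2 / a) * Real.exp (-(a / 2 * x))) := by gcongr
      _ = _ := by ring
  have hsc : Continuous fun x : ℝ => ((√(1 + x) : ℝ) : ℂ) * (Complex.I * n * w x) :=
    (Complex.continuous_ofReal.comp (by fun_prop)).mul (continuous_const.mul hwc)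
  have ha2 : 0 < a / 2 := by positivity
  have hh : MemLp (sep (fun x => ((√(1 + x) : ℝ) : ℂ) * (Complex.I * n * w x)) n) 2 vol :=
    memLp_sep (hae hsc (memLp_exp_neg ha2 _) hsq) n
  -- The three limits in the form norm share this pattern: a square-integrable bound depending on
  -- `x` only, and pointwise vanishing from some `k` on, because each `x > 0` is eventually in the
  -- region where the cutoff is `1`.
  have lim : ∀ {f : ℕ → ℝ → ℂ} {G : ℝ → ℝ} {F : ℕ → ℝ × Circ → ℂ}, (∀ k, Continuous (f k)) →
      MemLp G 2 halfVol → (∀ k x, 0 ≤ x → ‖f k x‖ ≤ G x) →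
      (∀ x, 0 < x → ∀ᶠ k in atTop, f k x = 0) → (∀ k, F k =ᵐ[vol] sep (f k) n) →
      Tendsto (fun k => eLpNorm (F k) 2 vol) atTop (𝓝 0) := by
    intro f G F hf hG hb hev hF
    simp_rw [eLpNorm_congr_ae (hF _)]
    refine tendsto_eLpNorm_zero_of_dominated
      (fun k => (continuous_sep (hf k) n).aestronglyMeasurable)
      (hG.comp_fst (volume : Measure Circ)) (fun k => ?_) ?_
    · filter_upwards [ae_vol_nonneg] with p hp
      rw [norm_sep]
      exact hb k p.1 hp
    · filter_upwards [ae_vol_pos] with p hp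
      refine tendsto_const_nhds.congr' ?_
      filter_upwards [hev p.1 hp] with k hk
      rw [sep, hk, zero_mul]
  refine ⟨hg.toLp _, hh.toLp _, fun k => sep (fun x => (cutoff k x : ℂ) * w x) n,
    isTest_sep_cutoff hw n, ?_, ?_, ?_⟩
  · refine lim (f := fun k x => ((cutoff k x : ℂ) - 1) * w x)
      (fun k => ((hcc k).sub continuous_const).mul hwc) (memLp_exp_neg ha C) (fun k x hx => ?_)
      (fun x hx => ?_) (fun k => ?_)
    · rw [norm_mul]
      exact (mul_le_of_le_one_left (norm_nonneg _) (hc1 k x)).trans (hb x hx)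
    · filter_upwards [eventually_cutoff hx] with k hk
      rw [hk.1]; simp
    · filter_upwards [hu] with p hp
      rw [hp]; simp only [sep]; ring
  · refine lim (f := fun k x => (cutoffDeriv k x : ℂ) * w x + ((cutoff k x : ℂ) - 1) * deriv w x)
      (fun k => ((hcd k).mul hwc).add (((hcc k).sub continuous_const).mul hwc'))
      (memLp_exp_neg ha (D + C)) (fun k x hx => ?_) (fun x hx => ?_) (fun k => ?_)
    · rw [add_mul]
      refine (norm_add_le _ _).trans (add_le_add (hDb k x hx) ?_)
      rw [norm_mul]
      exact (mul_le_of_le_one_left (norm_nonneg _) (hc1 k x)).trans (hb' x hx)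
    · filter_upwards [eventually_cutoff hx] with k hk
      rw [hk.1, hk.2]; simp
    · filter_upwards [hg.coeFn_toLp] with p hp
      rw [hp, dx_sep, hdc]; simp only [sep]; ring
  · refine lim (f := fun k x => ((cutoff k x : ℂ) - 1) *
        (((√(1 + x) : ℝ) : ℂ) * (Complex.I * n * w x)))
      (fun k => ((hcc k).sub continuous_const).mul hsc)
      (memLp_exp_neg ha2 (‖(n : ℂ)‖ * C * (1 + 2 / a))) (fun k x hx => ?_)
      (fun x hx => ?_) (fun k => ?_)
    · rw [norm_mul]
      exact (mul_le_of_le_one_left (norm_nonneg _) (hc1 k x)).trans (hsq x hx)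
    · filter_upwards [eventually_cutoff hx] with k hk
      rw [hk.1]; simp
    · filter_upwards [hh.coeFn_toLp] with p hp
      rw [hp, dy_sep]; simp only [sep]; ring

/-- A smooth function in the form domain on which `opL` acts as a scalar. -/
theorem dirichletL_of_smooth {φ : ℝ × Circ → ℂ} (hφ : Smooth φ) {μ : ℂ}
    (hL : ∀ p : ℝ × Circ, opL φ p = μ * φ p) {u : L2} (hu : u =ᵐ[vol] φ)
    (hd : InFormDomain u) : DirichletL u (μ • u) := by
  refine ⟨hd, fun ψ hψ => ?_⟩
  have h1 : ∫ p, u p * opL ψ p ∂vol = ∫ p, φ p * opL ψ p ∂vol := by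
    refine integral_congr_ae ?_
    filter_upwards [hu] with p hp
    rw [hp]
  have h2 : ∫ p, (μ • u : L2) p * ψ p ∂vol = ∫ p, opL φ p * ψ p ∂vol := by
    refine integral_congr_ae ?_
    filter_upwards [hu, Lp.coeFn_smul μ u] with p hp hp'
    rw [hp', Pi.smul_apply, hp, hL, smul_eq_mul]
  rw [h1, h2, integral_mul_opL hφ hψ, integral_opL_mul hφ hψ]

/-! ### The functions `φ_{m,n}` as Dirichlet eigenfunctions -/

/-- The scale `|n|^{2/3}`. -/
def airyScale (n : ℤ) : ℝ := |(n : ℝ)| ^ (2 / 3 : ℝ)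

theorem airyScale_pos {n : ℤ} (hn : n ≠ 0) : 0 < airyScale n :=
  Real.rpow_pos_of_pos (abs_pos.2 (Int.cast_ne_zero.2 hn)) _

theorem airyScale_cube (n : ℤ) : airyScale n ^ 3 = (n : ℝ) ^ 2 := by
  rw [airyScale, ← Real.rpow_natCast, ← Real.rpow_mul (abs_nonneg _)]
  norm_num

theorem airyScale_sq (n : ℤ) : airyScale n ^ 2 = |(n : ℝ)| ^ (4 / 3 : ℝ) := by
  rw [airyScale, ← Real.rpow_natCast, ← Real.rpow_mul (abs_nonneg _)]
  norm_num

/-- The `x`-profile of `eigenfun τ n`. -/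
def profile (τ : ℝ) (n : ℤ) (x : ℝ) : ℂ := airyAi (airyScale n * x - τ)

theorem eigenfun_eq_sep (τ : ℝ) (n : ℤ) : eigenfun τ n = sep (profile τ n) n := rfl

theorem profile_eq (τ : ℝ) (n : ℤ) :
    profile τ n = fun x => ((airyRe (airyScale n * x - τ) : ℝ) : ℂ) :=
  funext fun _ => airyAi_eq_ofReal _

theorem contDiff_profile (τ : ℝ) (n : ℤ) : ContDiff ℝ ∞ (profile τ n) := by
  rw [profile_eq]
  exact Complex.ofRealCLM.contDiff.comp (contDiff_airyRe.comp (by fun_prop))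

theorem hasDerivAt_scale (a τ x : ℝ) : HasDerivAt (fun x => a * x - τ) a x := by
  simpa using ((hasDerivAt_id x).const_mul a).sub_const τ

theorem deriv_profile (τ : ℝ) (n : ℤ) : deriv (profile τ n) =
    fun x => ((airyDeriv (airyScale n * x - τ) * airyScale n : ℝ) : ℂ) := by
  ext x
  rw [profile_eq]
  exact ((hasDerivAt_airyRe _).comp x (hasDerivAt_scale (airyScale n) τ x)).ofReal_comp.deriv

theorem deriv_deriv_profile (τ : ℝ) (n : ℤ) (x : ℝ) : deriv (deriv (profile τ n)) x =
    (airyScale n : ℂ) ^ 2 * (airyScale n * x - τ) * profile τ n x := by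
  rw [deriv_profile, profile_eq]
  have h := (((hasDerivAt_airyDeriv _).comp x (hasDerivAt_scale (airyScale n) τ x)).mul_const
    (airyScale n)).ofReal_comp.deriv
  refine h.trans ?_
  push_cast; ring

/-- With `a = airyScale n`, Airy's equation gives `w'' = a² (a x - τ) w`. Here `a³ = n²` cancels the
potential `n² x`, and `a² = |n|^{4/3}` leaves the eigenvalue. -/
theorem opL_eigenfun (τ : ℝ) (n : ℤ) (p : ℝ × Circ) :
    opL (eigenfun τ n) p = (eigenval τ n : ℂ) * eigenfun τ n p := by
  have h3 : (airyScale n : ℂ) ^ 3 = (n : ℂ) ^ 2 := by exact_mod_cast airyScale_cube n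
  rw [eigenfun_eq_sep, opL_sep, deriv_deriv_profile, eigenval, ← airyScale_sq, sep]
  push_cast
  linear_combination (-(p.1 : ℂ) * profile τ n p.1 * fourier n p.2) * h3

theorem smooth_eigenfun (τ : ℝ) (n : ℤ) : Smooth (eigenfun τ n) :=
  smooth_sep (contDiff_profile τ n) n

theorem memLp_profile (τ : ℝ) {n : ℤ} (hn : n ≠ 0) : MemLp (profile τ n) 2 halfVol :=
  memLp_scaled_airyAi (airyScale_pos hn) τ

theorem memLp_eigenfun (τ : ℝ) {n : ℤ} (hn : n ≠ 0) : MemLp (eigenfun τ n) 2 vol :=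
  memLp_sep (memLp_profile τ hn) n

theorem profile_zero {τ : ℝ} (h : airyRe (-τ) = 0) (n : ℤ) : profile τ n 0 = 0 := by
  rw [profile_eq]; simp [h]

theorem dirichletL_eigenfun {τ : ℝ} (h : airyRe (-τ) = 0) {n : ℤ} (hn : n ≠ 0) {u : L2}
    (hu : u =ᵐ[vol] eigenfun τ n) : DirichletL u ((eigenval τ n : ℂ) • u) := by
  refine dirichletL_of_smooth (smooth_eigenfun τ n) (opL_eigenfun τ n) hu ?_
  have ha := airyScale_pos hn
  obtain ⟨C, hC, h1⟩ := exists_abs_scaled_airyRe_le (airyScale n) τ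
  obtain ⟨C', hC', h2⟩ := exists_abs_scaled_airyDeriv_le (airyScale n) τ
  refine inFormDomain_sep (C := C + C' * airyScale n) (contDiff_profile τ n) (profile_zero h n) ha
    (by positivity) (fun x _ => ?_) (fun x _ => ?_) n hu
  · rw [profile_eq, Complex.norm_real, Real.norm_eq_abs]
    refine (h1 x).trans (mul_le_mul_of_nonneg_right ?_ (Real.exp_pos _).le)
    have := mul_nonneg hC' ha.le
    linarith
  · rw [deriv_profile, Complex.norm_real, Real.norm_eq_abs, abs_mul, abs_of_pos ha]
    calc _ ≤ C' * Real.exp (-(airyScale n * x)) * airyScale n := by gcongr; exact h2 x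
      _ = C' * airyScale n * Real.exp (-(airyScale n * x)) := by ring
      _ ≤ _ := mul_le_mul_of_nonneg_right (by linarith) (Real.exp_pos _).le

/-! ### The eigenspaces are linear subspaces -/

section Linear

variable {φ ψ : ℝ × Circ → ℂ}

/-- The combination `φ + c ψ` treats sums and scalar multiples at once; with the zero vector it
yields every submodule axiom of `eigenspace`. -/
theorem Smooth.add_mul_const (hφ : Smooth φ) (c : ℂ) (hψ : Smooth ψ) :
    Smooth (fun p => φ p + c * ψ p) :=
  ContDiff.add hφ (ContDiff.mul contDiff_const hψ)

theorem Smooth.dx_add_mul_const (hφ : Smooth φ) (c : ℂ) (hψ : Smooth ψ) (p : ℝ × Circ) :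
    Friedlander.dx (fun p => φ p + c * ψ p) p =
      Friedlander.dx φ p + c * Friedlander.dx ψ p :=
  ((hφ.hasDerivAt_fst p.1 p.2).add ((hψ.hasDerivAt_fst p.1 p.2).const_mul c)).deriv

theorem Smooth.dy_add_mul_const (hφ : Smooth φ) (c : ℂ) (hψ : Smooth ψ) (p : ℝ × Circ) :
    Friedlander.dy (fun p => φ p + c * ψ p) p =
      Friedlander.dy φ p + c * Friedlander.dy ψ p := by
  obtain ⟨x, z⟩ := p
  obtain ⟨y, rfl⟩ := QuotientAddGroup.mk_surjective z
  exact ((hφ.add_mul_const c hψ).hasDerivAt_snd x y).unique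
    ((hφ.hasDerivAt_snd x y).add ((hψ.hasDerivAt_snd x y).const_mul c))

theorem IsTest.add_mul_const (hφ : IsTest φ) (c : ℂ) (hψ : IsTest ψ) :
    IsTest (fun p => φ p + c * ψ p) where
  smooth := hφ.smooth.add_mul_const c hψ.smooth
  compact := hφ.compact.add (hψ.compact.mul_left (f := fun _ => c))
  interior := (tsupport_add φ fun p => c * ψ p).trans (union_subset hφ.interior
    ((closure_mono (Function.support_mul_subset_right (fun _ => c) ψ)).trans hψ.interior))

theorem coeFn_add_smul (u v : L2) (c : ℂ) : (u + c • v : L2) =ᵐ[vol] fun p => u p + c * v p := by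
  filter_upwards [Lp.coeFn_add u (c • v), Lp.coeFn_smul c v] with p h1 h2
  rw [h1, Pi.add_apply, h2, Pi.smul_apply, smul_eq_mul]

theorem tendsto_eLpNorm_add_smul {F G : ℕ → ℝ × Circ → ℂ} {f g : L2} (c : ℂ)
    (hF : ∀ k, AEStronglyMeasurable (F k) vol) (hG : ∀ k, AEStronglyMeasurable (G k) vol)
    (hf : Tendsto (fun k => eLpNorm (fun p => F k p - f p) 2 vol) atTop (𝓝 0))
    (hg : Tendsto (fun k => eLpNorm (fun p => G k p - g p) 2 vol) atTop (𝓝 0)) :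
    Tendsto (fun k => eLpNorm (fun p => F k p + c * G k p - (f + c • g : L2) p) 2 vol) atTop
      (𝓝 0) := by
  have hlim := hf.add (ENNReal.Tendsto.const_mul (a := ‖c‖ₑ) hg (.inr enorm_ne_top))
  rw [mul_zero, add_zero] at hlim
  refine tendsto_of_tendsto_of_tendsto_of_le_of_le tendsto_const_nhds hlim
    (fun _ => zero_le) fun k => ?_
  have h1 : (fun p => F k p + c * G k p - (f + c • g : L2) p) =ᵐ[vol]
      (fun p => F k p - f p) + c • (fun p => G k p - g p) := by
    filter_upwards [coeFn_add_smul f g c] with p hp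
    simp only [hp, Pi.add_apply, Pi.smul_apply, smul_eq_mul]
    ring
  change eLpNorm _ 2 vol ≤ eLpNorm _ 2 vol + ‖c‖ₑ * eLpNorm _ 2 vol
  rw [eLpNorm_congr_ae h1, ← eLpNorm_const_smul]
  exact eLpNorm_add_le ((hF k).sub (Lp.aestronglyMeasurable f))
    (((hG k).sub (Lp.aestronglyMeasurable g)).const_smul c) (by norm_num)

theorem InFormDomain.add_smul {u v : L2} (hu : InFormDomain u) (c : ℂ) (hv : InFormDomain v) :
    InFormDomain (u + c • v) := by
  obtain ⟨g₁, h₁, φ, hφ, a1, a2, a3⟩ := hu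
  obtain ⟨g₂, h₂, ψ, hψ, b1, b2, b3⟩ := hv
  have hs : Continuous fun p : ℝ × Circ => ((√(1 + p.1) : ℝ) : ℂ) :=
    Complex.continuous_ofReal.comp (by fun_prop)
  refine ⟨g₁ + c • g₂, h₁ + c • h₂, fun k p => φ k p + c * ψ k p,
    fun k => (hφ k).add_mul_const c (hψ k), ?_, ?_, ?_⟩
  · exact tendsto_eLpNorm_add_smul c (fun k => (hφ k).smooth.continuous.aestronglyMeasurable)
      (fun k => (hψ k).smooth.continuous.aestronglyMeasurable) a1 b1
  · simp_rw [(hφ _).smooth.dx_add_mul_const c (hψ _).smooth]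
    exact tendsto_eLpNorm_add_smul c (fun k => (hφ k).dx.smooth.continuous.aestronglyMeasurable)
      (fun k => (hψ k).dx.smooth.continuous.aestronglyMeasurable) a2 b2
  · simp_rw [(hφ _).smooth.dy_add_mul_const c (hψ _).smooth, mul_add, mul_left_comm _ c]
    exact tendsto_eLpNorm_add_smul c
      (fun k => (hs.mul (hφ k).dy.smooth.continuous).aestronglyMeasurable)
      (fun k => (hs.mul (hψ k).dy.smooth.continuous).aestronglyMeasurable) a3 b3

theorem eLpNorm_sub_coeFn_zero {F : ℕ → ℝ × Circ → ℂ} (hF : ∀ k p, F k p = 0) :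
    Tendsto (fun k => eLpNorm (fun p => F k p - (0 : L2) p) 2 vol) atTop (𝓝 0) := by
  refine tendsto_const_nhds.congr fun k => ?_
  rw [eLpNorm_congr_ae (g := 0), eLpNorm_zero]
  filter_upwards [Lp.coeFn_zero ℂ 2 vol] with p hp
  rw [hF, hp]; simp

theorem inFormDomain_zero : InFormDomain 0 := by
  refine ⟨0, 0, fun _ _ => 0, fun _ => ⟨contDiff_const, HasCompactSupport.zero, by simp⟩,
    eLpNorm_sub_coeFn_zero fun _ _ => rfl, eLpNorm_sub_coeFn_zero fun k p => ?_,
    eLpNorm_sub_coeFn_zero fun k p => ?_⟩ <;> simp [dx, dy]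

theorem DirichletL.add_smul {u f v w : L2} (hu : DirichletL u f) (c : ℂ) (hv : DirichletL v w) :
    DirichletL (u + c • v) (f + c • w) := by
  refine ⟨hu.1.add_smul c hv.1, fun ψ hψ => ?_⟩
  have key : ∀ (a b : L2) {θ : ℝ × Circ → ℂ}, IsTest θ →
      ∫ p, (a + c • b : L2) p * θ p ∂vol = ∫ p, a p * θ p ∂vol + c * ∫ p, b p * θ p ∂vol := by
    intro a b θ hθ
    have hi : ∀ a : L2, Integrable (fun p => a p * θ p) vol := fun a =>
      (Lp.memLp a).integrable_mul hθ.memLp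
    rw [← integral_const_mul, ← integral_add (hi a) ((hi b).const_mul c)]
    refine integral_congr_ae ?_
    filter_upwards [coeFn_add_smul a b c] with p hp
    rw [hp]; ring
  rw [key u v hψ.opL, key f w hψ, hu.2 ψ hψ, hv.2 ψ hψ]

theorem dirichletL_zero : DirichletL 0 0 := by
  refine ⟨inFormDomain_zero, fun ψ hψ => ?_⟩
  have key : ∀ θ : ℝ × Circ → ℂ, ∫ p, (0 : L2) p * θ p ∂vol = 0 := fun θ => by
    refine integral_eq_zero_of_ae ?_
    filter_upwards [Lp.coeFn_zero ℂ 2 vol] with p hp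
    rw [hp]; simp
  rw [key, key]

theorem ae_memLp_section (u : L2) : ∀ᵐ x ∂halfVol, MemLp (fun y : Circ => u (x, y)) 2 volume :=
  ae_memLp_two_section (μ := halfVol) (Lp.memLp u)

theorem ae_ae_section {P : ℝ × Circ → Prop} (h : ∀ᵐ p ∂vol, P p) :
    ∀ᵐ x ∂halfVol, ∀ᵐ y : Circ, P (x, y) :=
  Measure.ae_ae_of_ae_prod h

theorem ZeroMean.add_smul {u v : L2} (hu : ZeroMean u) (c : ℂ) (hv : ZeroMean v) :
    ZeroMean (u + c • v) := by
  change ∀ᵐ x ∂halfVol, _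
  filter_upwards [hu, hv, ae_memLp_section u, ae_memLp_section v,
    ae_ae_section (coeFn_add_smul u v c)] with x h1 h2 h3 h4 h5
  rw [integral_congr_ae h5, integral_add (h3.integrable one_le_two)
    ((h4.integrable one_le_two).const_mul c), integral_const_mul, h1, h2]
  simp

theorem zeroMean_zero : ZeroMean 0 := by
  change ∀ᵐ x ∂halfVol, _
  filter_upwards [ae_ae_section (Lp.coeFn_zero ℂ 2 vol)] with x hx
  rw [integral_congr_ae hx]; simp

/-- The eigenspace of the Dirichlet realization on functions of zero mean. -/
def eigenspace (μ : ℂ) : Submodule ℂ L2 where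
  carrier := {u | ZeroMean u ∧ DirichletL u (μ • u)}
  zero_mem' := ⟨zeroMean_zero, by rw [smul_zero]; exact dirichletL_zero⟩
  add_mem' {u v} hu hv := by
    have h1 := hu.1.add_smul 1 hv.1
    have h2 := hu.2.add_smul 1 hv.2
    rw [one_smul] at h1
    rw [one_smul, one_smul, ← smul_add] at h2
    exact ⟨h1, h2⟩
  smul_mem' c v hv := by
    have h1 := zeroMean_zero.add_smul c hv.1
    have h2 := dirichletL_zero.add_smul c hv.2
    rw [zero_add] at h1
    rw [zero_add, zero_add, smul_comm] at h2
    exact ⟨h1, h2⟩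

theorem isDirichletEigenfunction_iff {μ : ℂ} {u : L2} :
    IsDirichletEigenfunction μ u ↔ u ≠ 0 ∧ u ∈ eigenspace μ :=
  ⟨fun h => ⟨h.1, h.2, h.3⟩, fun h => ⟨h.1, h.2.1, h.2.2⟩⟩

end Linear

/-! ### Fourier series in `y`, orthogonality and completeness -/

section Fourier

open ComplexConjugate

theorem integral_fourier_eq_zero {n : ℤ} (hn : n ≠ 0) : ∫ y : Circ, fourier n y = 0 :=
  integral_eq_zero_of_add_right_eq_neg (fourier_add_half_inv_index hn Real.two_pi_pos)

theorem integral_circ_eq (f : Circ → ℂ) :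
    ∫ y, f y ∂AddCircle.haarAddCircle = (2 * Real.pi)⁻¹ • ∫ y : Circ, f y :=
  AddCircle.integral_haarAddCircle

/-- Two functions on the circle, one of mean zero and one with no other Fourier coefficient, are
orthogonal. -/
theorem integral_mul_conj_eq_zero {g h : Circ → ℂ} (hg : MemLp g 2 volume)
    (hh : MemLp h 2 volume) (hg0 : ∫ y, g y = 0)
    (hh0 : ∀ n : ℤ, n ≠ 0 → ∫ y, h y * fourier (-n) y = 0) : ∫ y, g y * conj (h y) = 0 := by
  have hg' := hg.haarAddCircle
  have hh' := hh.haarAddCircle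
  have hrepr : ∀ (f : Circ → ℂ) (hf : MemLp f 2 AddCircle.haarAddCircle) (n : ℤ),
      inner ℂ (fourierBasis n) (hf.toLp f) = (2 * Real.pi)⁻¹ • ∫ y : Circ, f y * fourier (-n) y := by
    intro f hf n
    rw [← HilbertBasis.repr_apply_apply, fourierBasis_repr, fourierCoeff_congr_ae hf.coeFn_toLp,
      fourierCoeff, integral_circ_eq]
    simp_rw [smul_eq_mul, mul_comm]
  -- In Parseval's identity every term vanishes: `n = 0` because of `g`, all others because of `h`.
  have hsum := fourierBasis.hasSum_inner_mul_inner (hh'.toLp h) (hg'.toLp g)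
  have hz : (fun i => inner ℂ (hh'.toLp h) (fourierBasis i) *
      inner ℂ (fourierBasis i) (hg'.toLp g)) = fun _ => 0 := by
    ext n
    by_cases hn : n = 0
    · rw [hrepr g hg' n, hn]
      simp [hg0]
    · rw [← inner_conj_symm, hrepr h hh' n, hh0 n hn]
      simp
  rw [hz] at hsum
  have h0 := hsum.unique hasSum_zero
  rw [L2.inner_def] at h0
  have h1 : ∫ y, g y * conj (h y) ∂AddCircle.haarAddCircle = 0 := by
    rw [← h0]
    refine integral_congr_ae ?_
    filter_upwards [hg'.coeFn_toLp, hh'.coeFn_toLp] with y h1 h2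
    rw [h1, h2, RCLike.inner_apply]
  rw [integral_circ_eq, smul_eq_zero] at h1
  exact h1.resolve_left (inv_ne_zero Real.two_pi_pos.ne')

/-- The `n`-th Fourier coefficient in `y`, up to a factor. -/
def fourierSection (w : L2) (n : ℤ) (x : ℝ) : ℂ := ∫ y : Circ, w (x, y) * fourier (-n) y

theorem memLp_fourierSection (w : L2) (n : ℤ) : MemLp (fourierSection w n) 2 halfVol := by
  have hm : AEStronglyMeasurable (fun p : ℝ × Circ => w p * fourier (-n) p.2) vol :=
    (Lp.aestronglyMeasurable w).mul
      ((fourier (-n)).continuous.comp continuous_snd).aestronglyMeasurable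
  have hms : AEStronglyMeasurable (fourierSection w n) halfVol :=
    AEStronglyMeasurable.integral_prod_right' (μ := halfVol) (ν := (volume : Measure Circ)) hm
  have hi : Integrable (fun x => ∫ y : Circ, ‖w (x, y)‖ ^ 2) halfVol :=
    Integrable.integral_prod_left (μ := halfVol) (ν := (volume : Measure Circ))
      ((memLp_two_iff_integrable_sq_norm (Lp.aestronglyMeasurable w)).1 (Lp.memLp w))
  rw [memLp_two_iff_integrable_sq_norm hms]
  refine (hi.mul_const (∫ _ : Circ, (1 : ℝ) ^ 2)).mono' (hms.norm.pow 2) ?_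
  filter_upwards [ae_memLp_section w] with x hx
  rw [Real.norm_of_nonneg (by positivity)]
  -- Cauchy–Schwarz against the constant `1`, the circle having finite measure.
  have h1 := sq_integral_mul_le hx.norm (memLp_const (1 : ℝ) (μ := (volume : Measure Circ)))
  refine le_trans ?_ h1
  gcongr
  refine (norm_integral_le_integral_norm _).trans_eq ?_
  simp_rw [norm_mul, norm_fourier_apply]

end Fourier

open ComplexConjugate

/-- The class of `eigenfun τ n` in `L²`, for `n ≠ 0`. -/
def eigenL2 (τ : ℝ) (n : ℤ) : L2 :=
  if h : n ≠ 0 then (memLp_eigenfun τ h).toLp _ else 0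

theorem coeFn_eigenL2 (τ : ℝ) {n : ℤ} (hn : n ≠ 0) : eigenL2 τ n =ᵐ[vol] eigenfun τ n := by
  rw [eigenL2, dif_pos hn]
  exact MemLp.coeFn_toLp _

theorem airyScale_neg (n : ℤ) : airyScale (-n) = airyScale n := by
  rw [airyScale, airyScale, Int.cast_neg, abs_neg]

theorem profile_neg (τ : ℝ) (n : ℤ) : profile τ (-n) = profile τ n := by
  ext x
  rw [profile, profile, airyScale_neg]

theorem eigenval_neg (τ : ℝ) (n : ℤ) : eigenval τ (-n) = eigenval τ n := by
  rw [eigenval, eigenval, Int.cast_neg, abs_neg, neg_sq]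

theorem conj_eigenfun (τ : ℝ) (n : ℤ) (p : ℝ × Circ) :
    conj (eigenfun τ n p) = eigenfun τ (-n) p := by
  rw [eigenfun_eq_sep, eigenfun_eq_sep, sep, sep, profile_neg, map_mul, fourier_neg, profile_eq,
    Complex.conj_ofReal]

/-- Since `Ai` is real, conjugation replaces `n` by `-n`. This turns the Hermitian product into the
bilinear pairing for which the realization is symmetric. -/
theorem inner_eigenL2 (τ : ℝ) {n : ℤ} (hn : n ≠ 0) (u : L2) :
    inner ℂ (eigenL2 τ n) u = ∫ p, u p * eigenfun τ (-n) p ∂vol := by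
  rw [L2.inner_def]
  refine integral_congr_ae ?_
  filter_upwards [coeFn_eigenL2 τ hn] with p hp
  rw [hp, RCLike.inner_apply, conj_eigenfun]

theorem inner_eigenL2_eq_fourierSection (τ : ℝ) {n : ℤ} (hn : n ≠ 0) (u : L2) :
    inner ℂ (eigenL2 τ n) u = ∫ x, fourierSection u n x * profile τ n x ∂halfVol := by
  rw [inner_eigenL2 τ hn]
  have hi : Integrable (fun p => u p * eigenfun τ (-n) p) vol :=
    (Lp.memLp u).integrable_mul (memLp_eigenfun τ (neg_ne_zero.2 hn))
  refine (integral_prod (μ := halfVol) (ν := (volume : Measure Circ)) _ hi).trans ?_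
  refine integral_congr_ae (.of_forall fun x => ?_)
  simp only [fourierSection]
  rw [← integral_mul_const]
  refine integral_congr_ae (.of_forall fun y => ?_)
  simp only [eigenfun_eq_sep, sep, profile_neg]
  ring

theorem inner_eigenL2_of_ne (τ τ' : ℝ) {n n' : ℤ} (hn : n ≠ 0) (hn' : n' ≠ 0) (h : n ≠ n') :
    inner ℂ (eigenL2 τ n) (eigenL2 τ' n') = 0 := by
  rw [inner_eigenL2 τ hn]
  have h1 : ∫ p, eigenL2 τ' n' p * eigenfun τ (-n) p ∂vol =
      ∫ p : ℝ × Circ, (profile τ' n' p.1 * profile τ n p.1) * fourier (n' - n) p.2 ∂vol := by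
    refine integral_congr_ae ?_
    filter_upwards [coeFn_eigenL2 τ' hn'] with p hp
    rw [hp, eigenfun_eq_sep, eigenfun_eq_sep, sep, sep, profile_neg, sub_eq_add_neg, fourier_add]
    ring
  rw [h1]
  refine (integral_prod_mul (μ := halfVol) (ν := (volume : Measure Circ))
    (fun x => profile τ' n' x * profile τ n x) (fun y => fourier (n' - n) y)).trans ?_
  rw [integral_fourier_eq_zero (sub_ne_zero.2 h.symm), mul_zero]

theorem zeroMean_eigenL2 (τ : ℝ) {n : ℤ} (hn : n ≠ 0) : ZeroMean (eigenL2 τ n) := by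
  change ∀ᵐ x ∂halfVol, _
  filter_upwards [ae_ae_section (coeFn_eigenL2 τ hn)] with x hx
  rw [integral_congr_ae hx]
  simp only [eigenfun_eq_sep, sep]
  rw [integral_const_mul, integral_fourier_eq_zero hn, mul_zero]

/-- For `x > max 0 (τ / airyScale n)` the argument of `Ai` is nonnegative, so the profile has no
zero on a set of positive measure. -/
theorem eigenL2_ne_zero (τ : ℝ) {n : ℤ} (hn : n ≠ 0) : eigenL2 τ n ≠ 0 := by
  intro h0
  have ha := airyScale_pos hn
  have h1 : ∀ᵐ p ∂vol, eigenfun τ n p = 0 := by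
    filter_upwards [coeFn_eigenL2 τ hn, Lp.coeFn_zero ℂ 2 vol] with p h2 h3
    rw [← h2, h0, h3]; rfl
  have h2 : ∀ᵐ x ∂halfVol, profile τ n x = 0 := by
    filter_upwards [ae_ae_section h1] with x hx
    obtain ⟨y, hy⟩ := hx.exists
    rw [eigenfun_eq_sep] at hy
    rw [← norm_eq_zero, ← norm_sep (profile τ n) n (x, y), hy, norm_zero]
  have h3 : ∀ᵐ x ∂(volume : Measure ℝ), x ∈ Ici (0 : ℝ) → profile τ n x = 0 :=
    (ae_restrict_iff' measurableSet_Ici).1 h2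
  have h4 : ∀ x ∈ Ioi (max 0 (τ / airyScale n)), ¬(x ∈ Ici (0 : ℝ) → profile τ n x = 0) := by
    intro x hx h
    have hx0 : 0 ≤ x := (le_max_left _ _).trans (le_of_lt hx)
    have hx1 : τ / airyScale n ≤ x := (le_max_right _ _).trans (le_of_lt hx)
    have h5 := h hx0
    rw [profile_eq, Complex.ofReal_eq_zero] at h5
    rw [div_le_iff₀ ha] at hx1
    exact airyRe_ne_zero (by linarith) h5
  have h6 := measure_mono_null (μ := volume) (fun x hx => h4 x hx) (ae_iff.1 h3)
  simp at h6

theorem eigenL2_mem_eigenspace {τ : ℝ} (h : airyRe (-τ) = 0) {n : ℤ} (hn : n ≠ 0) :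
    eigenL2 τ n ∈ eigenspace (eigenval τ n : ℂ) :=
  ⟨zeroMean_eigenL2 τ hn, dirichletL_eigenfun h hn (coeFn_eigenL2 τ hn)⟩

/-- Eigenfunctions of distinct eigenvalues are orthogonal. -/
theorem inner_eigenL2_of_mem_eigenspace {τ : ℝ} (h : airyRe (-τ) = 0) {n : ℤ} (hn : n ≠ 0)
    {μ : ℂ} (hμ : (eigenval τ n : ℂ) ≠ μ) {u : L2} (hu : u ∈ eigenspace μ) :
    inner ℂ (eigenL2 τ n) u = 0 := by
  have hn' := neg_ne_zero.2 hn
  -- The pairing is with the mode `-n`, which has the same eigenvalue. Since it is bilinear, `μ`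
  -- need not be known to be real.
  have key := hu.2.integral_mul_comm (dirichletL_eigenfun h hn' (coeFn_eigenL2 τ hn'))
  rw [inner_eigenL2 τ hn]
  have h1 : ∫ p, (μ • u : L2) p * eigenL2 τ (-n) p ∂vol =
      μ * ∫ p, u p * eigenfun τ (-n) p ∂vol := by
    rw [← integral_const_mul]
    refine integral_congr_ae ?_
    filter_upwards [coeFn_eigenL2 τ hn', Lp.coeFn_smul μ u] with p h1 h2
    rw [h1, h2, Pi.smul_apply, smul_eq_mul, mul_assoc]
  have h2 : ∫ p, ((eigenval τ (-n) : ℂ) • eigenL2 τ (-n) : L2) p * u p ∂vol =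
      (eigenval τ n : ℂ) * ∫ p, u p * eigenfun τ (-n) p ∂vol := by
    rw [← integral_const_mul]
    refine integral_congr_ae ?_
    filter_upwards [coeFn_eigenL2 τ hn', Lp.coeFn_smul (eigenval τ (-n) : ℂ) (eigenL2 τ (-n))]
      with p h1 h2
    rw [h2, Pi.smul_apply, h1, smul_eq_mul, eigenval_neg]
    ring
  rw [h1, h2] at key
  by_contra h0
  exact hμ (mul_right_cancel₀ h0 key.symm)

/-- A function orthogonal to all `eigenL2` is orthogonal to all functions of zero mean. -/
theorem inner_eq_zero_of_zeroMean {w u : L2}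
    (hw : ∀ τ, airyRe (-τ) = 0 → ∀ n : ℤ, n ≠ 0 → inner ℂ (eigenL2 τ n) w = 0)
    (hu : ZeroMean u) : inner ℂ w u = 0 := by
  -- Completeness in `x`, mode by mode: for almost every `x` only the zeroth Fourier coefficient of
  -- `w (x, ·)` can survive, and that one is orthogonal to a function of zero mean.
  have hsec : ∀ᵐ x ∂halfVol, ∀ n : ℤ, n ≠ 0 → fourierSection w n x = 0 := by
    refine ae_all_iff.2 fun n => ?_
    by_cases hn : n = 0
    · exact .of_forall fun x h => absurd hn h
    · filter_upwards [ae_eq_zero_of_forall_integral_airyAi (memLp_fourierSection w n)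
        (airyScale_pos hn) fun τ hτ => (inner_eigenL2_eq_fourierSection τ hn w).symm.trans
          (hw τ hτ n hn)] with x hx _
      exact hx
  have hi : Integrable (fun p => u p * conj (w p)) vol :=
    (Lp.memLp u).integrable_mul (Lp.memLp w).star
  have h1 : inner ℂ w u = ∫ p, u p * conj (w p) ∂vol := by
    rw [L2.inner_def]
    simp_rw [RCLike.inner_apply]
  rw [h1]
  refine (integral_prod (μ := halfVol) (ν := (volume : Measure Circ)) _ hi).trans ?_
  refine integral_eq_zero_of_ae ?_
  have hu' : ∀ᵐ x ∂halfVol, ∫ y : Circ, u (x, y) = 0 := hu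
  filter_upwards [hsec, hu', ae_memLp_section u, ae_memLp_section w] with x h2 h3 h4 h5
  exact integral_mul_conj_eq_zero h4 h5 h3 h2

/-! ### Enumeration of the eigenvalues and identification of the eigenspaces -/

section Enumeration

variable {t : ℕ → ℝ}

theorem mem_topologicalClosure_span (ht : range t = {s | airyRe (-s) = 0}) {u : L2}
    (hu : ZeroMean u) :
    u ∈ (Submodule.span ℂ
      {v : L2 | ∃ (m : ℕ) (n : ℤ), n ≠ 0 ∧ v = eigenL2 (t m) n}).topologicalClosure := by
  rw [← Submodule.orthogonal_orthogonal_eq_closure, Submodule.mem_orthogonal]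
  intro w hw
  refine inner_eq_zero_of_zeroMean (fun τ hτ n hn => ?_) hu
  obtain ⟨m, rfl⟩ : τ ∈ range t := by rw [ht]; exact hτ
  exact (Submodule.mem_orthogonal _ _).1 hw _ (Submodule.subset_span ⟨m, n, hn, rfl⟩)

theorem eigenval_injective {τ τ' : ℝ} {n : ℤ} (hn : n ≠ 0) (h : eigenval τ n = eigenval τ' n) :
    τ = τ' := by
  have h1 : 0 < |(n : ℝ)| ^ (4 / 3 : ℝ) :=
    Real.rpow_pos_of_pos (abs_pos.2 (Int.cast_ne_zero.2 hn)) _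
  exact mul_left_cancel₀ h1.ne' (add_left_cancel h)

/-- As `n² ≤ λ(m,n)`, only finitely many `n` occur, and for fixed `n ≠ 0` the eigenvalue determines
`t m`. Finiteness provides the orthogonal projection used in `mem_eigenspace_iff`. -/
theorem finite_eigenval_eq (hm : StrictMono t) (hpos : ∀ m, 0 < t m) (μ : ℂ) :
    {p : ℕ × ℤ | p.2 ≠ 0 ∧ (eigenval (t p.1) p.2 : ℂ) = μ}.Finite := by
  refine Finite.of_finite_image (f := Prod.snd)
    ((finite_Icc (-⌈‖μ‖⌉) ⌈‖μ‖⌉).subset ?_) ?_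
  · rintro _ ⟨⟨m, n⟩, ⟨hn, h⟩, rfl⟩
    have h1 : (n : ℝ) ^ 2 ≤ ‖μ‖ := by
      rw [← h, Complex.norm_real, eigenval]
      refine le_trans ?_ (le_abs_self _)
      have := mul_nonneg (Real.rpow_nonneg (abs_nonneg (n : ℝ)) (4 / 3)) (hpos m).le
      linarith
    have h2 : (n : ℝ) ^ 2 ≤ (⌈‖μ‖⌉ : ℤ) := h1.trans (Int.le_ceil _)
    have h3 : n ^ 2 ≤ ⌈‖μ‖⌉ := by exact_mod_cast h2
    have h4 : |n| ≤ n ^ 2 := by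
      rw [← sq_abs]
      nlinarith [Int.one_le_abs hn]
    exact abs_le.1 (h4.trans h3)
  · rintro ⟨m, n⟩ ⟨hn, h⟩ ⟨m', n'⟩ ⟨_, h'⟩ rfl
    have h1 : eigenval (t m) n = eigenval (t m') n := by exact_mod_cast h.trans h'.symm
    rw [hm.injective (eigenval_injective hn h1)]

/-- For `u` in the eigenspace and `v` its projection on the span, `u - v` is again in the
eigenspace. It is orthogonal to the `eigenL2` of eigenvalue `μ` by projection and to the others by
symmetry; having zero mean, it is then orthogonal to itself. -/
theorem mem_eigenspace_iff (hm : StrictMono t) (hpos : ∀ m, 0 < t m)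
    (ht : range t = {s | airyRe (-s) = 0}) {μ : ℂ} {u : L2} :
    u ∈ eigenspace μ ↔ u ∈ Submodule.span ℂ
      {v : L2 | ∃ (m : ℕ) (n : ℤ), n ≠ 0 ∧ (eigenval (t m) n : ℂ) = μ ∧ v = eigenL2 (t m) n} := by
  have hz : ∀ m, airyRe (-t m) = 0 := fun m => by
    have : t m ∈ range t := mem_range_self m
    rwa [ht] at this
  set S : Set L2 :=
    {v : L2 | ∃ (m : ℕ) (n : ℤ), n ≠ 0 ∧ (eigenval (t m) n : ℂ) = μ ∧ v = eigenL2 (t m) n}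
  have hS : Submodule.span ℂ S ≤ eigenspace μ := by
    refine Submodule.span_le.2 ?_
    rintro _ ⟨m, n, hn, rfl, rfl⟩
    exact eigenL2_mem_eigenspace (hz m) hn
  refine ⟨fun hu => ?_, fun h => hS h⟩
  have hfin : S.Finite := by
    refine ((finite_eigenval_eq hm hpos μ).image fun p => eigenL2 (t p.1) p.2).subset ?_
    rintro _ ⟨m, n, hn, h, rfl⟩
    exact ⟨(m, n), ⟨hn, h⟩, rfl⟩
  have : FiniteDimensional ℂ (Submodule.span ℂ S) := FiniteDimensional.span_of_finite ℂ hfin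
  set v : L2 := (Submodule.span ℂ S).starProjection u with hv
  have hvS : v ∈ Submodule.span ℂ S := Submodule.starProjection_apply_mem _ _
  have hd : u - v ∈ eigenspace μ := sub_mem hu (hS hvS)
  have h0 : inner ℂ (u - v) (u - v) = 0 := by
    refine inner_eq_zero_of_zeroMean (fun τ hτ n hn => ?_) hd.1
    by_cases h : (eigenval τ n : ℂ) = μ
    · obtain ⟨m, rfl⟩ : τ ∈ range t := by rw [ht]; exact hτ
      exact (Submodule.mem_orthogonal _ _).1 (Submodule.sub_starProjection_mem_orthogonal u) _
        (Submodule.subset_span ⟨m, n, hn, h, rfl⟩)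
    · exact inner_eigenL2_of_mem_eigenspace hτ hn h hd
  rw [inner_self_eq_zero, sub_eq_zero] at h0
  rwa [h0]

end Enumeration

end Friedlander

end

theorem proposition1 :
    -- the oscillatory integral that defines `Ai` converges
    (∀ s : ℝ, Tendsto (airyPartial s) atTop (𝓝 (airyAi s))) ∧
    -- the roots of `Ai (-t) = 0` are `0 < t 0 < t 1 < ⋯` (`t m` is the root number `m + 1`)
    ∃ t : ℕ → ℝ, StrictMono t ∧ (∀ m, 0 < t m) ∧ range t = {s : ℝ | airyAi (-s) = 0} ∧
    -- each eigenfunction is smooth, vanishes at `x = 0` and satisfies the equation pointwise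
    (∀ (m : ℕ) (n : ℤ), n ≠ 0 →
      Smooth (eigenfun (t m) n) ∧
      (∀ y : Circ, eigenfun (t m) n (0, y) = 0) ∧
      ∀ (x : ℝ) (y : Circ), 0 ≤ x →
        opL (eigenfun (t m) n) (x, y) = (eigenval (t m) n : ℂ) * eigenfun (t m) n (x, y)) ∧
    -- their classes `Φ m n` in `L²(M)`
    ∃ Φ : ℕ → ℤ → L2,
      (∀ (m : ℕ) (n : ℤ), n ≠ 0 → Φ m n =ᵐ[vol] eigenfun (t m) n) ∧
      -- they are Dirichlet eigenfunctions of zero mean in `y`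
      (∀ (m : ℕ) (n : ℤ), n ≠ 0 →
        IsDirichletEigenfunction (eigenval (t m) n : ℂ) (Φ m n)) ∧
      -- there are no others: the eigenspace of any `μ` is spanned by those with this eigenvalue
      (∀ (μ : ℂ) (u : L2), IsDirichletEigenfunction μ u ↔
        u ≠ 0 ∧ u ∈ Submodule.span ℂ
          {v : L2 | ∃ (m : ℕ) (n : ℤ), n ≠ 0 ∧ (eigenval (t m) n : ℂ) = μ ∧ v = Φ m n}) ∧
      -- they are pairwise orthogonal
      (∀ (m m' : ℕ) (n n' : ℤ), n ≠ 0 → n' ≠ 0 → (m, n) ≠ (m', n') →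
        inner ℂ (Φ m n) (Φ m' n') = 0) ∧
      -- they are complete in the space of functions of zero mean in `y`
      (∀ u : L2, ZeroMean u →
        u ∈ (Submodule.span ℂ
          {v : L2 | ∃ (m : ℕ) (n : ℤ), n ≠ 0 ∧ v = Φ m n}).topologicalClosure) := by
  refine ⟨tendsto_airyPartial, ?_⟩
  obtain ⟨t, hm, hpos, ht⟩ := exists_airy_zeros
  have hz : ∀ m, airyRe (-t m) = 0 := fun m => by
    have : t m ∈ range t := mem_range_self m
    rwa [ht] at this
  refine ⟨t, hm, hpos, ?_, fun m n _ => ⟨smooth_eigenfun _ _, fun y => ?_,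
    fun x y _ => opL_eigenfun _ _ _⟩, fun m n => eigenL2 (t m) n,
    fun m n hn => coeFn_eigenL2 _ hn,
    fun m n hn => isDirichletEigenfunction_iff.2
      ⟨eigenL2_ne_zero _ hn, eigenL2_mem_eigenspace (hz m) hn⟩,
    fun μ u => isDirichletEigenfunction_iff.trans
      (and_congr_right fun _ => mem_eigenspace_iff hm hpos ht), fun m m' n n' hn hn' h => ?_,
    fun u hu => mem_topologicalClosure_span ht hu⟩
  · rw [ht]
    ext s
    simp only [mem_ofPred_eq, airyAi_eq_ofReal, Complex.ofReal_eq_zero]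
  · rw [eigenfun_eq_sep, sep]
    simp only [profile_zero (hz m), zero_mul]
  · by_cases hnn : n = n'
    · subst hnn
      -- For equal `n` and `m ≠ m'` the eigenvalues differ, so no orthogonality integral for Airy
      -- functions is needed; for `n ≠ n'` the characters are orthogonal.
      refine inner_eigenL2_of_mem_eigenspace (hz m) hn (fun he => h ?_)
        (eigenL2_mem_eigenspace (hz m') hn)
      rw [hm.injective (eigenval_injective hn (Complex.ofReal_injective he))]
    · exact inner_eigenL2_of_ne _ _ hn hn' hnn
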